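/- **Setting.** Let $\mathcal S^4\subset\mathbb R^5=\mathbb R^3\oplus\mathbb R^2$ be the unit sphere, with coordinates $(x_1,x_2,x_3,y_1,y_2)$ and its standard orientation, and let $M=\Lambda^2_-(T^*\mathcal S^4)$ and $M_0=M\setminus\mathcal S^4$ (complement of the zero section). For a local oriented orthonormal coframe $b_0,\dots,b_3$ of $\mathcal S^4$ put $\Omega_1=b_0\wedge b_1-b_2\wedge b_3$, $\Omega_2=b_0\wedge b_2-b_3\wedge b_1$, $\Omega_3=b_0\wedge b_3-b_1\wedge b_2$, write points of $M$ as $a_1\Omega_1+a_2\Omega_2+a_3\Omega_3$, let $\zeta_1,\zeta_2,\zeta_3$ be the vertical 1-forms (the covariant differentials of $a_1,a_2,a_3$ for the Levi-Civita connection), and let $r^2=a_1^2+a_2^2+a_3^2$. The Bryant–Salamon metric is $$g_c=(c+r^2)^{-1/2}(\zeta_1^2+\zeta_2^2+\zeta_3^2)+2(c+r^2)^{1/2}(b_0^2+b_1^2+b_2^2+b_3^2),$$ on $M$ if $c>0$ and on $M_0$ if $c=0$. The coassociative fibration $\pi_c:M\to\mathbb R^3$ ($c>0$), respectively $\pi_0:M_0\to\mathbb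 R^3$, is $$\pi_c(p,\eta)=\big(\eta(\partial_{y_1},\partial_{y_2}),\,2(c+r^2)^{1/4}y_1(p),\,2(c+r^2)^{1/4}y_2(p)\big),$$ where the 2-form $\eta$ on $T_p\mathcal S^4$ is extended by zero in the direction normal to $\mathcal S^4$. The coassociative fibres are the fibres of $\pi_c$. If $c>0$, the singular ones are those over the circle $\{(0,w_1,w_2): w_1^2+w_2^2=(2c^{1/4})^2\}$; each of them contains exactly one point (its vertex) in which $\eta=0$ and $x_1=x_2=x_3=0$. If $c=0$, the unique singular fibre is $\pi_0^{-1}(0)$. Fibres, without the vertex if there is one, carry the metric induced by $g_c$. On $\mathrm{SO}(3)\cong\mathbb{RP}^3$ let $\sigma_1,\sigma_2,\sigma_3$ be the standard left-invariant coframe with $d\sigma_1=\sigma_2\wedge\sigma_3$, $d\sigma_2=\sigma_3\wedge\sigma_1$, $d\sigma_3=\sigma_1\wedge\sigma_2$, that is, in Euler angles, $\sigma_1=d\gamma+\cos\theta\,d\phi$, $\sigma_2=\cos\gamma\,d\theta+\sin\gamma\sin\theta\,d\phi$, $\sigma_3=\sin\gamma\,d\theta-\cos\gamma\sin\theta\,d\phi$.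 On $\mathbb R^+\times\mathrm{SO}(3)$ consider the cone metrics $$g_{AC}=dR^2+\tfrac{R^2}{4}\sigma_1^2+\tfrac{R^2}{2}(\sigma_2^2+\sigma_3^2),\qquad g_{CS}=dR^2+\tfrac{R^2}{2}(\sigma_1^2+\sigma_2^2)+R^2\sigma_3^2 .$$ **Proposition.** (a) For every $c\ge 0$, every fibre $F$ of $\pi_c$ (smooth or singular) is asymptotically conical with rate $-2$ (or better) and asymptotic cone $g_{AC}$: the fibre, without its vertex if it has one, is a smooth 4-dimensional submanifold $N$, and there are $R_0>0$, a compact subset $K$ of the total space $\Lambda^2_-(T^*\mathcal S^4)$ and a diffeomorphism $\Psi:(R_0,\infty)\times\mathrm{SO}(3)\to N\setminus K$ such that for all $j\ge 0$, uniformly on $\mathrm{SO}(3)$, $$|\nabla^j(\Psi^*g_c-g_{AC})|=O(R^{-2-j})\quad\text{as }R\to\infty,$$ with $\nabla$ and $|\cdot|$ those of $g_{AC}$. (b) For every $c>0$, every singular fibre $F$ of $\pi_c$ has exactly one vertex $p$ and is conically singular at $p$ with asymptotic cone $g_{CS}$: $N=F\setminus\{p\}$ is a smooth 4-dimensional submanifold,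 and there are $\mu>0$, $\varepsilon>0$, an open neighbourhood $U$ of $p$ and a diffeomorphism $\Psi:(0,\varepsilon)\times\mathrm{SO}(3)\to N\cap U$ with $\Psi(R,A)\to p$ as $R\to0$, uniformly in $A$, such that for all $j\ge 0$, uniformly on $\mathrm{SO}(3)$, $$|\nabla^j(\Psi^*g_c-g_{CS})|=O(R^{\mu-j})\quad\text{as }R\to 0,$$ with $\nabla$ and $|\cdot|$ those of $g_{CS}$. (c) The unique singular fibre $\pi_0^{-1}(0)$ in $M_0$ is a smooth 4-dimensional submanifold, and with the metric induced by $g_0$ it is isometric to the Riemannian cone $(\mathbb R^+\times\mathrm{SO}(3),g_{AC})$. -/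

import Mathlib

open Set Filter Topology Asymptotics
open scoped ContDiff

noncomputable section

/-! ## Smooth maps between subsets of normed spaces -/

/-- `f` restricts to a diffeomorphism of `s` onto `t`. For (embedded) smooth submanifolds `s`, `t` of
normed spaces, `ContDiffOn ℝ ∞ f s` is the usual smoothness of `f` as a map on the manifold `s`. -/
def IsDiffeoOn {V W : Type*} [NormedAddCommGroup V] [NormedSpace ℝ V]
    [NormedAddCommGroup W] [NormedSpace ℝ W] (s : Set V) (t : Set W) (f : V → W) : Prop :=
  ContDiffOn ℝ ∞ f s ∧ f '' s = t ∧
    ∃ h : W → V, ContDiffOn ℝ ∞ h t ∧ ∀ x ∈ s, h (f x) = x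

/-- `N` is an (embedded) smooth submanifold of dimension `d`: each point of `N` has a neighbourhood
in `N` that is diffeomorphic to an open subset of `ℝᵈ`. -/
def IsSmoothSubmanifold {W : Type*} [NormedAddCommGroup W] [NormedSpace ℝ W]
    (d : ℕ) (N : Set W) : Prop :=
  ∀ x ∈ N, ∃ (U : Set W) (V : Set (EuclideanSpace ℝ (Fin d))) (f : EuclideanSpace ℝ (Fin d) → W),
    IsOpen U ∧ x ∈ U ∧ IsOpen V ∧ IsDiffeoOn V (N ∩ U) f

/-! ## The bundle of anti-self-dual 2-forms on the 4-sphere and its Bryant–Salamon metrics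

Coordinates on `ℝ⁵` are `(x₁, x₂, x₃, y₁, y₂)`, indexed by `0, 1, 2, 3, 4`. A 2-form on
`T_p S⁴ = p^⊥` is extended by zero in the direction of `p`, and so it is a skew-symmetric `5 × 5`
matrix `η` with `η p = 0`, where `η(X, Y) = ∑ i j, η i j * X i * Y j`. -/

/-- The linear space in which `Λ²₋(T*S⁴)` lies: pairs (point of `ℝ⁵`, `5 × 5` matrix). -/
abbrev Ambient : Type := (Fin 5 → ℝ) × (Fin 5 → Fin 5 → ℝ)

/-- Components of the volume form `p ⌟ (dx₁ ∧ dx₂ ∧ dx₃ ∧ dy₁ ∧ dy₂)` of the unit sphere at `p`. -/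
def sphereVol (p : Fin 5 → ℝ) (i j k l : Fin 5) : ℝ :=
  Matrix.det (Matrix.of ![p, Pi.single i 1, Pi.single j 1, Pi.single k 1, Pi.single l 1])

/-- The Hodge star, at `p ∈ S⁴`, of the 2-form `η` on `T_p S⁴`. -/
def hodgeStar (p : Fin 5 → ℝ) (η : Fin 5 → Fin 5 → ℝ) (i j : Fin 5) : ℝ :=
  (1 / 2) * ∑ k, ∑ l, sphereVol p i j k l * η k l

/-- The total space of `Λ²₋(T*S⁴)`, where `S⁴` is the unit sphere of `ℝ⁵`. -/
def asdBundle : Set Ambient :=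
  {x | ∑ i, x.1 i ^ 2 = 1 ∧ (∀ i j, x.2 i j = -x.2 j i) ∧ (∀ i, ∑ j, x.2 i j * x.1 j = 0) ∧
    ∀ i j, x.2 i j = -hodgeStar x.1 x.2 i j}

/-- `r² = a₁² + a₂² + a₃²` for the 2-form `a₁ Ω₁ + a₂ Ω₂ + a₃ Ω₃`, where
`Ω₁ = b₀ ∧ b₁ - b₂ ∧ b₃`, `Ω₂ = b₀ ∧ b₂ - b₃ ∧ b₁`, `Ω₃ = b₀ ∧ b₃ - b₁ ∧ b₂` for an oriented
orthonormal coframe `b`; the sum of the squares of the entries of each `Ωᵢ` is `4`. -/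
def rSq (x : Ambient) : ℝ := (1 / 4) * ∑ i, ∑ j, x.2 i j ^ 2

/-- The space on which the structure with parameter `c ≥ 0` lives: all of `M = Λ²₋(T*S⁴)` if `c > 0`,
and `M₀`, the complement of the zero section, if `c = 0`. -/
def totalSpace (c : ℝ) : Set Ambient := {x | x ∈ asdBundle ∧ 0 < c + rSq x}

/-- The vertical part, for the Levi-Civita connection of the round metric, of a tangent vector
`(p', η')` to `Λ²₋(T*S⁴)` at `(p, η)`: the covariant derivative of a field of 2-forms along a curve in
`S⁴` is the tangential projection `P η' P`, `P = 1 - p pᵀ`, of the derivative `η'` in `ℝ⁵`. -/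
def verticalPart (p : Fin 5 → ℝ) (η' : Fin 5 → Fin 5 → ℝ) (i j : Fin 5) : ℝ :=
  ∑ k, ∑ l, ((if i = k then 1 else 0) - p i * p k) * η' k l * ((if l = j then 1 else 0) - p l * p j)

/-- The Bryant–Salamon metric
`g_c = (c + r²)^(-1/2) (ζ₁² + ζ₂² + ζ₃²) + 2 (c + r²)^(1/2) (b₀² + b₁² + b₂² + b₃²)`
on `Λ²₋(T*S⁴)`, where `b` is an orthonormal coframe of the unit sphere and `ζ₁, ζ₂, ζ₃` are the
vertical 1-forms; it is evaluated on two tangent vectors `X`, `Y` at `x`. -/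
def bsMetric (c : ℝ) (x X Y : Ambient) : ℝ :=
  (Real.sqrt (c + rSq x))⁻¹ *
      ((1 / 4) * ∑ i, ∑ j, verticalPart x.1 X.2 i j * verticalPart x.1 Y.2 i j) +
    2 * Real.sqrt (c + rSq x) * ∑ i, X.1 i * Y.1 i

/-- The fibration `π_c : (p, η) ↦ (η(∂y₁, ∂y₂), 2 (c + r²)^(1/4) y₁, 2 (c + r²)^(1/4) y₂)`.
With `p = (cos α 𝐮, sin α cos β, sin α sin β)`, with the orthonormal coframe
`dα, sin α dβ, cos α dθ, cos α sin θ dφ`, and with `η = t Ω₁ + a₂ Ω₂ + a₃ Ω₃`, it is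
`(t cos α, v cos β, v sin β)` with `v = 2 (c + r²)^(1/4) sin α`. -/
def fibration (c : ℝ) (x : Ambient) : ℝ × ℝ × ℝ :=
  (x.2 3 4, 2 * (c + rSq x) ^ (1 / 4 : ℝ) * x.1 3, 2 * (c + rSq x) ^ (1 / 4 : ℝ) * x.1 4)

/-- The fibre of `π_c` over `w`. -/
def fibre (c : ℝ) (w : ℝ × ℝ × ℝ) : Set Ambient := {x | x ∈ totalSpace c ∧ fibration c x = w}

/-- The values over which the fibre is singular: the circle `u = 0`, `v = 2 c^(1/4)` if `c > 0`,
and the origin if `c = 0`. -/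
def singularValues (c : ℝ) : Set (ℝ × ℝ × ℝ) :=
  {w | w.1 = 0 ∧ w.2.1 ^ 2 + w.2.2 ^ 2 = (2 * c ^ (1 / 4 : ℝ)) ^ 2}

/-- The zero vectors over the circle `x₁ = x₂ = x₃ = 0` of `S⁴` (the fixed points of `SO(3)`);
in `M`, these are the vertices of the singular fibres. -/
def vertices : Set Ambient := {x | x.1 0 = 0 ∧ x.1 1 = 0 ∧ x.1 2 = 0 ∧ x.2 = 0}

/-- The smooth locus of the fibre over `w`: the fibre without its vertex, if it has one. -/
def smoothFibre (c : ℝ) (w : ℝ × ℝ × ℝ) : Set Ambient := fibre c w \ vertices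

/-- Only fibres over `singularValues c` have a vertex; the other ones are equal to their smooth
locus. -/
theorem smoothFibre_eq_fibre (c : ℝ) (w : ℝ × ℝ × ℝ) (hw : w ∉ singularValues c) :
    smoothFibre c w = fibre c w := by
  refine sdiff_eq_left.2 (Set.disjoint_left.2 ?_)
  rintro ⟨p, η⟩ ⟨⟨⟨hp, -⟩, -⟩, hx⟩ ⟨h0, h1, h2, h3⟩
  apply hw
  simp only [Fin.sum_univ_five] at hp h0 h1 h2 h3
  subst h3
  rw [h0, h1, h2] at hp
  rw [← hx]
  simp only [singularValues, fibration, rSq, mem_ofPred_eq, Pi.zero_apply, ne_eq, OfNat.ofNat_ne_zero,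
    not_false_eq_true, zero_pow, Finset.sum_const_zero, mul_zero, add_zero, true_and]
  linear_combination (2 * c ^ (1 / 4 : ℝ)) ^ 2 * hp

theorem singularValues_zero : singularValues 0 = {0} := by
  ext ⟨a, b, d⟩
  have h4 : (0 : ℝ) ^ (1 / 4 : ℝ) = 0 := Real.zero_rpow (by norm_num)
  simp only [singularValues, mem_ofPred_eq, h4, mem_singleton_iff, Prod.ext_iff, Prod.fst_zero,
    Prod.snd_zero]
  constructor
  · rintro ⟨ha, h⟩
    exact ⟨ha, by nlinarith [sq_nonneg b, sq_nonneg d], by nlinarith [sq_nonneg b, sq_nonneg d]⟩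
  · rintro ⟨rfl, rfl, rfl⟩
    simp

/-! ## Riemannian cones over `SO(3)` with a left-invariant link metric -/

/-- The group `SO(3)`, diffeomorphic to `ℝℙ³`, as a subset of the space of `3 × 3` matrices. -/
def SO3 : Set (Fin 3 → Fin 3 → ℝ) :=
  {A | Matrix.of A ∈ Matrix.specialOrthogonalGroup (Fin 3) ℝ}

/-- The linear space in which `ℝ⁺ × SO(3)` lies. -/
abbrev ConeSpace : Type := ℝ × (Fin 3 → Fin 3 → ℝ)

/-- The one-parameter groups of rotations about the first, third and second axis of `ℝ³`; their
velocities `E 0, E 1, E 2` at `t = 0` satisfy `[E 0, E 1] = -E 2`, `[E 1, E 2] = -E 0`,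
`[E 2, E 0] = -E 1`. The left-invariant 1-forms `σ₁, σ₂, σ₃` are defined by
`A⁻¹ dA = σ₁ E 0 + σ₂ E 1 + σ₃ E 2`, so that `dσ₁ = σ₂ ∧ σ₃`, `dσ₂ = σ₃ ∧ σ₁`, `dσ₃ = σ₁ ∧ σ₂`.
In the coordinates `A = so3Rotation 0 φ * so3Rotation 1 θ * so3Rotation 0 γ` they are
`σ₁ = dγ + cos θ dφ`, `σ₂ = cos γ dθ + sin γ sin θ dφ`, `σ₃ = sin γ dθ - cos γ sin θ dφ`. -/
def so3Rotation : Fin 3 → ℝ → Fin 3 → Fin 3 → ℝ :=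
  ![fun t => ![![1, 0, 0], ![0, Real.cos t, -Real.sin t], ![0, Real.sin t, Real.cos t]],
    fun t => ![![Real.cos t, -Real.sin t, 0], ![Real.sin t, Real.cos t, 0], ![0, 0, 1]],
    fun t => ![![Real.cos t, 0, Real.sin t], ![0, 1, 0], ![-Real.sin t, 0, Real.cos t]]]

/-- The derivative of a function on `ℝ⁺ × SO(3)` along the orthonormal frame of the cone metric
`dR² + R² (a₁ σ₁² + a₂ σ₂² + a₃ σ₃²)`. Here `none` is the index of `∂_R`, and `some i` that of
`X_i / (R √a_i)`, where `X₁, X₂, X₃` is the frame of left-invariant vector fields dual to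
`σ₁, σ₂, σ₃`, with flows `A ↦ A * so3Rotation i t`. -/
def frameDeriv {V : Type*} [NormedAddCommGroup V] [NormedSpace ℝ V] (a : Fin 3 → ℝ)
    (f : ConeSpace → V) : Option (Fin 3) → ConeSpace → V
  | none, x => deriv (fun t => f (t, x.2)) x.1
  | some i, x => (x.1 * Real.sqrt (a i))⁻¹ •
      deriv (fun t => f (x.1, fun k l => ∑ m, x.2 k m * so3Rotation i t m l)) 0

/-- The Levi-Civita symbol `ε_{ijk}` on three indices. -/
def leviCivita (i j k : Fin 3) : ℝ :=
  (((i : ℕ) : ℝ) - ((j : ℕ) : ℝ)) * (((j : ℕ) : ℝ) - ((k : ℕ) : ℝ)) *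
    (((k : ℕ) : ℝ) - ((i : ℕ) : ℝ)) / 2

/-- The coefficients in `[e_b, e_c] = ∑ d, (frameBracket a R b c d) e_d` of the Lie brackets of the
orthonormal frame, at radius `R`. -/
def frameBracket (a : Fin 3 → ℝ) (R : ℝ) :
    Option (Fin 3) → Option (Fin 3) → Option (Fin 3) → ℝ
  | none, some i, some k => if i = k then -R⁻¹ else 0
  | some i, none, some k => if i = k then R⁻¹ else 0
  | some i, some j, some k =>
      -leviCivita i j k * (Real.sqrt (a k) / (R * Real.sqrt (a i) * Real.sqrt (a j)))
  | _, _, _ => 0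

/-- The coefficients in `∇_{e_b} e_c = ∑ d, (connectionCoeff a R b c d) e_d` of the Levi-Civita
connection of the cone metric (the Koszul formula in an orthonormal frame). -/
def connectionCoeff (a : Fin 3 → ℝ) (R : ℝ) (b c d : Option (Fin 3)) : ℝ :=
  (frameBracket a R b c d - frameBracket a R c d b + frameBracket a R d b c) / 2

/-- The covariant derivative of a covariant `k`-tensor given by its components in the orthonormal
frame: `(∇T)(e_{I 0}, e_{I 1}, …) = e_{I 0} (T(e_{I 1}, …)) - ∑ m, T(…, ∇_{e_{I 0}} e_{I (m+1)}, …)`. -/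
def covDeriv (a : Fin 3 → ℝ) {k : ℕ} (T : (Fin k → Option (Fin 3)) → ConeSpace → ℝ) :
    (Fin (k + 1) → Option (Fin 3)) → ConeSpace → ℝ := fun I x =>
  frameDeriv a (T (Fin.tail I)) (I 0) x -
    ∑ m : Fin k, ∑ d : Option (Fin 3),
      connectionCoeff a x.1 (I 0) (I m.succ) d * T (Function.update (Fin.tail I) m d) x

/-- The `j`-th covariant derivative `∇ʲ T` of a covariant 2-tensor `T`. -/
def iterCovDeriv (a : Fin 3 → ℝ) (T : (Fin 2 → Option (Fin 3)) → ConeSpace → ℝ) :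
    (j : ℕ) → (Fin (2 + j) → Option (Fin 3)) → ConeSpace → ℝ
  | 0 => T
  | j + 1 => covDeriv a (iterCovDeriv a T j)

/-- The pointwise norm, for the cone metric, of a tensor given by its components in the orthonormal
frame. -/
def tensorNorm {k : ℕ} (T : (Fin k → Option (Fin 3)) → ConeSpace → ℝ) (x : ConeSpace) : ℝ :=
  Real.sqrt (∑ I, T I x ^ 2)

/-- The components in the orthonormal frame of `Ψ^* g - g₀`, where
`g₀ = dR² + R² (a₁ σ₁² + a₂ σ₂² + a₃ σ₃²)` and `g` is a field of bilinear forms. -/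
def metricDifference (a : Fin 3 → ℝ) (g : Ambient → Ambient → Ambient → ℝ)
    (Ψ : ConeSpace → Ambient) : (Fin 2 → Option (Fin 3)) → ConeSpace → ℝ := fun I x =>
  g (Ψ x) (frameDeriv a Ψ (I 0) x) (frameDeriv a Ψ (I 1) x) - if I 0 = I 1 then 1 else 0

/-- `N`, with the metric induced by `g`, is a Riemannian 4-manifold that is asymptotically conical
with rate `lam` and asymptotic cone
`(ℝ⁺ × SO(3), dR² + R² (a₁ σ₁² + a₂ σ₂² + a₃ σ₃²))`.
The complement of the end in `N` is `N ∩ K` for a compact subset `K` of the surrounding space.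
So it is compact if `N` is closed; otherwise it may contain punctured neighbourhoods of
singular points that are not in `N`. -/
def IsAsymptoticallyConical (a : Fin 3 → ℝ) (lam : ℝ) (g : Ambient → Ambient → Ambient → ℝ)
    (N : Set Ambient) : Prop :=
  IsSmoothSubmanifold 4 N ∧
  ∃ (R₀ : ℝ) (K : Set Ambient) (Ψ : ConeSpace → Ambient), 0 < R₀ ∧ IsCompact K ∧
    IsDiffeoOn (Ioi R₀ ×ˢ SO3) (N \ K) Ψ ∧
    ∀ j : ℕ, (fun x => tensorNorm (iterCovDeriv a (metricDifference a g Ψ) j) x)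
      =O[atTop ×ˢ 𝓟 SO3] fun x => x.1 ^ (lam - j)

/-- `N`, with the metric induced by `g`, is a Riemannian 4-manifold that is conically singular at the
point `p` (which is not in `N`) with some positive rate and with asymptotic cone
`(ℝ⁺ × SO(3), dR² + R² (a₁ σ₁² + a₂ σ₂² + a₃ σ₃²))`. -/
def IsConicallySingularAt (a : Fin 3 → ℝ) (g : Ambient → Ambient → Ambient → ℝ)
    (N : Set Ambient) (p : Ambient) : Prop :=
  IsSmoothSubmanifold 4 N ∧ p ∉ N ∧
  ∃ (μ ε : ℝ) (U : Set Ambient) (Ψ : ConeSpace → Ambient), 0 < μ ∧ 0 < ε ∧ IsOpen U ∧ p ∈ U ∧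
    IsDiffeoOn (Ioo 0 ε ×ˢ SO3) (N ∩ U) Ψ ∧
    Tendsto Ψ (𝓝[>] 0 ×ˢ 𝓟 SO3) (𝓝 p) ∧
    ∀ j : ℕ, (fun x => tensorNorm (iterCovDeriv a (metricDifference a g Ψ) j) x)
      =O[𝓝[>] 0 ×ˢ 𝓟 SO3] fun x => x.1 ^ (μ - j)

/-- `N`, with the metric induced by `g`, is a Riemannian 4-manifold isometric to the cone
`(ℝ⁺ × SO(3), dR² + R² (a₁ σ₁² + a₂ σ₂² + a₃ σ₃²))`. -/
def IsRiemannianCone (a : Fin 3 → ℝ) (g : Ambient → Ambient → Ambient → ℝ)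
    (N : Set Ambient) : Prop :=
  IsSmoothSubmanifold 4 N ∧
  ∃ Ψ : ConeSpace → Ambient, IsDiffeoOn (Ioi 0 ×ˢ SO3) N Ψ ∧
    ∀ x ∈ Ioi (0 : ℝ) ×ˢ SO3, ∀ I, metricDifference a g Ψ I x = 0

/-- Link coefficients of `dR² + (R²/4) σ₁² + (R²/2) (σ₂² + σ₃²)`. -/
def acLink : Fin 3 → ℝ := ![1 / 4, 1 / 2, 1 / 2]

/-- Link coefficients of `dR² + (R²/2) (σ₁² + σ₂²) + R² σ₃²`. -/
def csLink : Fin 3 → ℝ := ![1 / 2, 1 / 2, 1]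

end

/-! The rotations of the `ℝ³` factor preserve all the data, so the problem reduces to functions of
one variable. Write a value of the fibration as `(u, v a, v b)` with `a² + b² = 1`. Base points of
the fibre are `(x, Y (a, b))`, so they lie on the great 3-sphere orthogonal to `(-b, a)`.
Contraction with `(-b, a)` turns an anti-self-dual form into a tangent vector `(f, u (a, b))` of
that sphere, with `r² = |f|² + u²`. Hence the fibre is the set of `(x, f)` in `ℝ³ × ℝ³` with `|x|² +
Y² = 1` and `x · f = -u Y`, where `Y = (v / 2) (c + |f|² + u²)^(-1/4)` (`fibre_eq_image`). These two
equations are independent except at `x = f = 0`, the vertex (`surjective_fderiv_fibreEqs`), so the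
smooth locus is a 4-manifold.

The great sphere is totally geodesic and its normal `(-b, a)` is parallel. The metric is therefore
`W⁻¹ (|f'|² - (x · f')²) + 2 W (|x'|² + y'²)`, with `W = √(c + r²)` (`bsMetric_asdTangent`). Where
`x` and `f` are linearly independent, `SO(3)` acts freely, and each orbit contains exactly one pair
`x = (C, 0, 0)`, `f = (τ, 0, ρ)` with `C, ρ > 0`. A curve of such pairs gives a chart `(R, A) ↦ A ·
γ(R)` (`isDiffeoOn_orbitMap`), in which the metric components in the left-invariant frame depend on
`R` alone (`metricDifference_eq_gramDefect`).

On the end, take `R = 2 (c + r²)^(1/4)`. Then `Y = v / R`, `W = R² / 4`, `ρ ~ R² / 4`, and the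
difference from the cone metric is `R⁻²` times a function analytic in `1 / R` at `0`. For `c = u = v
= 0` the difference vanishes identically and the chart covers the whole fibre, which gives the exact
cone. At a vertex, `u = 0`, `c = d⁴`, `v = 2 d`; take `R = 2 d |x|`. The sphere equation gives `W =
d² / (1 - C²)`, and the difference is analytic in `R` and zero at `R = 0`, so rate `1` works.

The derivative estimates need no further computation. Invariant tensors with components `R^m k(σ)`,
where `σ` is `1 / R` or `R` and `k` is analytic at `0`, are mapped by `∇` to tensors of the same
kind with `m - 1` for `m` (`HasConeOrder.covDeriv`), and `k(σ)` is bounded. -/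

noncomputable section

/-! ### The Hodge star of the sphere in coordinates -/

theorem sphereVol_self (p : Fin 5 → ℝ) (i j k : Fin 5) : sphereVol p i j k k = 0 := by
  unfold sphereVol
  exact Matrix.det_zero_of_row_eq (i := 3) (j := 4) (by decide) rfl

theorem sphereVol_left_left (p : Fin 5 → ℝ) (i j k : Fin 5) : sphereVol p i j i k = 0 := by
  unfold sphereVol
  exact Matrix.det_zero_of_row_eq (i := 1) (j := 3) (by decide) rfl

theorem sphereVol_left_right (p : Fin 5 → ℝ) (i j k : Fin 5) : sphereVol p i j k i = 0 := by
  unfold sphereVol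
  exact Matrix.det_zero_of_row_eq (i := 1) (j := 4) (by decide) rfl

theorem sphereVol_right_left (p : Fin 5 → ℝ) (i j k : Fin 5) : sphereVol p i j j k = 0 := by
  unfold sphereVol
  exact Matrix.det_zero_of_row_eq (i := 2) (j := 3) (by decide) rfl

theorem sphereVol_right_right (p : Fin 5 → ℝ) (i j k : Fin 5) : sphereVol p i j k j = 0 := by
  unfold sphereVol
  exact Matrix.det_zero_of_row_eq (i := 2) (j := 4) (by decide) rfl

theorem sphereVol_swap_right (p : Fin 5 → ℝ) (i j k l : Fin 5) :
    sphereVol p i j l k = -sphereVol p i j k l := by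
  unfold sphereVol
  have h := Matrix.det_permute (Equiv.swap (3 : Fin 5) 4)
    (Matrix.of ![p, Pi.single i 1, Pi.single j 1, Pi.single k 1, Pi.single l 1] : Matrix _ _ ℝ)
  rw [Equiv.Perm.sign_swap (by decide)] at h
  simp only [Units.val_neg, Units.val_one, Int.cast_neg, Int.cast_one, neg_mul, one_mul] at h
  rw [← h]
  congr 1
  ext a b
  fin_cases a <;> rfl

theorem sphereVol_swap_left (p : Fin 5 → ℝ) (i j k l : Fin 5) :
    sphereVol p j i k l = -sphereVol p i j k l := by
  unfold sphereVol
  have h := Matrix.det_permute (Equiv.swap (1 : Fin 5) 2)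
    (Matrix.of ![p, Pi.single i 1, Pi.single j 1, Pi.single k 1, Pi.single l 1] : Matrix _ _ ℝ)
  rw [Equiv.Perm.sign_swap (by decide)] at h
  simp only [Units.val_neg, Units.val_one, Int.cast_neg, Int.cast_one, neg_mul, one_mul] at h
  rw [← h]
  congr 1
  ext a b
  fin_cases a <;> rfl

/-- Permuting the columns by `σ` makes the matrix upper triangular with diagonal `p (σ 0), 1, 1, 1,
1`. -/
theorem sphereVol_perm (p : Fin 5 → ℝ) (σ : Equiv.Perm (Fin 5)) :
    sphereVol p (σ 1) (σ 2) (σ 3) (σ 4) = ((Equiv.Perm.sign σ : ℤ) : ℝ) * p (σ 0) := by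
  have h := Matrix.det_permute' σ (Matrix.of ![p, Pi.single (σ 1) 1, Pi.single (σ 2) 1,
    Pi.single (σ 3) 1, Pi.single (σ 4) 1] : Matrix (Fin 5) (Fin 5) ℝ)
  have hB : ((Matrix.of ![p, Pi.single (σ 1) 1, Pi.single (σ 2) 1,
      Pi.single (σ 3) 1, Pi.single (σ 4) 1] : Matrix (Fin 5) (Fin 5) ℝ).submatrix id σ).det =
      p (σ 0) := by
    rw [Matrix.det_of_isUpperTriangular]
    · simp [Fin.prod_univ_five]
    · intro i j hij
      fin_cases i <;> fin_cases j <;> simp at hij ⊢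
  rw [hB] at h
  rw [h, ← mul_assoc, ← Int.cast_mul, ← Units.val_mul, Int.units_mul_self]
  simp [sphereVol]

theorem hodgeStar_swap (p : Fin 5 → ℝ) (η : Fin 5 → Fin 5 → ℝ) (i j : Fin 5) :
    hodgeStar p η j i = -hodgeStar p η i j := by
  simp only [hodgeStar, sphereVol_swap_left p i j, neg_mul, Finset.sum_neg_distrib, mul_neg]

/-- Only the three pairs `{k, l}` disjoint from `{i, j}` survive, each weighted by the coordinate of
`p` with the remaining index; the sign is that of an explicit permutation. -/
theorem hodgeStar_of_skew (p : Fin 5 → ℝ) (η : Fin 5 → Fin 5 → ℝ) (h : ∀ i j, η i j = -η j i) :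
    hodgeStar p η 0 1 = p 2 * η 3 4 - p 3 * η 2 4 + p 4 * η 2 3 ∧
    hodgeStar p η 0 2 = - p 1 * η 3 4 + p 3 * η 1 4 - p 4 * η 1 3 ∧
    hodgeStar p η 0 3 = p 1 * η 2 4 - p 2 * η 1 4 + p 4 * η 1 2 ∧
    hodgeStar p η 0 4 = - p 1 * η 2 3 + p 2 * η 1 3 - p 3 * η 1 2 ∧
    hodgeStar p η 1 2 = p 0 * η 3 4 - p 3 * η 0 4 + p 4 * η 0 3 ∧
    hodgeStar p η 1 3 = - p 0 * η 2 4 + p 2 * η 0 4 - p 4 * η 0 2 ∧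
    hodgeStar p η 1 4 = p 0 * η 2 3 - p 2 * η 0 3 + p 3 * η 0 2 ∧
    hodgeStar p η 2 3 = p 0 * η 1 4 - p 1 * η 0 4 + p 4 * η 0 1 ∧
    hodgeStar p η 2 4 = - p 0 * η 1 3 + p 1 * η 0 3 - p 3 * η 0 1 ∧
    hodgeStar p η 3 4 = p 0 * η 1 2 - p 1 * η 0 2 + p 2 * η 0 1 := by
  have e (m i j k l : Fin 5) (σ : Equiv.Perm (Fin 5)) (ε : ℤˣ)
      (hσ : σ 0 = m ∧ σ 1 = i ∧ σ 2 = j ∧ σ 3 = k ∧ σ 4 = l ∧ Equiv.Perm.sign σ = ε) :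
      sphereVol p i j k l = ((ε : ℤ) : ℝ) * p m ∧ sphereVol p i j l k = -(((ε : ℤ) : ℝ) * p m) := by
    obtain ⟨rfl, rfl, rfl, rfl, rfl, rfl⟩ := hσ
    rw [sphereVol_swap_right p _ _ (σ 3), sphereVol_perm]
    exact ⟨rfl, rfl⟩
  simp only [hodgeStar, Fin.sum_univ_five, sphereVol_self, sphereVol_left_left,
    sphereVol_left_right, sphereVol_right_left, sphereVol_right_right, h 1 0, h 2 0, h 3 0, h 4 0,
    h 2 1, h 3 1, h 4 1, h 3 2, h 4 2, h 4 3]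
  refine ⟨?_, ?_, ?_, ?_, ?_, ?_, ?_, ?_, ?_, ?_⟩
  · have ⟨a2, b2⟩ := e 2 0 1 3 4
      ⟨![2, 0, 1, 3, 4], ![1, 2, 0, 3, 4], by decide, by decide⟩ 1 (by decide)
    have ⟨a3, b3⟩ := e 3 0 1 2 4
      ⟨![3, 0, 1, 2, 4], ![1, 2, 3, 0, 4], by decide, by decide⟩ (-1) (by decide)
    have ⟨a4, b4⟩ := e 4 0 1 2 3
      ⟨![4, 0, 1, 2, 3], ![1, 2, 3, 4, 0], by decide, by decide⟩ 1 (by decide)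
    rw [a2, b2, a3, b3, a4, b4]
    push_cast
    ring
  · have ⟨a1, b1⟩ := e 1 0 2 3 4
      ⟨![1, 0, 2, 3, 4], ![1, 0, 2, 3, 4], by decide, by decide⟩ (-1) (by decide)
    have ⟨a3, b3⟩ := e 3 0 2 1 4
      ⟨![3, 0, 2, 1, 4], ![1, 3, 2, 0, 4], by decide, by decide⟩ 1 (by decide)
    have ⟨a4, b4⟩ := e 4 0 2 1 3
      ⟨![4, 0, 2, 1, 3], ![1, 3, 2, 4, 0], by decide, by decide⟩ (-1) (by decide)
    rw [a1, b1, a3, b3, a4, b4]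
    push_cast
    ring
  · have ⟨a1, b1⟩ := e 1 0 3 2 4
      ⟨![1, 0, 3, 2, 4], ![1, 0, 3, 2, 4], by decide, by decide⟩ 1 (by decide)
    have ⟨a2, b2⟩ := e 2 0 3 1 4
      ⟨![2, 0, 3, 1, 4], ![1, 3, 0, 2, 4], by decide, by decide⟩ (-1) (by decide)
    have ⟨a4, b4⟩ := e 4 0 3 1 2
      ⟨![4, 0, 3, 1, 2], ![1, 3, 4, 2, 0], by decide, by decide⟩ 1 (by decide)
    rw [a1, b1, a2, b2, a4, b4]
    push_cast
    ring
  · have ⟨a1, b1⟩ := e 1 0 4 2 3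
      ⟨![1, 0, 4, 2, 3], ![1, 0, 3, 4, 2], by decide, by decide⟩ (-1) (by decide)
    have ⟨a2, b2⟩ := e 2 0 4 1 3
      ⟨![2, 0, 4, 1, 3], ![1, 3, 0, 4, 2], by decide, by decide⟩ 1 (by decide)
    have ⟨a3, b3⟩ := e 3 0 4 1 2
      ⟨![3, 0, 4, 1, 2], ![1, 3, 4, 0, 2], by decide, by decide⟩ (-1) (by decide)
    rw [a1, b1, a2, b2, a3, b3]
    push_cast
    ring
  · have ⟨a0, b0⟩ := e 0 1 2 3 4
      ⟨![0, 1, 2, 3, 4], ![0, 1, 2, 3, 4], by decide, by decide⟩ 1 (by decide)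
    have ⟨a3, b3⟩ := e 3 1 2 0 4
      ⟨![3, 1, 2, 0, 4], ![3, 1, 2, 0, 4], by decide, by decide⟩ (-1) (by decide)
    have ⟨a4, b4⟩ := e 4 1 2 0 3
      ⟨![4, 1, 2, 0, 3], ![3, 1, 2, 4, 0], by decide, by decide⟩ 1 (by decide)
    rw [a0, b0, a3, b3, a4, b4]
    push_cast
    ring
  · have ⟨a0, b0⟩ := e 0 1 3 2 4
      ⟨![0, 1, 3, 2, 4], ![0, 1, 3, 2, 4], by decide, by decide⟩ (-1) (by decide)
    have ⟨a2, b2⟩ := e 2 1 3 0 4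
      ⟨![2, 1, 3, 0, 4], ![3, 1, 0, 2, 4], by decide, by decide⟩ 1 (by decide)
    have ⟨a4, b4⟩ := e 4 1 3 0 2
      ⟨![4, 1, 3, 0, 2], ![3, 1, 4, 2, 0], by decide, by decide⟩ (-1) (by decide)
    rw [a0, b0, a2, b2, a4, b4]
    push_cast
    ring
  · have ⟨a0, b0⟩ := e 0 1 4 2 3
      ⟨![0, 1, 4, 2, 3], ![0, 1, 3, 4, 2], by decide, by decide⟩ 1 (by decide)
    have ⟨a2, b2⟩ := e 2 1 4 0 3
      ⟨![2, 1, 4, 0, 3], ![3, 1, 0, 4, 2], by decide, by decide⟩ (-1) (by decide)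
    have ⟨a3, b3⟩ := e 3 1 4 0 2
      ⟨![3, 1, 4, 0, 2], ![3, 1, 4, 0, 2], by decide, by decide⟩ 1 (by decide)
    rw [a0, b0, a2, b2, a3, b3]
    push_cast
    ring
  · have ⟨a0, b0⟩ := e 0 2 3 1 4
      ⟨![0, 2, 3, 1, 4], ![0, 3, 1, 2, 4], by decide, by decide⟩ 1 (by decide)
    have ⟨a1, b1⟩ := e 1 2 3 0 4
      ⟨![1, 2, 3, 0, 4], ![3, 0, 1, 2, 4], by decide, by decide⟩ (-1) (by decide)
    have ⟨a4, b4⟩ := e 4 2 3 0 1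
      ⟨![4, 2, 3, 0, 1], ![3, 4, 1, 2, 0], by decide, by decide⟩ 1 (by decide)
    rw [a0, b0, a1, b1, a4, b4]
    push_cast
    ring
  · have ⟨a0, b0⟩ := e 0 2 4 1 3
      ⟨![0, 2, 4, 1, 3], ![0, 3, 1, 4, 2], by decide, by decide⟩ (-1) (by decide)
    have ⟨a1, b1⟩ := e 1 2 4 0 3
      ⟨![1, 2, 4, 0, 3], ![3, 0, 1, 4, 2], by decide, by decide⟩ 1 (by decide)
    have ⟨a3, b3⟩ := e 3 2 4 0 1
      ⟨![3, 2, 4, 0, 1], ![3, 4, 1, 0, 2], by decide, by decide⟩ (-1) (by decide)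
    rw [a0, b0, a1, b1, a3, b3]
    push_cast
    ring
  · have ⟨a0, b0⟩ := e 0 3 4 1 2
      ⟨![0, 3, 4, 1, 2], ![0, 3, 4, 1, 2], by decide, by decide⟩ 1 (by decide)
    have ⟨a1, b1⟩ := e 1 3 4 0 2
      ⟨![1, 3, 4, 0, 2], ![3, 0, 4, 1, 2], by decide, by decide⟩ (-1) (by decide)
    have ⟨a2, b2⟩ := e 2 3 4 0 1
      ⟨![2, 3, 4, 0, 1], ![3, 4, 0, 1, 2], by decide, by decide⟩ 1 (by decide)
    rw [a0, b0, a1, b1, a2, b2]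
    push_cast
    ring

/-! ### Anti-self-dual forms over a great 3-sphere

For a unit vector `n = (a, b)` of the `y`-plane let `v = (-b, a)`. Contraction with `v` identifies
the anti-self-dual forms over the great 3-sphere `v^⊥` with its tangent vectors. -/

/-- The skew matrix with components `e` on `ℝ³`, `n` and `f` on the products of `ℝ³` with the
directions `(a, b)` and `(-b, a)` of the `y`-plane, and `g` on the `y`-plane. -/
def blockForm (a b : ℝ) (e n f : Fin 3 → ℝ) (g : ℝ) : Fin 5 → Fin 5 → ℝ :=
  ![![0, e 2, -e 1, a * n 0 - b * f 0, b * n 0 + a * f 0],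
    ![-e 2, 0, e 0, a * n 1 - b * f 1, b * n 1 + a * f 1],
    ![e 1, -e 0, 0, a * n 2 - b * f 2, b * n 2 + a * f 2],
    ![-(a * n 0 - b * f 0), -(a * n 1 - b * f 1), -(a * n 2 - b * f 2), 0, g],
    ![-(b * n 0 + a * f 0), -(b * n 1 + a * f 1), -(b * n 2 + a * f 2), -g, 0]]

/-- The point `(x, y n)` of `ℝ⁵ = ℝ³ ⊕ ℝ²`, where `n = (a, b)`. -/
def spherePoint (a b : ℝ) (x : Fin 3 → ℝ) (y : ℝ) : Fin 5 → ℝ := ![x 0, x 1, x 2, a * y, b * y]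

/-- The cross product on `ℝ³`. -/
def cross (x y : Fin 3 → ℝ) : Fin 3 → ℝ :=
  ![x 1 * y 2 - x 2 * y 1, x 2 * y 0 - x 0 * y 2, x 0 * y 1 - x 1 * y 0]

/-- The standard inner product of `ℝ³`. -/
def dot (x y : Fin 3 → ℝ) : ℝ := x 0 * y 0 + x 1 * y 1 + x 2 * y 2

/-- The anti-self-dual form over the point `(x, y n)` whose contraction with `v` is `(f, u n)`. -/
def asdPoint (a b u : ℝ) (x f : Fin 3 → ℝ) (y : ℝ) : Ambient :=
  (spherePoint a b x y, blockForm a b (y • f - u • x) (cross f x) f u)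

theorem blockForm_skew (a b : ℝ) (e n f : Fin 3 → ℝ) (g : ℝ) (i j : Fin 5) :
    blockForm a b e n f g i j = -blockForm a b e n f g j i := by
  fin_cases i <;> fin_cases j <;> simp [blockForm]

theorem sum_blockForm_mul (a b : ℝ) (hab : a ^ 2 + b ^ 2 = 1) (e n f e' n' f' : Fin 3 → ℝ)
    (g g' : ℝ) :
    ∑ i, ∑ j, blockForm a b e n f g i j * blockForm a b e' n' f' g' i j =
      2 * (dot e e' + dot n n' + dot f f' + g * g') := by
  simp [Fin.sum_univ_five, blockForm, dot]
  linear_combination (2 * (n 0 * n' 0 + n 1 * n' 1 + n 2 * n' 2) +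
    2 * (f 0 * f' 0 + f 1 * f' 1 + f 2 * f' 2)) * hab

section
variable {a b u y : ℝ} {x f : Fin 3 → ℝ}

/-- The blocks `y f - u x` and `f × x` are what anti-self-duality prescribes once the contraction
`(f, u n)` is given; the other equations follow from the sphere and tangency relations. -/
theorem asdPoint_mem_asdBundle (hab : a ^ 2 + b ^ 2 = 1) (h1 : dot x x + y ^ 2 = 1)
    (h2 : dot x f = -(u * y)) : asdPoint a b u x f y ∈ asdBundle := by
  simp only [dot] at h1 h2
  have hs := blockForm_skew a b (y • f - u • x) (cross f x) f u
  refine ⟨?_, hs, ?_, ?_⟩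
  · simp [asdPoint, spherePoint, Fin.sum_univ_five]
    linear_combination h1 + y ^ 2 * hab
  · intro i
    fin_cases i <;> simp [asdPoint, spherePoint, blockForm, Fin.sum_univ_five, cross]
    · linear_combination y * (f 1 * x 2 - f 2 * x 1) * hab
    · linear_combination y * (f 2 * x 0 - f 0 * x 2) * hab
    · linear_combination y * (f 0 * x 1 - f 1 * x 0) * hab
    · linear_combination b * h2
    · linear_combination -a * h2
  -- Both sides are skew, so the ten entries above the diagonal suffice.
  · have key : ∀ i j : Fin 5, i < j → (asdPoint a b u x f y).2 i j =
        -hodgeStar (asdPoint a b u x f y).1 (asdPoint a b u x f y).2 i j := by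
      obtain ⟨h01, h02, h03, h04, h12, h13, h14, h23, h24, h34⟩ :=
        hodgeStar_of_skew (asdPoint a b u x f y).1 (asdPoint a b u x f y).2 hs
      intro i j hij
      fin_cases i <;> fin_cases j <;> simp only [Fin.reduceFinMk, Fin.reduceLT,
        Fin.zero_eta, Fin.mk_one, lt_self_iff_false, Fin.isValue, Fin.not_lt_zero] at hij ⊢
      · rw [h01]; simp [asdPoint, spherePoint, blockForm, cross]
        linear_combination -y * f 2 * hab
      · rw [h02]; simp [asdPoint, spherePoint, blockForm, cross]
        linear_combination y * f 1 * hab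
      · rw [h03]; simp [asdPoint, spherePoint, blockForm, cross]
        linear_combination b * f 0 * h1 - b * x 0 * h2
      · rw [h04]; simp [asdPoint, spherePoint, blockForm, cross]
        linear_combination -a * f 0 * h1 + a * x 0 * h2
      · rw [h12]; simp [asdPoint, spherePoint, blockForm, cross]
        linear_combination -y * f 0 * hab
      · rw [h13]; simp [asdPoint, spherePoint, blockForm, cross]
        linear_combination b * f 1 * h1 - b * x 1 * h2
      · rw [h14]; simp [asdPoint, spherePoint, blockForm, cross]
        linear_combination -a * f 1 * h1 + a * x 1 * h2
      · rw [h23]; simp [asdPoint, spherePoint, blockForm, cross]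
        linear_combination b * f 2 * h1 - b * x 2 * h2
      · rw [h24]; simp [asdPoint, spherePoint, blockForm, cross]
        linear_combination -a * f 2 * h1 + a * x 2 * h2
      · rw [h34]; simp [asdPoint, spherePoint, blockForm, cross]
        linear_combination -u * h1 + y * h2
    intro i j
    rcases lt_trichotomy i j with h | rfl | h
    · exact key i j h
    · have e1 := hs i i
      have e2 := hodgeStar_swap (asdPoint a b u x f y).1 (asdPoint a b u x f y).2 i i
      change blockForm _ _ _ _ _ _ _ _ = _
      linarith
    · have e1 := hs i j
      have e2 := hodgeStar_swap (asdPoint a b u x f y).1 (asdPoint a b u x f y).2 i j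
      have e3 := key j i h
      change blockForm _ _ _ _ _ _ _ _ = _ at e3
      change blockForm _ _ _ _ _ _ _ _ = _
      linarith

/-- The blocks `(y f - u x, f × x)` and `(f, u)` have the same norm, by Lagrange's identity and `x ·
f = -u y`. -/
theorem rSq_asdPoint (hab : a ^ 2 + b ^ 2 = 1) (h1 : dot x x + y ^ 2 = 1)
    (h2 : dot x f = -(u * y)) : rSq (asdPoint a b u x f y) = dot f f + u ^ 2 := by
  simp only [rSq, asdPoint, pow_two (blockForm _ _ _ _ _ _ _ _), sum_blockForm_mul a b hab]
  simp only [dot, cross, Pi.sub_apply, Pi.smul_apply, smul_eq_mul, Matrix.cons_val] at *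
  linear_combination (1 / 2) * (f 0 ^ 2 + f 1 ^ 2 + f 2 ^ 2 + u ^ 2) * h1 -
    (1 / 2) * (x 0 * f 0 + x 1 * f 1 + x 2 * f 2 + u * y) * h2

end

/-- The `ℝ³`-component of the base point. -/
def basePart (q : Ambient) : Fin 3 → ℝ := ![q.1 0, q.1 1, q.1 2]

/-- The `ℝ³`-component of the contraction of the form with `(-b, a)`. -/
def formPart (a b : ℝ) (q : Ambient) : Fin 3 → ℝ :=
  ![a * q.2 0 4 - b * q.2 0 3, a * q.2 1 4 - b * q.2 1 3, a * q.2 2 4 - b * q.2 2 3]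

theorem basePart_asdPoint (a b u y : ℝ) (x f : Fin 3 → ℝ) : basePart (asdPoint a b u x f y) = x := by
  ext i
  fin_cases i <;> rfl

theorem formPart_asdPoint {a b : ℝ} (hab : a ^ 2 + b ^ 2 = 1) (u y : ℝ) (x f : Fin 3 → ℝ) :
    formPart a b (asdPoint a b u x f y) = f := by
  ext i
  fin_cases i <;> simp [formPart, asdPoint, blockForm]
  · linear_combination f 0 * hab
  · linear_combination f 1 * hab
  · linear_combination f 2 * hab

/-- Converse of `asdPoint_mem_asdBundle`: anti-self-duality recovers the components not involving
`(-b, a)` from the contraction with it, and `η p = 0` in the `y`-directions gives the tangency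
relation. -/
theorem eq_asdPoint_of_mem {a b y : ℝ} (hab : a ^ 2 + b ^ 2 = 1) {q : Ambient} (hq : q ∈ asdBundle)
    (h3 : q.1 3 = a * y) (h4 : q.1 4 = b * y) :
    q = asdPoint a b (q.2 3 4) (basePart q) (formPart a b q) y ∧
      dot (basePart q) (basePart q) + y ^ 2 = 1 ∧
      dot (basePart q) (formPart a b q) = -(q.2 3 4 * y) := by
  obtain ⟨p, η⟩ := q
  obtain ⟨h1, hs, h0, hd⟩ := hq
  replace hs : ∀ i j, η i j = -η j i := hs
  obtain ⟨h01, h02, h03, h04, h12, h13, h14, h23, h24, h34⟩ := hodgeStar_of_skew p η hs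
  have d01 := (hd 0 1).trans (congrArg Neg.neg h01)
  have d02 := (hd 0 2).trans (congrArg Neg.neg h02)
  have d03 := (hd 0 3).trans (congrArg Neg.neg h03)
  have d04 := (hd 0 4).trans (congrArg Neg.neg h04)
  have d12 := (hd 1 2).trans (congrArg Neg.neg h12)
  have d13 := (hd 1 3).trans (congrArg Neg.neg h13)
  have d14 := (hd 1 4).trans (congrArg Neg.neg h14)
  have d23 := (hd 2 3).trans (congrArg Neg.neg h23)
  have d24 := (hd 2 4).trans (congrArg Neg.neg h24)
  have z3 := h0 3
  have z4 := h0 4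
  have hz : ∀ i, η i i = 0 := fun i => by linarith [hs i i]
  simp only [Fin.sum_univ_five, hz] at h1 h3 h4 z3 z4 d01 d02 d03 d04 d12 d13 d14 d23 d24
  have n0 : a * η 0 3 + b * η 0 4 = (a * η 1 4 - b * η 1 3) * p 2 - (a * η 2 4 - b * η 2 3) * p 1 := by
    linear_combination a * d03 + b * d04 - a * η 1 2 * h4 + b * η 1 2 * h3
  have n1 : a * η 1 3 + b * η 1 4 = (a * η 2 4 - b * η 2 3) * p 0 - (a * η 0 4 - b * η 0 3) * p 2 := by
    linear_combination a * d13 + b * d14 + a * η 0 2 * h4 - b * η 0 2 * h3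
  have n2 : a * η 2 3 + b * η 2 4 = (a * η 0 4 - b * η 0 3) * p 1 - (a * η 1 4 - b * η 1 3) * p 0 := by
    linear_combination a * d23 + b * d24 - a * η 0 1 * h4 + b * η 0 1 * h3
  have e2 : η 0 1 = y * (a * η 2 4 - b * η 2 3) - η 3 4 * p 2 := by
    linear_combination d01 + η 2 4 * h3 - η 2 3 * h4
  have e1 : η 0 2 = -(y * (a * η 1 4 - b * η 1 3) - η 3 4 * p 1) := by
    linear_combination d02 - η 1 4 * h3 + η 1 3 * h4
  have e0 : η 1 2 = y * (a * η 0 4 - b * η 0 3) - η 3 4 * p 0 := by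
    linear_combination d12 + η 0 4 * h3 - η 0 3 * h4
  refine ⟨Prod.ext ?_ ?_, ?_, ?_⟩
  · ext i
    fin_cases i <;> simp [asdPoint, spherePoint, basePart, h3, h4]
  · have t3 (i : Fin 5) (n : ℝ) (hn : a * η i 3 + b * η i 4 = n) :
        η i 3 = a * n - b * (a * η i 4 - b * η i 3) := by
      linear_combination -η i 3 * hab + a * hn
    have t4 (i : Fin 5) (n : ℝ) (hn : a * η i 3 + b * η i 4 = n) :
        η i 4 = b * n + a * (a * η i 4 - b * η i 3) := by
      linear_combination -η i 4 * hab + b * hn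
    ext i j
    fin_cases i <;> fin_cases j <;> simp [asdPoint, blockForm, basePart, formPart, cross, hz]
    · exact e2
    · linear_combination e1
    · exact t3 0 _ n0
    · exact t4 0 _ n0
    · linear_combination hs 1 0 - e2
    · exact e0
    · exact t3 1 _ n1
    · exact t4 1 _ n1
    · linear_combination hs 2 0 - e1
    · linear_combination hs 2 1 - e0
    · exact t3 2 _ n2
    · exact t4 2 _ n2
    · linear_combination hs 3 0 - t3 0 _ n0
    · linear_combination hs 3 1 - t3 1 _ n1
    · linear_combination hs 3 2 - t3 2 _ n2
    · linear_combination hs 4 0 - t4 0 _ n0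
    · linear_combination hs 4 1 - t4 1 _ n1
    · linear_combination hs 4 2 - t4 2 _ n2
    · exact hs 4 3
  · simp [dot, basePart]
    linear_combination h1 - y ^ 2 * hab - (p 3 + a * y) * h3 - (p 4 + b * y) * h4
  · simp [dot, basePart, formPart]
    rw [hs 3 0, hs 3 1, hs 3 2] at z3
    rw [hs 4 0, hs 4 1, hs 4 2, hs 4 3] at z4
    linear_combination b * z3 - a * z4 - b * η 3 4 * h4 - a * η 3 4 * h3 - η 3 4 * y * hab

/-! ### The Bryant–Salamon metric on the anti-self-dual forms over a great 3-sphere -/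

/-- Expand `(1 - p pᵀ) X (1 - p pᵀ)` with `q = X p`; the last term vanishes because `pᵀ X p = 0` for
skew `X`. -/
theorem verticalPart_of_skew (p : Fin 5 → ℝ) (X : Fin 5 → Fin 5 → ℝ) (hX : ∀ i j, X i j = -X j i)
    (q : Fin 5 → ℝ) (hq : ∀ i, ∑ j, X i j * p j = q i) (i j : Fin 5) :
    verticalPart p X i j = X i j + p i * q j - q i * p j := by
  have h1 (k : Fin 5) : ∑ l, ((if i = k then 1 else 0) - p i * p k) * X k l *
      ((if l = j then 1 else 0) - p l * p j) =
      ((if i = k then 1 else 0) - p i * p k) * (X k j - q k * p j) := by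
    rw [← hq k, Finset.sum_mul, mul_sub, Finset.mul_sum]
    simp only [mul_sub, Finset.sum_sub_distrib, mul_ite, mul_one, mul_zero, Finset.sum_ite_eq',
      Finset.mem_univ, if_true]
    congr 1
    exact Finset.sum_congr rfl fun l _ => by ring
  have h2 : ∑ k, p k * X k j = -q j := by
    rw [← hq j, ← Finset.sum_neg_distrib]
    exact Finset.sum_congr rfl fun k _ => by rw [hX k j]; ring
  have h3 : ∑ k, p k * q k = 0 := by
    have : ∑ k, p k * q k = ∑ k, ∑ l, p k * X k l * p l := by
      refine Finset.sum_congr rfl fun k _ => ?_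
      rw [← hq k, Finset.mul_sum]
      exact Finset.sum_congr rfl fun l _ => by ring
    have h' : ∑ k, ∑ l, p k * X k l * p l = -∑ k, ∑ l, p k * X k l * p l := by
      conv_lhs => rw [Finset.sum_comm]
      simp only [← Finset.sum_neg_distrib]
      exact Finset.sum_congr rfl fun l _ => Finset.sum_congr rfl fun k _ => by rw [hX k l]; ring
    linarith
  unfold verticalPart
  simp only [h1]
  simp only [sub_mul _ _ (X _ _ - _), Finset.sum_sub_distrib, ite_mul, one_mul, zero_mul, Finset.sum_ite_eq,
    Finset.mem_univ, if_true]
  have h4 : ∑ k, p i * p k * (X k j - q k * p j) =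
      p i * (∑ k, p k * X k j) - p i * p j * ∑ k, p k * q k := by
    rw [Finset.mul_sum, Finset.mul_sum, ← Finset.sum_sub_distrib]
    exact Finset.sum_congr rfl fun k _ => by ring
  rw [h4, h2, h3]
  ring

/-- The derivative of `asdPoint a b u` at `(x, f, y)` in the direction `(x', f', y')`. -/
def asdTangent (a b u : ℝ) (x f : Fin 3 → ℝ) (y : ℝ) (x' f' : Fin 3 → ℝ) (y' : ℝ) : Ambient :=
  (spherePoint a b x' y',
    blockForm a b (y' • f + y • f' - u • x') (cross f' x + cross f x') f' 0)

section
variable {a b u y : ℝ} {x f : Fin 3 → ℝ}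

/-- Contraction with the parallel normal commutes with covariant differentiation. So the result is
the anti-self-dual form of the tangential projection `(f', 0) - (x · f') (x, y n)` of the derivative
of `(f, u n)`, with `u` constant. -/
theorem verticalPart_asdTangent (hab : a ^ 2 + b ^ 2 = 1) (h1 : dot x x + y ^ 2 = 1)
    (h2 : dot x f = -(u * y)) {x' f' : Fin 3 → ℝ} {y' : ℝ} (h3 : dot x x' + y * y' = 0) :
    verticalPart (spherePoint a b x y) (asdTangent a b u x f y x' f' y').2 =
      blockForm a b (y • f') (cross f' x) (f' - dot x f' • x) (-(dot x f' * y)) := by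
  simp only [dot] at h1 h2 h3
  have hs := blockForm_skew a b (y' • f + y • f' - u • x') (cross f' x + cross f x') f' 0
  have hv := verticalPart_of_skew (spherePoint a b x y) _ hs
    ![y' * cross x f 0 - u * cross x x' 0 + y * cross f x' 0,
      y' * cross x f 1 - u * cross x x' 1 + y * cross f x' 1,
      y' * cross x f 2 - u * cross x x' 2 + y * cross f x' 2,
      b * dot x f' - a * dot x (cross f x'), -(a * dot x f') - b * dot x (cross f x')] (by
    intro i
    fin_cases i <;>
      simp [spherePoint, blockForm, Fin.sum_univ_five, cross, dot]
    · linear_combination y * (f' 1 * x 2 - f' 2 * x 1 + (f 1 * x' 2 - f 2 * x' 1)) * hab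
    · linear_combination y * (f' 2 * x 0 - f' 0 * x 2 + (f 2 * x' 0 - f 0 * x' 2)) * hab
    · linear_combination y * (f' 0 * x 1 - f' 1 * x 0 + (f 0 * x' 1 - f 1 * x' 0)) * hab
    · ring
    · ring)
  have hv' : ∀ i j, i < j →
      verticalPart (spherePoint a b x y) (asdTangent a b u x f y x' f' y').2 i j =
      blockForm a b (y • f') (cross f' x) (f' - dot x f' • x) (-(dot x f' * y)) i j := by
    intro i j hij
    refine (hv i j).trans ?_
    fin_cases i <;> fin_cases j <;> simp only [Fin.reduceFinMk, Fin.reduceLT,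
      Fin.zero_eta, Fin.mk_one, lt_self_iff_false, Fin.isValue, Fin.not_lt_zero] at hij ⊢ <;>
      simp [spherePoint, blockForm, cross, dot]
    · linear_combination (y' * x 2 - y * x' 2) * h2 + (u * x' 2 - y' * f 2) * h1 +
        (y * f 2 - u * x 2) * h3
    · linear_combination -(y' * x 1 - y * x' 1) * h2 - (u * x' 1 - y' * f 1) * h1 -
        (y * f 1 - u * x 1) * h3
    · linear_combination a * ((x 1 * x' 2 - x 2 * x' 1) * h2 - (x 1 * f 2 - x 2 * f 1) * h3 -
        (f 1 * x' 2 - f 2 * x' 1) * h1)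
    · linear_combination b * ((x 1 * x' 2 - x 2 * x' 1) * h2 - (x 1 * f 2 - x 2 * f 1) * h3 -
        (f 1 * x' 2 - f 2 * x' 1) * h1)
    · linear_combination (y' * x 0 - y * x' 0) * h2 + (u * x' 0 - y' * f 0) * h1 +
        (y * f 0 - u * x 0) * h3
    · linear_combination a * ((x 2 * x' 0 - x 0 * x' 2) * h2 - (x 2 * f 0 - x 0 * f 2) * h3 -
        (f 2 * x' 0 - f 0 * x' 2) * h1)
    · linear_combination b * ((x 2 * x' 0 - x 0 * x' 2) * h2 - (x 2 * f 0 - x 0 * f 2) * h3 -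
        (f 2 * x' 0 - f 0 * x' 2) * h1)
    · linear_combination a * ((x 0 * x' 1 - x 1 * x' 0) * h2 - (x 0 * f 1 - x 1 * f 0) * h3 -
        (f 0 * x' 1 - f 1 * x' 0) * h1)
    · linear_combination b * ((x 0 * x' 1 - x 1 * x' 0) * h2 - (x 0 * f 1 - x 1 * f 0) * h3 -
        (f 0 * x' 1 - f 1 * x' 0) * h1)
    · linear_combination -y * (x 0 * f' 0 + x 1 * f' 1 + x 2 * f' 2) * hab
  have hw := blockForm_skew a b (y • f') (cross f' x) (f' - dot x f' • x) (-(dot x f' * y))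
  have hsw : ∀ i j, verticalPart (spherePoint a b x y) (asdTangent a b u x f y x' f' y').2 i j =
      -verticalPart (spherePoint a b x y) (asdTangent a b u x f y x' f' y').2 j i := by
    intro i j
    refine (hv i j).trans ?_
    refine Eq.trans ?_ (congrArg Neg.neg (hv j i)).symm
    rw [hs i j]
    ring
  ext i j
  rcases lt_trichotomy i j with h | rfl | h
  · exact hv' i j h
  · linarith [hsw i i, hw i i]
  · rw [hsw, hw, hv' j i h]

theorem bsMetric_asdTangent (c : ℝ) (hab : a ^ 2 + b ^ 2 = 1) (h1 : dot x x + y ^ 2 = 1)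
    (h2 : dot x f = -(u * y)) {x' f' x'' f'' : Fin 3 → ℝ} {y' y'' : ℝ}
    (h3 : dot x x' + y * y' = 0) (h3' : dot x x'' + y * y'' = 0) :
    bsMetric c (asdPoint a b u x f y) (asdTangent a b u x f y x' f' y')
        (asdTangent a b u x f y x'' f'' y'') =
      (√(c + (dot f f + u ^ 2)))⁻¹ * (dot f' f'' - dot x f' * dot x f'') +
        2 * √(c + (dot f f + u ^ 2)) * (dot x' x'' + y' * y'') := by
  have e1 := verticalPart_asdTangent hab h1 h2 (f' := f') h3
  have e2 := verticalPart_asdTangent hab h1 h2 (f' := f'') h3'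
  unfold bsMetric
  rw [rSq_asdPoint hab h1 h2]
  simp only [show (asdPoint a b u x f y).1 = spherePoint a b x y from rfl, e1, e2,
    sum_blockForm_mul a b hab]
  congr 1
  · congr 1
    simp only [dot, cross, Pi.sub_apply, Pi.smul_apply, smul_eq_mul, Matrix.cons_val] at *
    linear_combination (1 / 2) * ((f' 0 * f'' 0 + f' 1 * f'' 1 + f' 2 * f'' 2) +
      (x 0 * f' 0 + x 1 * f' 1 + x 2 * f' 2) * (x 0 * f'' 0 + x 1 * f'' 1 + x 2 * f'' 2)) * h1
  · congr 1
    simp [asdTangent, spherePoint, Fin.sum_univ_five, dot]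
    linear_combination y' * y'' * hab

end

/-! ### Regular level sets -/

/-- A linear projection to `ker L`, followed by coordinates there, complements `L`. -/
theorem exists_equiv_prod_of_surjective {E F : Type*} [NormedAddCommGroup E] [NormedSpace ℝ E]
    [FiniteDimensional ℝ E] [NormedAddCommGroup F] [NormedSpace ℝ F] [FiniteDimensional ℝ F]
    {d : ℕ} (hd : Module.finrank ℝ E = Module.finrank ℝ F + d) (L : E →L[ℝ] F)
    (hL : Function.Surjective L) :
    ∃ (P : E →L[ℝ] EuclideanSpace ℝ (Fin d)) (e : E ≃L[ℝ] F × EuclideanSpace ℝ (Fin d)),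
      (e : E →L[ℝ] F × EuclideanSpace ℝ (Fin d)) = L.prod P := by
  set K := LinearMap.ker (L : E →ₗ[ℝ] F) with hK
  have hKd : Module.finrank ℝ K = d := by
    have h1 := LinearMap.finrank_range_add_finrank_ker (L : E →ₗ[ℝ] F)
    rw [LinearMap.range_eq_top.2 hL, finrank_top, ← hK] at h1
    omega
  obtain ⟨π, hπ⟩ := LinearMap.exists_leftInverse_of_injective K.subtype K.ker_subtype
  have iso : K ≃ₗ[ℝ] EuclideanSpace ℝ (Fin d) := LinearEquiv.ofFinrankEq _ _ (by simp [hKd])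
  set P : E →L[ℝ] EuclideanSpace ℝ (Fin d) :=
    LinearMap.toContinuousLinearMap (iso.toLinearMap ∘ₗ π) with hP
  have hinj : Function.Injective (L.prod P : E →ₗ[ℝ] F × EuclideanSpace ℝ (Fin d)) := by
    rw [← LinearMap.ker_eq_bot, LinearMap.ker_eq_bot']
    intro z hz
    have hz1 : L z = 0 := congrArg Prod.fst hz
    have hz2 : iso (π z) = 0 := congrArg Prod.snd hz
    have hz3 : π z = 0 := by simpa using hz2
    have hz4 : π z = ⟨z, hz1⟩ := LinearMap.congr_fun hπ ⟨z, hz1⟩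
    rw [hz4] at hz3
    exact congrArg Subtype.val hz3
  refine ⟨P, (LinearEquiv.ofInjectiveOfFinrankEq _ hinj (by simp [hd])).toContinuousLinearEquiv, ?_⟩
  ext z <;> rfl

/-- By the inverse function theorem `(Φ, P)` straightens the level set to `{0} × ℝᵈ`. The globally
smooth `κ`, a left inverse of `ι`, makes the chart inverse `P ∘ κ` smooth on the image. -/
theorem isSmoothSubmanifold_image_levelSet {E F W : Type*} [NormedAddCommGroup E]
    [NormedSpace ℝ E] [FiniteDimensional ℝ E] [NormedAddCommGroup F] [NormedSpace ℝ F]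
    [FiniteDimensional ℝ F] [NormedAddCommGroup W] [NormedSpace ℝ W] {d : ℕ}
    (hd : Module.finrank ℝ E = Module.finrank ℝ F + d) {O : Set E} (hO : IsOpen O) {Φ : E → F}
    (hΦ : ∀ z ∈ O, ContDiffAt ℝ ω Φ z)
    (hsurj : ∀ z ∈ O, Φ z = 0 → Function.Surjective (fderiv ℝ Φ z)) {ι : E → W} {κ : W → E}
    (hι : ∀ z ∈ O, ContDiffAt ℝ ∞ ι z) (hκ : ContDiff ℝ ∞ κ) (hκι : ∀ z ∈ O, κ (ι z) = z) :
    IsSmoothSubmanifold d (ι '' {z ∈ O | Φ z = 0}) := by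
  have : CompleteSpace E := FiniteDimensional.complete ℝ E
  rintro _ ⟨z₀, ⟨hz₀, hΦ₀⟩, rfl⟩
  obtain ⟨P, e, he⟩ := exists_equiv_prod_of_surjective hd _ (hsurj z₀ hz₀ hΦ₀)
  have hG : ContDiffAt ℝ ω (fun z => (Φ z, P z)) z₀ :=
    (hΦ z₀ hz₀).prodMk P.contDiff.contDiffAt
  have hG' : HasFDerivAt (fun z => (Φ z, P z))
      (e : E →L[ℝ] F × EuclideanSpace ℝ (Fin d)) z₀ := by
    rw [he]
    exact ((hΦ z₀ hz₀).differentiableAt (by simp)).hasFDerivAt.prodMk P.hasFDerivAt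
  have hn : (ω : WithTop ℕ∞) ≠ 0 := by simp
  set φ := hG.toOpenPartialHomeomorph _ hG' hn with hφ
  have hφc : ∀ z, φ z = (Φ z, P z) := fun z => rfl
  have hsource : z₀ ∈ φ.source := hG.mem_toOpenPartialHomeomorph_source hG' hn
  have htarget : φ z₀ ∈ φ.target := φ.map_source hsource
  have hsymm : ContDiffAt ℝ ω φ.symm (φ z₀) := by
    refine φ.contDiffAt_symm htarget (f₀' := e) ?_ ?_ <;> rw [φ.left_inv hsource]
    · exact hG'
    · exact hG
  -- Regularity `ω` matters here: unlike `ContDiffAt ℝ ∞`, it passes from a point to a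
  -- neighbourhood.
  have hmem : ∀ᶠ p in 𝓝 (φ z₀), p ∈ φ.target ∧ ContDiffAt ℝ ω φ.symm p ∧ φ.symm p ∈ O := by
    refine Filter.Eventually.and (φ.open_target.mem_nhds htarget) ((hsymm.eventually (by simp)).and ?_)
    refine hsymm.continuousAt.preimage_mem_nhds ?_
    rw [φ.left_inv hsource]
    exact hO.mem_nhds hz₀
  obtain ⟨A, hA, hAo, hzA⟩ := eventually_nhds_iff.1 hmem
  refine ⟨κ ⁻¹' (φ.source ∩ φ ⁻¹' A), {t | ((0 : F), t) ∈ A}, fun t => ι (φ.symm (0, t)),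
    (φ.isOpen_inter_preimage hAo).preimage hκ.continuous, ?_,
    hAo.preimage (by fun_prop), ?_, ?_, fun q => P (κ q), ?_, ?_⟩
  · rw [mem_preimage, hκι z₀ hz₀]
    exact ⟨hsource, hzA⟩
  · intro t ht
    have h1 := hA _ ht
    refine ContDiffAt.contDiffWithinAt ?_
    refine ContDiffAt.comp t (hι _ h1.2.2) ?_
    exact ContDiffAt.comp t (h1.2.1.of_le le_top) (by fun_prop)
  · ext q
    constructor
    · rintro ⟨t, ht, rfl⟩
      have h1 := hA _ ht
      have h2 := φ.right_inv h1.1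
      rw [hφc] at h2
      refine ⟨⟨_, ⟨h1.2.2, congrArg Prod.fst h2⟩, rfl⟩, ?_⟩
      rw [mem_preimage, hκι _ h1.2.2]
      refine ⟨φ.map_target h1.1, ?_⟩
      rw [mem_preimage, φ.right_inv h1.1]
      exact ht
    · rintro ⟨⟨z, ⟨hz, hΦz⟩, rfl⟩, hq⟩
      rw [mem_preimage, hκι z hz] at hq
      have h2 : φ z = (0, P z) := by rw [hφc, hΦz]
      refine ⟨P z, ?_, ?_⟩
      · have := hq.2
        rwa [mem_preimage, h2] at this
      · change ι (φ.symm (0, P z)) = ι z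
        rw [← h2, φ.left_inv hq.1]
  · exact (P.contDiff.comp hκ).contDiffOn
  · intro t ht
    have h1 := hA _ ht
    have h2 := φ.right_inv h1.1
    rw [hφc] at h2
    change P (κ (ι _)) = t
    rw [hκι _ h1.2.2]
    exact congrArg Prod.snd h2

/-! ### The fibres as level sets -/

/-- `c + r²` on the fibre over `(u, v a, v b)`. -/
def fibreS (c u : ℝ) (f : Fin 3 → ℝ) : ℝ := c + (dot f f + u ^ 2)

/-- The component of the base point in the direction `(a, b)`, on the fibre over `(u, v a, v b)`. -/
def fibreY (c u v : ℝ) (f : Fin 3 → ℝ) : ℝ := v / 2 * fibreS c u f ^ (-(1 / 4) : ℝ)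

/-- The equations of the fibre over `(u, v a, v b)`. -/
def fibreEqs (c u v : ℝ) (z : (Fin 3 → ℝ) × (Fin 3 → ℝ)) : ℝ × ℝ :=
  (dot z.1 z.1 + fibreY c u v z.2 ^ 2 - 1, dot z.1 z.2 + u * fibreY c u v z.2)

/-- The parametrization of the fibre over `(u, v a, v b)` by a subset of `ℝ³ × ℝ³`. -/
def fibrePoint (c u v a b : ℝ) (z : (Fin 3 → ℝ) × (Fin 3 → ℝ)) : Ambient :=
  asdPoint a b u z.1 z.2 (fibreY c u v z.2)

theorem fibreEqs_eq_zero_iff {c u v : ℝ} {z : (Fin 3 → ℝ) × (Fin 3 → ℝ)} :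
    fibreEqs c u v z = 0 ↔ dot z.1 z.1 + fibreY c u v z.2 ^ 2 = 1 ∧
      dot z.1 z.2 = -(u * fibreY c u v z.2) := by
  simp [fibreEqs, Prod.ext_iff, sub_eq_zero, add_eq_zero_iff_eq_neg]

theorem dot_self_eq_zero {x : Fin 3 → ℝ} : dot x x = 0 ↔ x = 0 := by
  constructor
  · intro h
    simp only [dot] at h
    ext i
    fin_cases i <;> simp <;> nlinarith [sq_nonneg (x 0), sq_nonneg (x 1), sq_nonneg (x 2)]
  · rintro rfl
    simp [dot]

theorem dot_self_nonneg (x : Fin 3 → ℝ) : 0 ≤ dot x x := by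
  simp only [dot]
  nlinarith [sq_nonneg (x 0), sq_nonneg (x 1), sq_nonneg (x 2)]

section
variable {c u v a b : ℝ}

theorem rSq_fibrePoint (hab : a ^ 2 + b ^ 2 = 1) {z : (Fin 3 → ℝ) × (Fin 3 → ℝ)}
    (hz : fibreEqs c u v z = 0) : c + rSq (fibrePoint c u v a b z) = fibreS c u z.2 := by
  obtain ⟨h1, h2⟩ := fibreEqs_eq_zero_iff.1 hz
  rw [fibrePoint, rSq_asdPoint hab h1 h2, fibreS]

/-- The last two components of the fibration force the `y`-part of the base point to be a multiple
of `(a, b)`. As `r² = |f|² + u²`, that multiple is an explicit function of `f`. -/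
theorem fibre_eq_image (hab : a ^ 2 + b ^ 2 = 1) :
    fibre c (u, v * a, v * b) =
      fibrePoint c u v a b '' {z | 0 < fibreS c u z.2 ∧ fibreEqs c u v z = 0} := by
  ext q
  constructor
  · rintro ⟨⟨hq, hpos⟩, hfib⟩
    simp only [fibration, Prod.mk.injEq] at hfib
    obtain ⟨f1, f2, f3⟩ := hfib
    set s := (c + rSq q) ^ (1 / 4 : ℝ) with hs
    have hs0 : 0 < s := Real.rpow_pos_of_pos hpos _
    have hsi : (c + rSq q) ^ (-(1 / 4) : ℝ) = s⁻¹ := Real.rpow_neg hpos.le _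
    obtain ⟨e1, e2, e3⟩ := eq_asdPoint_of_mem (y := v / 2 * s⁻¹) hab hq
      (by field_simp; linarith) (by field_simp; linarith)
    rw [f1] at e1 e3
    have hr : c + rSq q = fibreS c u (formPart a b q) := by
      rw [fibreS, ← rSq_asdPoint hab e2 e3, ← e1]
    have hY : fibreY c u v (formPart a b q) = v / 2 * s⁻¹ := by rw [fibreY, ← hr, hsi]
    refine ⟨(basePart q, formPart a b q), ⟨hr ▸ hpos, ?_⟩, ?_⟩
    · rw [fibreEqs_eq_zero_iff]
      simp only [hY]
      exact ⟨e2, e3⟩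
    · simp only [fibrePoint, hY]
      exact e1.symm
  · rintro ⟨z, ⟨hpos, hz⟩, rfl⟩
    have hr := rSq_fibrePoint hab hz
    obtain ⟨h1, h2⟩ := fibreEqs_eq_zero_iff.1 hz
    refine ⟨⟨asdPoint_mem_asdBundle hab h1 h2, hr ▸ hpos⟩, ?_⟩
    have hs0 : 0 < fibreS c u z.2 ^ (1 / 4 : ℝ) := Real.rpow_pos_of_pos hpos _
    simp only [fibration, hr]
    simp only [fibrePoint, asdPoint, blockForm, spherePoint, fibreY, Real.rpow_neg hpos.le]
    refine Prod.ext rfl (Prod.ext ?_ ?_) <;> simp <;> field_simp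

theorem fibrePoint_mem_vertices_iff (hab : a ^ 2 + b ^ 2 = 1) {z : (Fin 3 → ℝ) × (Fin 3 → ℝ)}
    (hz : fibreEqs c u v z = 0) : fibrePoint c u v a b z ∈ vertices ↔ z = 0 := by
  obtain ⟨h1, h2⟩ := fibreEqs_eq_zero_iff.1 hz
  constructor
  · rintro ⟨z0, z1, z2, z3⟩
    have hb : z.1 = 0 := by
      rw [← basePart_asdPoint a b u (fibreY c u v z.2) z.1 z.2]
      ext i
      fin_cases i
      · exact z0
      · exact z1
      · exact z2
    have hf : z.2 = 0 := by
      rw [← formPart_asdPoint hab u (fibreY c u v z.2) z.1 z.2]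
      change (asdPoint a b u z.1 z.2 (fibreY c u v z.2)).2 = 0 at z3
      ext i
      fin_cases i <;> simp [formPart, z3]
    exact Prod.ext hb hf
  · rintro rfl
    simp only [Prod.fst_zero, Prod.snd_zero, show dot (0 : Fin 3 → ℝ) 0 = 0 by simp [dot]] at h1 h2
    -- At `z = 0` the sphere equation reads `Y² = 1`, so the second equation forces `u = 0`.
    have hu : u = 0 := by
      have h3 : fibreY c u v 0 ≠ 0 := fun h => by rw [h] at h1; norm_num at h1
      rcases mul_eq_zero.1 (neg_eq_zero.1 h2.symm) with h | h
      · exact h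
      · exact absurd h h3
    refine ⟨rfl, rfl, rfl, ?_⟩
    ext i j
    subst hu
    fin_cases i <;> fin_cases j <;> simp [fibrePoint, asdPoint, blockForm, cross]

theorem smoothFibre_eq_image (hab : a ^ 2 + b ^ 2 = 1) :
    smoothFibre c (u, v * a, v * b) = fibrePoint c u v a b ''
      {z ∈ {z | 0 < fibreS c u z.2 ∧ z ≠ 0} | fibreEqs c u v z = 0} := by
  rw [smoothFibre, fibre_eq_image hab]
  ext q
  constructor
  · rintro ⟨⟨z, ⟨hp, hz⟩, rfl⟩, hv⟩
    exact ⟨z, ⟨⟨hp, fun h => hv ((fibrePoint_mem_vertices_iff hab hz).2 h)⟩, hz⟩, rfl⟩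
  · rintro ⟨z, ⟨⟨hp, h0⟩, hz⟩, rfl⟩
    exact ⟨⟨z, ⟨hp, hz⟩, rfl⟩, fun h => h0 ((fibrePoint_mem_vertices_iff hab hz).1 h)⟩

theorem contDiff_fibreS {n : WithTop ℕ∞} : ContDiff ℝ n (fibreS c u) := by
  unfold fibreS dot
  fun_prop

theorem contDiffAt_fibreY {n : WithTop ℕ∞} {f : Fin 3 → ℝ} (hf : 0 < fibreS c u f) :
    ContDiffAt ℝ n (fibreY c u v) f :=
  contDiffAt_const.mul (contDiff_fibreS.contDiffAt.rpow_const_of_ne hf.ne')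

theorem contDiff_asdPoint {n : WithTop ℕ∞} :
    ContDiff ℝ n (fun z : (Fin 3 → ℝ) × (Fin 3 → ℝ) × ℝ => asdPoint a b u z.1 z.2.1 z.2.2) := by
  unfold asdPoint
  refine ContDiff.prodMk ?_ ?_
  · rw [contDiff_pi]
    intro i
    fin_cases i <;> simp [spherePoint] <;> fun_prop
  · rw [contDiff_pi]
    intro i
    rw [contDiff_pi]
    intro j
    fin_cases i <;> fin_cases j <;> simp [blockForm, cross] <;> fun_prop

theorem contDiffAt_fibrePoint {n : WithTop ℕ∞} {z : (Fin 3 → ℝ) × (Fin 3 → ℝ)}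
    (hz : 0 < fibreS c u z.2) : ContDiffAt ℝ n (fibrePoint c u v a b) z :=
  contDiff_asdPoint.contDiffAt.comp (x := z)
    (f := fun z : (Fin 3 → ℝ) × (Fin 3 → ℝ) => (z.1, z.2, fibreY c u v z.2))
    (contDiffAt_fst.prodMk (contDiffAt_snd.prodMk ((contDiffAt_fibreY hz).comp z contDiffAt_snd)))

theorem contDiffAt_fibreEqs {n : WithTop ℕ∞} {z : (Fin 3 → ℝ) × (Fin 3 → ℝ)}
    (hz : 0 < fibreS c u z.2) : ContDiffAt ℝ n (fibreEqs c u v) z := by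
  have hY : ContDiffAt ℝ n (fun z : (Fin 3 → ℝ) × (Fin 3 → ℝ) => fibreY c u v z.2) z :=
    (contDiffAt_fibreY hz).comp z contDiffAt_snd
  unfold fibreEqs dot
  refine ContDiffAt.prodMk ?_ ?_
  · refine ContDiffAt.sub (ContDiffAt.add ?_ (hY.pow 2)) contDiffAt_const
    fun_prop
  · refine ContDiffAt.add ?_ (contDiffAt_const.mul hY)
    fun_prop

/-- `Y` is `v / 2` times a negative power of `c + |f|² + u²`, so its gradient is `y₁ f` with `Y y₁ ≤
0`. This sign is what makes the equations of the fibre independent. -/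
theorem exists_hasDerivAt_fibreY {f : Fin 3 → ℝ} (hf : 0 < fibreS c u f) :
    ∃ y₁ : ℝ, fibreY c u v f * y₁ ≤ 0 ∧ (v ≠ 0 → fibreY c u v f * y₁ < 0) ∧
      ∀ f' : Fin 3 → ℝ, HasDerivAt (fun t : ℝ => fibreY c u v (f + t • f')) (y₁ * dot f f') 0 := by
  have hp (s : ℝ) : 0 < fibreS c u f ^ s := Real.rpow_pos_of_pos hf _
  have hneg : fibreY c u v f * (-(v / 4) * fibreS c u f ^ (-(1 / 4) - 1 : ℝ)) =
      -(v ^ 2 * (fibreS c u f ^ (-(1 / 4) : ℝ) * fibreS c u f ^ (-(1 / 4) - 1 : ℝ)) / 8) := by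
    rw [fibreY]; ring
  refine ⟨-(v / 4) * fibreS c u f ^ (-(1 / 4) - 1 : ℝ), ?_, ?_, ?_⟩
  · rw [hneg]
    have := mul_pos (hp (-(1 / 4))) (hp (-(1 / 4) - 1))
    have := mul_nonneg (sq_nonneg v) this.le
    linarith
  · intro hv
    rw [hneg]
    have := mul_pos (hp (-(1 / 4))) (hp (-(1 / 4) - 1))
    have := mul_pos (by positivity : 0 < v ^ 2) this
    linarith
  · intro f'
    have hS : HasDerivAt (fun t : ℝ => fibreS c u (f + t • f')) (2 * dot f f') 0 := by
      have : (fun t : ℝ => fibreS c u (f + t • f')) =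
          fun t => fibreS c u f + t * (2 * dot f f') + t ^ 2 * dot f' f' := by
        ext t
        simp [fibreS, dot]
        ring
      rw [this]
      have h1 := ((hasDerivAt_id (0 : ℝ)).mul_const (2 * dot f f')).const_add (fibreS c u f)
      have h2 := (hasDerivAt_pow 2 (0 : ℝ)).mul_const (dot f' f')
      convert! h1.add h2 using 1
      simp
    have h0 : fibreS c u (f + (0 : ℝ) • f') = fibreS c u f := by simp
    have h1 := (hS.rpow_const (p := -(1 / 4)) (Or.inl (by rw [h0]; exact hf.ne'))).const_mul (v / 2)
    rw [h0] at h1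
    convert! h1 using 1
    ring

/-- Lagrange multipliers: if the differential is not onto, some nonzero functional `(l, m)` kills
its range, which gives two vector equations relating `x` and `f`. The sign of `Y y₁` then leaves
only `x = f = 0`. -/
theorem surjective_fderiv_fibreEqs {z : (Fin 3 → ℝ) × (Fin 3 → ℝ)} (hS : 0 < fibreS c u z.2)
    (h0 : z ≠ 0) (hz : fibreEqs c u v z = 0) :
    Function.Surjective (fderiv ℝ (fibreEqs c u v) z) := by
  obtain ⟨x, f⟩ := z
  obtain ⟨h1, h2⟩ := fibreEqs_eq_zero_iff.1 hz
  obtain ⟨y₁, hy0, hyv, hy⟩ := exists_hasDerivAt_fibreY (v := v) hS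
  simp only at h1 h2 hy0 hyv hy
  set Y := fibreY c u v f with hY
  have hd (x' f' : Fin 3 → ℝ) : fderiv ℝ (fibreEqs c u v) (x, f) (x', f') =
      (2 * dot x x' + 2 * Y * (y₁ * dot f f'), dot f x' + dot x f' + u * (y₁ * dot f f')) := by
    have hF := ((contDiffAt_fibreEqs (n := 1) (v := v) hS).differentiableAt (by simp)).hasFDerivAt
    have hc : HasDerivAt (fun t : ℝ => ((x, f) : (Fin 3 → ℝ) × (Fin 3 → ℝ)) + t • (x', f'))
        (x', f') 0 := by
      simpa using ((hasDerivAt_id (0 : ℝ)).smul_const (x', f')).const_add (x, f)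
    have h3 := HasFDerivAt.comp_hasDerivAt (0 : ℝ) (by simpa using hF) hc
    refine h3.unique ?_
    have hx : HasDerivAt (fun t : ℝ => dot (x + t • x') (x + t • x')) (2 * dot x x') 0 := by
      have : (fun t : ℝ => dot (x + t • x') (x + t • x')) =
          fun t => dot x x + t * (2 * dot x x') + t ^ 2 * dot x' x' := by
        ext t
        simp [dot]
        ring
      rw [this]
      have h1 := ((hasDerivAt_id (0 : ℝ)).mul_const (2 * dot x x')).const_add (dot x x)
      have h2 := (hasDerivAt_pow 2 (0 : ℝ)).mul_const (dot x' x')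
      convert! h1.add h2 using 1
      simp
    have hxf : HasDerivAt (fun t : ℝ => dot (x + t • x') (f + t • f')) (dot f x' + dot x f') 0 := by
      have : (fun t : ℝ => dot (x + t • x') (f + t • f')) =
          fun t => dot x f + t * (dot f x' + dot x f') + t ^ 2 * dot x' f' := by
        ext t
        simp [dot]
        ring
      rw [this]
      have h1 := ((hasDerivAt_id (0 : ℝ)).mul_const (dot f x' + dot x f')).const_add (dot x f)
      have h2 := (hasDerivAt_pow 2 (0 : ℝ)).mul_const (dot x' f')
      convert! h1.add h2 using 1
      simp
    have hyf := hy f'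
    have hy2 := hyf.pow 2
    refine HasDerivAt.prodMk ?_ ?_
    · convert! (hx.add hy2).sub_const 1 using 1
      simp [hY]
    · exact hxf.add (hyf.const_mul u)
  by_contra hns
  have hlt : LinearMap.range (fderiv ℝ (fibreEqs c u v) (x, f)).toLinearMap < ⊤ := by
    rw [lt_top_iff_ne_top]
    intro h
    exact hns (LinearMap.range_eq_top.1 h)
  obtain ⟨φ, hφ0, hφ⟩ := Submodule.exists_le_ker_of_lt_top _ hlt
  have hφe (s t : ℝ) : φ (s, t) = s * φ (1, 0) + t * φ (0, 1) := by
    rw [← smul_eq_mul, ← smul_eq_mul, ← map_smul, ← map_smul, ← map_add]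
    simp
  set l := φ (1, 0) with hl
  set m := φ (0, 1) with hm
  have hker (x' f' : Fin 3 → ℝ) :
      (2 * dot x x' + 2 * Y * (y₁ * dot f f')) * l +
        (dot f x' + dot x f' + u * (y₁ * dot f f')) * m = 0 := by
    have := hφ (LinearMap.mem_range_self _ (x', f'))
    rw [LinearMap.mem_ker] at this
    change φ (fderiv ℝ (fibreEqs c u v) (x, f) (x', f')) = 0 at this
    rwa [hd, hφe] at this
  have hA (i : Fin 3) : 2 * l * x i + m * f i = 0 := by
    have := hker (Pi.single i 1) 0
    fin_cases i <;> simp [dot] at this ⊢ <;> linarith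
  have hB (i : Fin 3) : y₁ * (2 * Y * l + u * m) * f i + m * x i = 0 := by
    have := hker 0 (Pi.single i 1)
    fin_cases i <;> simp [dot] at this ⊢ <;> linarith
  -- If `m = 0`, then `x = 0`, so `Y² = 1` and `v ≠ 0`; now `Y y₁ < 0` forces `f = 0`. If `m ≠ 0`,
  -- pairing both vector equations with `x ≠ 0` gives `|x|⁴ = u² Y y₁ ≤ 0`.
  by_cases hm0 : m = 0
  · have hl0 : l ≠ 0 := by
      intro hl0
      apply hφ0
      ext <;> simp [← hl, ← hm, hl0, hm0]
    have hx : x = 0 := by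
      ext i
      have := hA i
      simpa [hm0, hl0] using this
    have hY1 : Y ^ 2 = 1 := by simpa [hx, dot] using h1
    have hv : v ≠ 0 := by
      rintro rfl
      simp [hY, fibreY] at hY1
    have hf : f = 0 := by
      ext i
      have h5 := hB i
      have h6 : Y * y₁ * (l * f i) = 0 := by
        rw [hm0] at h5
        linear_combination (1 / 2) * h5
      have h7 := (mul_eq_zero.1 h6).resolve_left (hyv hv).ne
      exact (mul_eq_zero.1 h7).resolve_left hl0
    exact h0 (by rw [hx, hf]; rfl)
  · have hx0 : x ≠ 0 := by
      intro hx
      apply h0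
      have : f = 0 := by
        ext i
        have := hA i
        simpa [hm0, hx] using this
      rw [hx, this]; rfl
    have hX : 0 < dot x x := (dot_self_nonneg x).lt_of_ne (fun h => hx0 (dot_self_eq_zero.1 h.symm))
    have e1 : 2 * l * dot x x = m * (u * Y) := by
      have : 2 * l * dot x x + m * dot x f = 0 := by
        simp only [dot]
        linear_combination x 0 * hA 0 + x 1 * hA 1 + x 2 * hA 2
      rw [h2] at this
      linarith
    have e2 : y₁ * (2 * Y * l + u * m) * (-(u * Y)) + m * dot x x = 0 := by
      rw [← h2]
      simp only [dot]
      linear_combination x 0 * hB 0 + x 1 * hB 1 + x 2 * hB 2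
    have e3 : m * (dot x x ^ 2 - u ^ 2 * (Y * y₁)) = 0 := by
      linear_combination dot x x * e2 + y₁ * u * Y ^ 2 * e1 + y₁ * u ^ 2 * Y * m * h1
    have e4 := (mul_eq_zero.1 e3).resolve_left hm0
    have := mul_nonneg (sq_nonneg u) (neg_nonneg.2 hy0)
    nlinarith

theorem contDiff_basePart {n : WithTop ℕ∞} : ContDiff ℝ n basePart := by
  unfold basePart
  rw [contDiff_pi]
  intro i
  fin_cases i <;> simp <;> fun_prop

theorem contDiff_formPart {n : WithTop ℕ∞} : ContDiff ℝ n (formPart a b) := by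
  unfold formPart
  rw [contDiff_pi]
  intro i
  fin_cases i <;> simp <;> fun_prop

theorem isSmoothSubmanifold_smoothFibre_aux (hab : a ^ 2 + b ^ 2 = 1) :
    IsSmoothSubmanifold 4 (smoothFibre c (u, v * a, v * b)) := by
  rw [smoothFibre_eq_image hab]
  refine isSmoothSubmanifold_image_levelSet (κ := fun q => (basePart q, formPart a b q))
    (by simp) ?_ (fun z hz => contDiffAt_fibreEqs hz.1)
    (fun z hz hz0 => surjective_fderiv_fibreEqs hz.1 hz.2 hz0)
    (fun z hz => contDiffAt_fibrePoint hz.1) (contDiff_basePart.prodMk contDiff_formPart) ?_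
  · exact (isOpen_lt continuous_const
      ((contDiff_fibreS (n := 0)).continuous.comp continuous_snd)).inter isOpen_ne
  · intro z _
    exact Prod.ext (basePart_asdPoint ..) (formPart_asdPoint hab ..)

end

/-- For `v = 0` the direction is arbitrary. The sign `0 ≤ v` later selects `v = 2 c^(1/4)` on the
singular circle. -/
theorem exists_polar (w : ℝ × ℝ × ℝ) :
    ∃ u v a b : ℝ, 0 ≤ v ∧ a ^ 2 + b ^ 2 = 1 ∧ w = (u, v * a, v * b) := by
  obtain ⟨u, p, q⟩ := w
  by_cases h : p ^ 2 + q ^ 2 = 0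
  · refine ⟨u, 0, 1, 0, le_rfl, by norm_num, ?_⟩
    have hp : p = 0 := by nlinarith [sq_nonneg p, sq_nonneg q]
    have hq : q = 0 := by nlinarith [sq_nonneg p, sq_nonneg q]
    simp [hp, hq]
  · have h0 : 0 ≤ p ^ 2 + q ^ 2 := by positivity
    have hs : √(p ^ 2 + q ^ 2) ≠ 0 := (Real.sqrt_ne_zero h0).2 h
    refine ⟨u, √(p ^ 2 + q ^ 2), p / √(p ^ 2 + q ^ 2), q / √(p ^ 2 + q ^ 2), Real.sqrt_nonneg _, ?_, ?_⟩
    · rw [div_pow, div_pow, Real.sq_sqrt h0]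
      field_simp
    · simp only [Prod.mk.injEq, true_and]
      constructor <;> field_simp

theorem isSmoothSubmanifold_smoothFibre (c : ℝ) (w : ℝ × ℝ × ℝ) :
    IsSmoothSubmanifold 4 (smoothFibre c w) := by
  obtain ⟨u, v, a, b, -, hab, rfl⟩ := exists_polar w
  exact isSmoothSubmanifold_smoothFibre_aux hab

/-! ### The rotation group -/

/-- The action of `3 × 3` matrices on `ℝ³`. -/
def act (A : Fin 3 → Fin 3 → ℝ) (x : Fin 3 → ℝ) : Fin 3 → ℝ := fun k => ∑ m, A k m * x m

/-- The velocities at `t = 0` of the rotations `so3Rotation i t`. -/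
def infRotation : Fin 3 → (Fin 3 → ℝ) → Fin 3 → ℝ :=
  ![fun x => ![0, -x 2, x 1], fun x => ![-x 1, x 0, 0], fun x => ![x 2, 0, -x 0]]

theorem mem_SO3_iff {A : Fin 3 → Fin 3 → ℝ} :
    A ∈ SO3 ↔ (Matrix.of A).transpose * Matrix.of A = 1 ∧ (Matrix.of A).det = 1 := by
  simp only [SO3, mem_ofPred_eq, Matrix.mem_specialOrthogonalGroup_iff,
    Matrix.mem_orthogonalGroup_iff']

theorem dot_act_act {A : Fin 3 → Fin 3 → ℝ} (hA : A ∈ SO3) (x y : Fin 3 → ℝ) :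
    dot (act A x) (act A y) = dot x y := by
  have h := (mem_SO3_iff.1 hA).1
  have e (i j : Fin 3) := congrFun (congrFun h i) j
  simp only [Matrix.mul_apply, Matrix.transpose_apply, Matrix.of_apply, Fin.sum_univ_three,
    Matrix.one_apply] at e
  have e00 := e 0 0
  have e01 := e 0 1
  have e02 := e 0 2
  have e11 := e 1 1
  have e12 := e 1 2
  have e22 := e 2 2
  simp only [Fin.isValue, if_true, Fin.reduceEq, if_false] at e00 e01 e02 e11 e12 e22
  simp only [dot, act, Fin.sum_univ_three]
  linear_combination x 0 * y 0 * e00 + (x 0 * y 1 + x 1 * y 0) * e01 +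
    (x 0 * y 2 + x 2 * y 0) * e02 + x 1 * y 1 * e11 + (x 1 * y 2 + x 2 * y 1) * e12 +
    x 2 * y 2 * e22

/-- The adjugate of a rotation is its transpose. Thus the outer columns, which are visible in `x`
and `f`, determine the middle one. -/
theorem col_one_of_mem_SO3 {A : Fin 3 → Fin 3 → ℝ} (hA : A ∈ SO3) :
    cross (fun k => A k 2) (fun k => A k 0) = fun k => A k 1 := by
  obtain ⟨h1, h2⟩ := mem_SO3_iff.1 hA
  have h3 : (Matrix.of A).adjugate = (Matrix.of A).transpose := by
    have h4 := Matrix.mul_adjugate (Matrix.of A)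
    rw [h2, one_smul] at h4
    calc (Matrix.of A).adjugate
        = (Matrix.of A).transpose * Matrix.of A * (Matrix.of A).adjugate := by rw [h1, one_mul]
      _ = (Matrix.of A).transpose := by rw [mul_assoc, h4, mul_one]
  rw [Matrix.adjugate_fin_three] at h3
  have e (j : Fin 3) := congrFun (congrFun h3 1) j
  ext k
  have := e k
  fin_cases k <;> simp [cross, Matrix.of_apply] at this ⊢ <;> linarith

theorem mem_SO3_of_orthonormal {x z : Fin 3 → ℝ} (hx : dot x x = 1) (hz : dot z z = 1)
    (hxz : dot x z = 0) : (fun k => ![x k, cross z x k, z k]) ∈ SO3 := by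
  simp only [dot] at hx hz hxz
  rw [mem_SO3_iff]
  have hc : (z 1 * x 2 - z 2 * x 1) ^ 2 + (z 2 * x 0 - z 0 * x 2) ^ 2 +
      (z 0 * x 1 - z 1 * x 0) ^ 2 = 1 := by
    linear_combination (x 0 * x 0 + x 1 * x 1 + x 2 * x 2) * hz + hx -
      (x 0 * z 0 + x 1 * z 1 + x 2 * z 2) * hxz
  constructor
  · ext i j
    fin_cases i <;> fin_cases j <;>
      simp [Matrix.mul_apply, Fin.sum_univ_three, cross] <;> linarith
  · rw [Matrix.det_fin_three]
    simp [cross]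
    linarith

theorem so3Rotation_mem_SO3 (i : Fin 3) (t : ℝ) : so3Rotation i t ∈ SO3 := by
  rw [mem_SO3_iff]
  have h := Real.sin_sq_add_cos_sq t
  constructor
  · ext k l
    fin_cases i <;> fin_cases k <;> fin_cases l <;>
      simp [Matrix.mul_apply, Fin.sum_univ_three, so3Rotation] <;> linarith
  · rw [Matrix.det_fin_three]
    fin_cases i <;> simp [so3Rotation] <;> linarith

theorem mul_mem_SO3 {A B : Fin 3 → Fin 3 → ℝ} (hA : A ∈ SO3) (hB : B ∈ SO3) :
    (fun k l => ∑ m, A k m * B m l) ∈ SO3 :=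
  (Matrix.specialOrthogonalGroup (Fin 3) ℝ).mul_mem hA hB

theorem hasDerivAt_act_so3Rotation (A : Fin 3 → Fin 3 → ℝ) (i : Fin 3) (x : Fin 3 → ℝ) :
    HasDerivAt (fun t => act (fun k l => ∑ m, A k m * so3Rotation i t m l) x)
      (act A (infRotation i x)) 0 := by
  have h1 := Real.hasDerivAt_sin 0
  have h2 := Real.hasDerivAt_cos 0
  rw [Real.cos_zero] at h1
  rw [Real.sin_zero, neg_zero] at h2
  have hr : ∀ m, HasDerivAt (fun t => act (so3Rotation i t) x m) (infRotation i x m) 0 := by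
    intro m
    fin_cases i <;> fin_cases m <;>
      simp [act, so3Rotation, infRotation, Fin.sum_univ_three]
    · exact hasDerivAt_const _ _
    · convert! (h2.mul_const (x 1)).sub (h1.mul_const (x 2)) using 1
      simp
    · convert! (h1.mul_const (x 1)).add (h2.mul_const (x 2)) using 1
      simp
    · convert! (h2.mul_const (x 0)).sub (h1.mul_const (x 1)) using 1
      simp
    · convert! (h1.mul_const (x 0)).add (h2.mul_const (x 1)) using 1
      simp
    · exact hasDerivAt_const _ _
    · convert! (h2.mul_const (x 0)).add (h1.mul_const (x 2)) using 1
      simp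
    · exact hasDerivAt_const _ _
    · convert! (h2.mul_const (x 2)).sub (h1.mul_const (x 0)) using 1
      · ext t; simp; ring
      · simp
  rw [hasDerivAt_pi]
  intro k
  have h3 : HasDerivAt (fun t => ∑ m, A k m * act (so3Rotation i t) x m)
      (∑ m, A k m * infRotation i x m) 0 :=
    HasDerivAt.fun_sum fun m _ => (hr m).const_mul (A k m)
  convert! h3 using 1
  ext t
  simp only [act, Finset.sum_mul, Finset.mul_sum]
  rw [Finset.sum_comm]
  exact Finset.sum_congr rfl fun m _ => Finset.sum_congr rfl fun l _ => by ring

/-! ### Curves in the fibres that are transverse to the orbits of `SO(3)` -/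

/-- The map `(R, A) ↦ A · γ(R)`, where `γ` is the curve of the anti-self-dual forms
`asdPoint a b u (C, 0, 0) (τ, 0, ρ) Y`. -/
def orbitMap (a b u : ℝ) (C τ ρ Y : ℝ → ℝ) (q : ConeSpace) : Ambient :=
  asdPoint a b u (act q.2 ![C q.1, 0, 0]) (act q.2 ![τ q.1, 0, ρ q.1]) (Y q.1)

/-- The curve `asdPoint a b u (C, 0, 0) (τ, 0, ρ) Y`, with parameter in `O`, is smooth and lies in the
fibre over `(u, v a, v b)`. -/
structure IsFibreCurve (c u v : ℝ) (O : Set ℝ) (C τ ρ Y : ℝ → ℝ) : Prop where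
  isOpen : IsOpen O
  contDiffAt_C : ∀ R ∈ O, ContDiffAt ℝ ∞ C R
  contDiffAt_τ : ∀ R ∈ O, ContDiffAt ℝ ∞ τ R
  contDiffAt_ρ : ∀ R ∈ O, ContDiffAt ℝ ∞ ρ R
  contDiffAt_Y : ∀ R ∈ O, ContDiffAt ℝ ∞ Y R
  C_pos : ∀ R ∈ O, 0 < C R
  ρ_pos : ∀ R ∈ O, 0 < ρ R
  sphere : ∀ R ∈ O, C R ^ 2 + Y R ^ 2 = 1
  orthogonal : ∀ R ∈ O, C R * τ R = -(u * Y R)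
  S_pos : ∀ R ∈ O, 0 < c + (τ R ^ 2 + ρ R ^ 2 + u ^ 2)
  Y_eq : ∀ R ∈ O, Y R = v / 2 * (c + (τ R ^ 2 + ρ R ^ 2 + u ^ 2)) ^ (-(1 / 4) : ℝ)

theorem act_col_zero (A : Fin 3 → Fin 3 → ℝ) (s : ℝ) (k : Fin 3) :
    act A ![s, 0, 0] k = s * A k 0 := by
  simp [act, Fin.sum_univ_three, mul_comm]

theorem act_col_zero_two (A : Fin 3 → Fin 3 → ℝ) (s t : ℝ) (k : Fin 3) :
    act A ![s, 0, t] k = s * A k 0 + t * A k 2 := by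
  simp [act, Fin.sum_univ_three, mul_comm]

theorem contDiff_act {n : WithTop ℕ∞} :
    ContDiff ℝ n (fun q : (Fin 3 → Fin 3 → ℝ) × (Fin 3 → ℝ) => act q.1 q.2) := by
  unfold act
  fun_prop

namespace IsFibreCurve

variable {c u v a b : ℝ} {O : Set ℝ} {C τ ρ Y : ℝ → ℝ}

theorem eqs (h : IsFibreCurve c u v O C τ ρ Y) {R : ℝ} (hR : R ∈ O) {A : Fin 3 → Fin 3 → ℝ} (hA : A ∈ SO3) :
    fibreS c u (act A ![τ R, 0, ρ R]) = c + (τ R ^ 2 + ρ R ^ 2 + u ^ 2) ∧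
    fibreY c u v (act A ![τ R, 0, ρ R]) = Y R ∧
    fibreEqs c u v (act A ![C R, 0, 0], act A ![τ R, 0, ρ R]) = 0 := by
  have e1 : fibreS c u (act A ![τ R, 0, ρ R]) = c + (τ R ^ 2 + ρ R ^ 2 + u ^ 2) := by
    rw [fibreS, dot_act_act hA]
    simp [dot]
    ring
  have e2 : fibreY c u v (act A ![τ R, 0, ρ R]) = Y R := by
    rw [fibreY, e1, ← h.Y_eq R hR]
  refine ⟨e1, e2, ?_⟩
  rw [fibreEqs_eq_zero_iff]
  simp only [e2, dot_act_act hA]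
  simp [dot]
  exact ⟨by linarith [h.sphere R hR], h.orthogonal R hR⟩

theorem orbitMap_eq (h : IsFibreCurve c u v O C τ ρ Y) {R : ℝ} (hR : R ∈ O) {A : Fin 3 → Fin 3 → ℝ} (hA : A ∈ SO3) :
    orbitMap a b u C τ ρ Y (R, A) =
      fibrePoint c u v a b (act A ![C R, 0, 0], act A ![τ R, 0, ρ R]) := by
  rw [fibrePoint, (h.eqs hR hA).2.1]
  rfl

theorem orbitMap_mem_fibre (h : IsFibreCurve c u v O C τ ρ Y) (hab : a ^ 2 + b ^ 2 = 1) {R : ℝ} (hR : R ∈ O)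
    {A : Fin 3 → Fin 3 → ℝ} (hA : A ∈ SO3) :
    orbitMap a b u C τ ρ Y (R, A) ∈ fibre c (u, v * a, v * b) := by
  obtain ⟨e1, -, e3⟩ := h.eqs hR hA
  rw [fibre_eq_image hab, h.orbitMap_eq hR hA]
  exact ⟨_, ⟨by rw [e1]; exact h.S_pos R hR, e3⟩, rfl⟩

theorem orbitMap_mem_smoothFibre (h : IsFibreCurve c u v O C τ ρ Y) (hab : a ^ 2 + b ^ 2 = 1) {R : ℝ} (hR : R ∈ O)
    {A : Fin 3 → Fin 3 → ℝ} (hA : A ∈ SO3) :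
    orbitMap a b u C τ ρ Y (R, A) ∈ smoothFibre c (u, v * a, v * b) := by
  refine ⟨h.orbitMap_mem_fibre hab hR hA, fun hv => ?_⟩
  rw [h.orbitMap_eq hR hA, fibrePoint_mem_vertices_iff hab (h.eqs hR hA).2.2] at hv
  have h1 : dot (act A ![C R, 0, 0]) (act A ![C R, 0, 0]) = C R ^ 2 := by
    rw [dot_act_act hA]
    simp [dot, pow_two]
  rw [show act A ![C R, 0, 0] = 0 from congrArg Prod.fst hv] at h1
  have := h.C_pos R hR
  simp [dot] at h1
  exact (pow_pos this 2).ne' h1.symm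

theorem add_rSq_orbitMap (h : IsFibreCurve c u v O C τ ρ Y) (hab : a ^ 2 + b ^ 2 = 1) {R : ℝ} (hR : R ∈ O)
    {A : Fin 3 → Fin 3 → ℝ} (hA : A ∈ SO3) :
    c + rSq (orbitMap a b u C τ ρ Y (R, A)) = c + (τ R ^ 2 + ρ R ^ 2 + u ^ 2) := by
  rw [h.orbitMap_eq hR hA, rSq_fibrePoint hab (h.eqs hR hA).2.2, (h.eqs hR hA).1]

theorem basePart_orbitMap (R : ℝ) (A : Fin 3 → Fin 3 → ℝ) :
    basePart (orbitMap a b u C τ ρ Y (R, A)) = act A ![C R, 0, 0] :=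
  basePart_asdPoint ..

theorem formPart_orbitMap (hab : a ^ 2 + b ^ 2 = 1) (R : ℝ) (A : Fin 3 → Fin 3 → ℝ) :
    formPart a b (orbitMap a b u C τ ρ Y (R, A)) = act A ![τ R, 0, ρ R] :=
  formPart_asdPoint hab ..

theorem contDiffAt_orbitMap (h : IsFibreCurve c u v O C τ ρ Y) {q : ConeSpace} (hq : q.1 ∈ O) :
    ContDiffAt ℝ ∞ (orbitMap a b u C τ ρ Y) q := by
  have h1 : ContDiffAt ℝ ∞ (fun q : ConeSpace => C q.1) q :=
    (h.contDiffAt_C _ hq).comp q contDiffAt_fst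
  have h2 : ContDiffAt ℝ ∞ (fun q : ConeSpace => τ q.1) q :=
    (h.contDiffAt_τ _ hq).comp q contDiffAt_fst
  have h3 : ContDiffAt ℝ ∞ (fun q : ConeSpace => ρ q.1) q :=
    (h.contDiffAt_ρ _ hq).comp q contDiffAt_fst
  have h4 : ContDiffAt ℝ ∞ (fun q : ConeSpace => Y q.1) q :=
    (h.contDiffAt_Y _ hq).comp q contDiffAt_fst
  have h5 : ContDiffAt ℝ ∞ (fun q : ConeSpace => act q.2 ![C q.1, 0, 0]) q := by
    refine contDiff_act.contDiffAt.comp (x := q)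
      (f := fun q : ConeSpace => (q.2, ![C q.1, 0, 0])) (contDiffAt_snd.prodMk ?_)
    rw [contDiffAt_pi]
    intro i
    fin_cases i
    exacts [h1, contDiffAt_const, contDiffAt_const]
  have h6 : ContDiffAt ℝ ∞ (fun q : ConeSpace => act q.2 ![τ q.1, 0, ρ q.1]) q := by
    refine contDiff_act.contDiffAt.comp (x := q)
      (f := fun q : ConeSpace => (q.2, ![τ q.1, 0, ρ q.1])) (contDiffAt_snd.prodMk ?_)
    rw [contDiffAt_pi]
    intro i
    fin_cases i
    exacts [h2, contDiffAt_const, h3]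
  exact contDiff_asdPoint.contDiffAt.comp (x := q)
    (f := fun q : ConeSpace => (act q.2 ![C q.1, 0, 0], act q.2 ![τ q.1, 0, ρ q.1], Y q.1))
    (h5.prodMk (h6.prodMk h4))

/-- The inverse is explicit: `rad` gives `R`, then `X = x / C` and `Z = (f - τ X) / ρ` are
orthonormal, and `A` has columns `X`, `Z × X`, `Z`. Besides the recovery of `R`, only `|f|² = τ² +
ρ²` has to be known, since the fibre equations supply `|x|` and `x · f`. -/
theorem isDiffeoOn_orbitMap (h : IsFibreCurve c u v O C τ ρ Y) (hab : a ^ 2 + b ^ 2 = 1)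
    {N : Set Ambient} {rad : Ambient → ℝ}
    (hmem : ∀ R ∈ O, ∀ A ∈ SO3, orbitMap a b u C τ ρ Y (R, A) ∈ N ∧
      rad (orbitMap a b u C τ ρ Y (R, A)) = R)
    (hN : ∀ z, fibreEqs c u v z = 0 → 0 < fibreS c u z.2 → fibrePoint c u v a b z ∈ N →
      rad (fibrePoint c u v a b z) ∈ O ∧ dot z.2 z.2 =
        τ (rad (fibrePoint c u v a b z)) ^ 2 + ρ (rad (fibrePoint c u v a b z)) ^ 2)
    (hfib : N ⊆ fibre c (u, v * a, v * b)) (hrad : ∀ q ∈ N, ContDiffAt ℝ ∞ rad q) :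
    IsDiffeoOn (O ×ˢ SO3) N (orbitMap a b u C τ ρ Y) := by
  set X : Ambient → Fin 3 → ℝ := fun q => (C (rad q))⁻¹ • basePart q with hX
  set Z : Ambient → Fin 3 → ℝ := fun q => (ρ (rad q))⁻¹ • (formPart a b q - τ (rad q) • X q) with hZ
  have hN' : ∀ q ∈ N, ∃ z, fibreEqs c u v z = 0 ∧ fibrePoint c u v a b z = q ∧
      basePart q = z.1 ∧ formPart a b q = z.2 ∧ fibreY c u v z.2 = Y (rad q) ∧
      rad q ∈ O ∧ dot z.2 z.2 = τ (rad q) ^ 2 + ρ (rad q) ^ 2 := by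
    intro q hq
    have hq' := hfib hq
    rw [fibre_eq_image hab] at hq'
    obtain ⟨z, ⟨hz1, hz2⟩, rfl⟩ := hq'
    obtain ⟨h1, h2⟩ := hN z hz2 hz1 hq
    refine ⟨z, hz2, rfl, basePart_asdPoint .., formPart_asdPoint hab .., ?_, h1, h2⟩
    rw [fibreY, fibreS, h2, ← h.Y_eq _ h1]
  refine ⟨fun q hq => (h.contDiffAt_orbitMap hq.1).contDiffWithinAt, ?_,
    fun q => (rad q, fun k => ![X q k, cross (Z q) (X q) k, Z q k]), ?_, ?_⟩
  · ext q
    constructor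
    · rintro ⟨⟨R, A⟩, ⟨hR, hA⟩, rfl⟩
      exact (hmem R hR A hA).1
    · intro hq
      obtain ⟨z, hz, hzq, hb, hf, hY, hR, hff⟩ := hN' q hq
      obtain ⟨e1, e2⟩ := fibreEqs_eq_zero_iff.1 hz
      have hC := h.C_pos _ hR
      have hρ := h.ρ_pos _ hR
      have hs := h.sphere _ hR
      have ho := h.orthogonal _ hR
      rw [hY] at e1 e2
      have hXX : dot (X q) (X q) = 1 := by
        simp only [hX, hb, dot, Pi.smul_apply, smul_eq_mul] at e1 ⊢
        field_simp
        linarith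
      have hXf : dot (X q) z.2 = τ (rad q) := by
        simp only [hX, hb, dot, Pi.smul_apply, smul_eq_mul] at e2 ⊢
        field_simp
        linarith
      have hXZ : dot (X q) (Z q) = 0 := by
        simp only [hZ, hf, dot, Pi.smul_apply, Pi.sub_apply, smul_eq_mul] at hXX hXf ⊢
        field_simp
        linear_combination hXf - τ (rad q) * hXX
      have hZZ : dot (Z q) (Z q) = 1 := by
        simp only [hZ, hf, dot, Pi.smul_apply, Pi.sub_apply, smul_eq_mul] at hXX hXf hff ⊢
        field_simp
        linear_combination hff - 2 * τ (rad q) * hXf + τ (rad q) ^ 2 * hXX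
      have hA := mem_SO3_of_orthonormal hXX hZZ hXZ
      refine ⟨(rad q, fun k => ![X q k, cross (Z q) (X q) k, Z q k]), ⟨hR, hA⟩, ?_⟩
      rw [h.orbitMap_eq hR hA, ← hzq]
      congr 1
      rw [hzq]
      refine Prod.ext ?_ ?_
      · ext k
        simp only [act_col_zero, hX, hb]
        simp
        field_simp
      · ext k
        simp only [act_col_zero_two, hZ, hf]
        simp
        field_simp
        ring
  · intro q hq
    obtain ⟨z, hz, hzq, hb, hf, hY, hR, hff⟩ := hN' q hq
    have hr := hrad q hq
    have h1 : ContDiffAt ℝ ∞ (fun q => C (rad q)) q := (h.contDiffAt_C _ hR).comp q hr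
    have h2 : ContDiffAt ℝ ∞ (fun q => τ (rad q)) q := (h.contDiffAt_τ _ hR).comp q hr
    have h3 : ContDiffAt ℝ ∞ (fun q => ρ (rad q)) q := (h.contDiffAt_ρ _ hR).comp q hr
    have hXs : ContDiffAt ℝ ∞ X q :=
      (h1.inv (h.C_pos _ hR).ne').smul contDiff_basePart.contDiffAt
    have hZs : ContDiffAt ℝ ∞ Z q :=
      (h3.inv (h.ρ_pos _ hR).ne').smul (contDiff_formPart.contDiffAt.sub (h2.smul hXs))
    have hXk (k : Fin 3) : ContDiffAt ℝ ∞ (fun q => X q k) q := contDiffAt_pi.1 hXs k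
    have hZk (k : Fin 3) : ContDiffAt ℝ ∞ (fun q => Z q k) q := contDiffAt_pi.1 hZs k
    refine ContDiffAt.contDiffWithinAt (hr.prodMk ?_)
    rw [contDiffAt_pi]
    intro k
    rw [contDiffAt_pi]
    intro l
    fin_cases l
    · exact hXk k
    · fin_cases k <;> simp only [cross] <;>
        exact ((hZk _).mul (hXk _)).sub ((hZk _).mul (hXk _))
    · exact hZk k
  · rintro ⟨R, A⟩ ⟨hR, hA⟩
    have hr := (hmem R hR A hA).2
    have hC := h.C_pos _ hR
    have hρ := h.ρ_pos _ hR
    have hX0 : X (orbitMap a b u C τ ρ Y (R, A)) = fun k => A k 0 := by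
      ext k
      simp only [hX, hr, basePart_orbitMap, Pi.smul_apply, act_col_zero, smul_eq_mul]
      field_simp
    have hZ0 : Z (orbitMap a b u C τ ρ Y (R, A)) = fun k => A k 2 := by
      ext k
      simp only [hZ, hr, formPart_orbitMap hab, Pi.smul_apply, Pi.sub_apply, act_col_zero_two, hX0,
        smul_eq_mul]
      field_simp
      ring
    simp only [hr, hX0, hZ0, col_one_of_mem_SO3 hA]
    refine Prod.ext rfl ?_
    ext k l
    fin_cases l <;> rfl

end IsFibreCurve

/-! ### The metric in the left-invariant frame -/

theorem smul_asdTangent (s a b u : ℝ) (x f : Fin 3 → ℝ) (y : ℝ) (x' f' : Fin 3 → ℝ) (y' : ℝ) :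
    s • asdTangent a b u x f y x' f' y' =
      asdTangent a b u x f y (s • x') (s • f') (s * y') := by
  refine Prod.ext ?_ ?_
  · ext i
    fin_cases i <;> simp [asdTangent, spherePoint] <;> ring
  · ext i j
    fin_cases i <;> fin_cases j <;> simp [asdTangent, blockForm, cross] <;> ring

theorem smul_act (s : ℝ) (A : Fin 3 → Fin 3 → ℝ) (x : Fin 3 → ℝ) : s • act A x = act A (s • x) := by
  ext k
  simp [act, Fin.sum_univ_three]
  ring

theorem hasDerivAt_asdPoint (a b u : ℝ) {x f : ℝ → Fin 3 → ℝ} {y : ℝ → ℝ} {x' f' : Fin 3 → ℝ}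
    {y' t : ℝ} (hx : HasDerivAt x x' t) (hf : HasDerivAt f f' t) (hy : HasDerivAt y y' t) :
    HasDerivAt (fun t => asdPoint a b u (x t) (f t) (y t))
      (asdTangent a b u (x t) (f t) (y t) x' f' y') t := by
  have hxi := hasDerivAt_pi.1 hx
  have hfi := hasDerivAt_pi.1 hf
  have hz := hasDerivAt_const t (0 : ℝ)
  have hu := hasDerivAt_const t u
  have he (i : Fin 3) : HasDerivAt (fun t => (y t • f t - u • x t) i)
      ((y' • f t + y t • f' - u • x') i) t :=
    (hy.mul (hfi i)).sub ((hxi i).const_mul u)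
  have hn (i : Fin 3) : HasDerivAt (fun t => cross (f t) (x t) i)
      ((cross f' (x t) + cross (f t) x') i) t := by
    fin_cases i
    · convert! ((hfi 1).mul (hxi 2)).sub ((hfi 2).mul (hxi 1)) using 1
      simp [cross]; ring
    · convert! ((hfi 2).mul (hxi 0)).sub ((hfi 0).mul (hxi 2)) using 1
      simp [cross]; ring
    · convert! ((hfi 0).mul (hxi 1)).sub ((hfi 1).mul (hxi 0)) using 1
      simp [cross]; ring
  have h3 (i : Fin 3) := ((hn i).const_mul a).sub ((hfi i).const_mul b)
  have h4 (i : Fin 3) := ((hn i).const_mul b).add ((hfi i).const_mul a)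
  refine HasDerivAt.prodMk ?_ ?_
  · rw [hasDerivAt_pi]
    intro i
    fin_cases i
    exacts [hxi 0, hxi 1, hxi 2, hy.const_mul a, hy.const_mul b]
  · rw [hasDerivAt_pi]
    intro i
    rw [hasDerivAt_pi]
    intro j
    fin_cases i <;> fin_cases j
    exacts [hz, he 2, (he 1).neg, h3 0, h4 0, (he 2).neg, hz, he 0, h3 1, h4 1,
      he 1, (he 0).neg, hz, h3 2, h4 2, (h3 0).neg, (h3 1).neg, (h3 2).neg, hz, hu,
      (h4 0).neg, (h4 1).neg, (h4 2).neg, hu.neg, hz]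

/-- The velocity of the `ℝ³`-component of the base point along the cone frame, moved back to the curve. -/
def frameBase (l : Fin 3 → ℝ) (R C C' : ℝ) : Option (Fin 3) → Fin 3 → ℝ
  | none => ![C', 0, 0]
  | some i => (R * √(l i))⁻¹ • infRotation i ![C, 0, 0]

/-- The velocity of the `ℝ³`-component of the form along the cone frame, moved back to the curve. -/
def frameForm (l : Fin 3 → ℝ) (R τ ρ τ' ρ' : ℝ) : Option (Fin 3) → Fin 3 → ℝ
  | none => ![τ', 0, ρ']
  | some i => (R * √(l i))⁻¹ • infRotation i ![τ, 0, ρ]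

/-- The velocity of the radial component of the base point along the cone frame. -/
def frameRadial (Y' : ℝ) : Option (Fin 3) → ℝ
  | none => Y'
  | some _ => 0

namespace IsFibreCurve

variable {c u v a b : ℝ} {O : Set ℝ} {C τ ρ Y : ℝ → ℝ}

/-- The left-invariant fields have right multiplications as flows, so `A` stays outside and
infinitesimal rotations act on the fixed vectors of the curve. -/
theorem frameDeriv_orbitMap (h : IsFibreCurve c u v O C τ ρ Y) (l : Fin 3 → ℝ) {R : ℝ} (hR : R ∈ O)
    (A : Fin 3 → Fin 3 → ℝ) (i : Option (Fin 3)) :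
    frameDeriv l (orbitMap a b u C τ ρ Y) i (R, A) =
      asdTangent a b u (act A ![C R, 0, 0]) (act A ![τ R, 0, ρ R]) (Y R)
        (act A (frameBase l R (C R) (deriv C R) i))
        (act A (frameForm l R (τ R) (ρ R) (deriv τ R) (deriv ρ R) i))
        (frameRadial (deriv Y R) i) := by
  have hd {g : ℝ → ℝ} (hg : ContDiffAt ℝ ∞ g R) : HasDerivAt g (deriv g R) R :=
    (hg.differentiableAt (by simp)).hasDerivAt
  have hz := hasDerivAt_const R (0 : ℝ)
  have hact (A : Fin 3 → Fin 3 → ℝ) {x : ℝ → Fin 3 → ℝ} {x' : Fin 3 → ℝ}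
      (hx : ∀ i, HasDerivAt (fun t => x t i) (x' i) R) :
      HasDerivAt (fun t => act A (x t)) (act A x') R := by
    rw [hasDerivAt_pi]
    intro k
    exact HasDerivAt.fun_sum fun m _ => (hx m).const_mul (A k m)
  rcases i with _ | i
  · refine HasDerivAt.deriv (hasDerivAt_asdPoint a b u (hact A fun k => ?_) (hact A fun k => ?_)
      (hd (h.contDiffAt_Y R hR)))
    · fin_cases k
      exacts [hd (h.contDiffAt_C R hR), hz, hz]
    · fin_cases k
      exacts [hd (h.contDiffAt_τ R hR), hz, hd (h.contDiffAt_ρ R hR)]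
  · have h1 : (fun k l => ∑ m, A k m * so3Rotation i 0 m l) = A := by
      ext k l
      fin_cases i <;> fin_cases l <;> simp [so3Rotation, Fin.sum_univ_three]
    have h2 := hasDerivAt_asdPoint a b u (hasDerivAt_act_so3Rotation A i ![C R, 0, 0])
      (hasDerivAt_act_so3Rotation A i ![τ R, 0, ρ R]) (hasDerivAt_const 0 (Y R))
    simp only [h1] at h2
    have h3 := h2.deriv
    simp only [frameDeriv, frameBase, frameForm, frameRadial]
    refine (congrArg _ h3).trans ?_
    rw [smul_asdTangent, smul_act, smul_act, mul_zero]

theorem metricDifference_orbitMap (h : IsFibreCurve c u v O C τ ρ Y) (hab : a ^ 2 + b ^ 2 = 1)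
    (l : Fin 3 → ℝ) {R W : ℝ} (hR : R ∈ O) (hW : √(c + (τ R ^ 2 + ρ R ^ 2 + u ^ 2)) = W)
    {A : Fin 3 → Fin 3 → ℝ} (hA : A ∈ SO3) (I : Fin 2 → Option (Fin 3)) :
    metricDifference l (bsMetric c) (orbitMap a b u C τ ρ Y) I (R, A) =
      W⁻¹ * (dot (frameForm l R (τ R) (ρ R) (deriv τ R) (deriv ρ R) (I 0))
            (frameForm l R (τ R) (ρ R) (deriv τ R) (deriv ρ R) (I 1)) -
          dot ![C R, 0, 0] (frameForm l R (τ R) (ρ R) (deriv τ R) (deriv ρ R) (I 0)) *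
          dot ![C R, 0, 0] (frameForm l R (τ R) (ρ R) (deriv τ R) (deriv ρ R) (I 1))) +
        2 * W * (dot (frameBase l R (C R) (deriv C R) (I 0))
            (frameBase l R (C R) (deriv C R) (I 1)) +
          frameRadial (deriv Y R) (I 0) * frameRadial (deriv Y R) (I 1)) -
        if I 0 = I 1 then 1 else 0 := by
  obtain ⟨e1, e2, e3⟩ := h.eqs hR hA
  obtain ⟨e4, e5⟩ := fibreEqs_eq_zero_iff.1 e3
  rw [e2] at e4 e5
  -- Differentiating `C² + Y² = 1` shows that the radial velocity is tangent to the sphere, as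
  -- `bsMetric_asdTangent` requires.
  have hC : C R * deriv C R + Y R * deriv Y R = 0 := by
    have h1 := ((h.contDiffAt_C R hR).differentiableAt (by simp)).hasDerivAt.pow 2
    have h2 := ((h.contDiffAt_Y R hR).differentiableAt (by simp)).hasDerivAt.pow 2
    have h3 : (fun t => C t ^ 2 + Y t ^ 2) =ᶠ[𝓝 R] fun _ => 1 :=
      eventually_of_mem (h.isOpen.mem_nhds hR) fun t ht => h.sphere t ht
    have h4 := (h1.add h2).unique ((hasDerivAt_const R (1 : ℝ)).congr_of_eventuallyEq h3)
    simp at h4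
    linarith
  have ht (i : Option (Fin 3)) : dot (act A ![C R, 0, 0])
      (act A (frameBase l R (C R) (deriv C R) i)) + Y R * frameRadial (deriv Y R) i = 0 := by
    rw [dot_act_act hA]
    rcases i with _ | i
    · simpa [dot, frameBase, frameRadial] using hC
    · fin_cases i <;> simp [dot, frameBase, frameRadial, infRotation]
  have key := bsMetric_asdTangent c hab e4 e5 (ht (I 0)) (ht (I 1))
    (f' := act A (frameForm l R (τ R) (ρ R) (deriv τ R) (deriv ρ R) (I 0)))
    (f'' := act A (frameForm l R (τ R) (ρ R) (deriv τ R) (deriv ρ R) (I 1)))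
  simp only [metricDifference, h.frameDeriv_orbitMap l hR A]
  refine congrArg (· - _) (key.trans ?_)
  rw [show c + (dot (act A ![τ R, 0, ρ R]) (act A ![τ R, 0, ρ R]) + u ^ 2) =
    c + (τ R ^ 2 + ρ R ^ 2 + u ^ 2) from e1, hW]
  simp only [dot_act_act hA]

end IsFibreCurve

/-! ### Covariant derivatives of left-invariant tensors on a cone -/

/-- `σ` is a parameter for the end of the half-line described by `l`, homogeneous of degree `ε`. -/
structure IsConeParam (l : Filter ℝ) (σ : ℝ → ℝ) (ε : ℝ) : Prop where
  pos : ∀ᶠ R in l, 0 < R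
  eventually_nhds : ∀ P : ℝ → Prop, (∀ᶠ R in l, P R) → ∀ᶠ R in l, ∀ᶠ R' in 𝓝 R, P R'
  tendsto : Tendsto σ l (𝓝 0)
  hasDerivAt : ∀ᶠ R in l, HasDerivAt σ (ε * (σ R / R)) R

theorem isConeParam_inv_atTop : IsConeParam atTop (fun R => R⁻¹) (-1) where
  pos := eventually_gt_atTop 0
  eventually_nhds P hP := by
    obtain ⟨B, hB⟩ := eventually_atTop.1 hP
    filter_upwards [eventually_gt_atTop B] with R hR
    filter_upwards [Ioi_mem_nhds hR] with R' hR'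
    exact hB R' (le_of_lt hR')
  tendsto := tendsto_inv_atTop_zero
  hasDerivAt := by
    filter_upwards [eventually_gt_atTop 0] with R hR
    convert! hasDerivAt_inv hR.ne' using 1
    field_simp

theorem isConeParam_id : IsConeParam (𝓝[>] 0) (fun R => R) 1 where
  pos := self_mem_nhdsWithin
  eventually_nhds P hP := by
    have := eventually_eventually_nhdsWithin.2 hP
    filter_upwards [this, self_mem_nhdsWithin] with R hR hR0
    rwa [isOpen_Ioi.nhdsWithin_eq hR0] at hR
  tendsto := tendsto_nhdsWithin_of_tendsto_nhds tendsto_id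
  hasDerivAt := by
    filter_upwards [self_mem_nhdsWithin] with R hR
    have hR0 : R ≠ 0 := ne_of_gt hR
    convert! hasDerivAt_id R using 1
    field_simp

/-- The components of `T` are invariant under left translations and of the form
`R ^ m * k (σ R)` with `k` analytic at `0`. -/
def HasConeOrder (l : Filter ℝ) (σ : ℝ → ℝ) (m : ℝ) {n : ℕ}
    (T : (Fin n → Option (Fin 3)) → ConeSpace → ℝ) : Prop :=
  ∃ k : (Fin n → Option (Fin 3)) → ℝ → ℝ, (∀ I, AnalyticAt ℝ (k I) 0) ∧
    ∀ᶠ R in l, ∀ A ∈ SO3, ∀ I, T I (R, A) = R ^ m * k I (σ R)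

theorem frameBracket_eq (a : Fin 3 → ℝ) (R : ℝ) (b c d : Option (Fin 3)) :
    frameBracket a R b c d = R⁻¹ * frameBracket a 1 b c d := by
  rcases b with _ | i <;> rcases c with _ | j <;> rcases d with _ | k <;>
    (simp [frameBracket]; try ring)

theorem connectionCoeff_eq (a : Fin 3 → ℝ) (R : ℝ) (b c d : Option (Fin 3)) :
    connectionCoeff a R b c d = R⁻¹ * connectionCoeff a 1 b c d := by
  simp only [connectionCoeff]
  rw [frameBracket_eq a R b c d, frameBracket_eq a R c d b, frameBracket_eq a R d b c]
  ring

/-- In the unit frame the connection coefficients are `R⁻¹` times constants, and left-invariant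
fields annihilate the components. Radially, `∂_R (R^m k(σ)) = R^(m-1) (m k + ε σ k')(σ)`, and `s
k'(s)` is again analytic. -/
theorem HasConeOrder.covDeriv {l : Filter ℝ} {σ : ℝ → ℝ} {ε : ℝ} (hσ : IsConeParam l σ ε) {m : ℝ}
    {n : ℕ} {T : (Fin n → Option (Fin 3)) → ConeSpace → ℝ} (hT : HasConeOrder l σ m T)
    (a : Fin 3 → ℝ) : HasConeOrder l σ (m - 1) (covDeriv a T) := by
  obtain ⟨k, hk, hTk⟩ := hT
  refine ⟨fun I s => (if I 0 = none then m * k (Fin.tail I) s + ε * (s * deriv (k (Fin.tail I)) s)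
      else 0) - ∑ p : Fin n, ∑ d : Option (Fin 3),
        connectionCoeff a 1 (I 0) (I p.succ) d * k (Function.update (Fin.tail I) p d) s, ?_, ?_⟩
  · intro I
    refine AnalyticAt.sub ?_ ?_
    · split_ifs
      · exact (analyticAt_const.mul (hk _)).add
          (analyticAt_const.mul (analyticAt_id.mul (hk _).deriv))
      · exact analyticAt_const
    · refine Finset.analyticAt_fun_sum _ fun p _ => Finset.analyticAt_fun_sum _ fun d _ => ?_
      exact analyticAt_const.mul (hk _)
  · have hdiff : ∀ᶠ R in l, ∀ I, DifferentiableAt ℝ (k I) (σ R) := by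
      refine hσ.tendsto.eventually (eventually_all.2 fun I => ?_)
      exact (hk I).eventually_analyticAt.mono fun s hs => hs.differentiableAt
    -- The formula for `T` is needed on a neighbourhood of `R`, in order to be differentiated.
    filter_upwards [hσ.pos, hσ.eventually_nhds _ hTk, hTk, hσ.hasDerivAt, hdiff]
      with R hR hn hT hd hk' A hA I
    have hpow : R ^ m = R ^ (m - 1) * R := by
      rw [Real.rpow_sub_one hR.ne']
      field_simp
    have hframe : frameDeriv a (T (Fin.tail I)) (I 0) (R, A) = R ^ (m - 1) *
        (if I 0 = none then m * k (Fin.tail I) (σ R) +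
          ε * (σ R * deriv (k (Fin.tail I)) (σ R)) else 0) := by
      rcases hI : I 0 with _ | i
      · have h1 : (fun t => T (Fin.tail I) (t, A)) =ᶠ[𝓝 R]
            fun t => t ^ m * k (Fin.tail I) (σ t) := hn.mono fun t ht => ht A hA _
        have h2 := (Real.hasDerivAt_rpow_const (p := m) (Or.inl hR.ne')).mul
          ((hk' (Fin.tail I)).hasDerivAt.comp R hd)
        have h3 := (h2.congr_of_eventuallyEq h1).deriv
        simp only [frameDeriv, if_true]
        refine h3.trans ?_
        rw [hpow]
        field_simp
        simp only [Function.comp_apply]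
      · have h1 : (fun t => T (Fin.tail I) (R, fun p q => ∑ r, A p r * so3Rotation i t r q)) =
            fun _ => R ^ m * k (Fin.tail I) (σ R) := by
          ext t
          exact hT _ (mul_mem_SO3 hA (so3Rotation_mem_SO3 i t)) _
        simp only [frameDeriv, h1, deriv_const, smul_zero]
        simp
    simp only [_root_.covDeriv, hframe, mul_sub, Finset.mul_sum]
    congr 1
    refine Finset.sum_congr rfl fun p _ => Finset.sum_congr rfl fun d _ => ?_
    rw [hT A hA, connectionCoeff_eq, hpow]
    field_simp

theorem HasConeOrder.iterCovDeriv {l : Filter ℝ} {σ : ℝ → ℝ} {ε : ℝ} (hσ : IsConeParam l σ ε)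
    {m : ℝ} {T : (Fin 2 → Option (Fin 3)) → ConeSpace → ℝ} (hT : HasConeOrder l σ m T)
    (a : Fin 3 → ℝ) (j : ℕ) : HasConeOrder l σ (m - j) (iterCovDeriv a T j) := by
  induction j with
  | zero => simpa [_root_.iterCovDeriv] using hT
  | succ j ih =>
    have := ih.covDeriv hσ a
    rw [sub_sub] at this
    push_cast
    exact this

/-- Continuity of `k` at `0` bounds the components, uniformly in `A` because they do not depend on
it. -/
theorem HasConeOrder.isBigO {l : Filter ℝ} {σ : ℝ → ℝ} {ε : ℝ} (hσ : IsConeParam l σ ε) {m : ℝ}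
    {n : ℕ} {T : (Fin n → Option (Fin 3)) → ConeSpace → ℝ} (hT : HasConeOrder l σ m T) :
    (fun x => tensorNorm T x) =O[l ×ˢ 𝓟 SO3] fun x => x.1 ^ m := by
  obtain ⟨k, hk, hTk⟩ := hT
  have hb : ∀ᶠ R in l, ∀ I : Fin n → Option (Fin 3), |k I (σ R)| < |k I 0| + 1 := by
    refine hσ.tendsto.eventually (p := fun s => ∀ I, |k I s| < |k I 0| + 1)
      (eventually_all.2 fun I => ?_)
    exact (hk I).continuousAt.abs.eventually_lt_const (by simp)
  refine IsBigO.of_bound √(∑ I : Fin n → Option (Fin 3), (|k I 0| + 1) ^ 2) ?_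
  rw [eventually_prod_principal_iff]
  filter_upwards [hσ.pos, hTk, hb] with R hR hT hb A hA
  rw [tensorNorm, Real.norm_of_nonneg (Real.sqrt_nonneg _),
    Real.norm_of_nonneg (Real.rpow_nonneg hR.le _)]
  have hm : 0 ≤ R ^ m := Real.rpow_nonneg hR.le _
  rw [← Real.sqrt_sq hm, ← Real.sqrt_mul (Finset.sum_nonneg fun I _ => sq_nonneg _)]
  refine Real.sqrt_le_sqrt ?_
  rw [Finset.sum_mul]
  refine Finset.sum_le_sum fun I _ => ?_
  rw [hT A hA I, mul_pow, mul_comm]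
  refine mul_le_mul_of_nonneg_right ?_ (sq_nonneg _)
  rw [← sq_abs]
  exact pow_le_pow_left₀ (abs_nonneg _) (hb I).le 2

/-- The components of the induced metric minus the cone metric in the cone frame, along a curve as in
`IsFibreCurve`; `s i` is the length of the `i`-th dual basis vector of the cone metric. -/
def gramDefect (W C τ ρ Y C' τ' ρ' Y' : ℝ) (s : Fin 3 → ℝ) :
    Option (Fin 3) → Option (Fin 3) → ℝ
  | none, none => W⁻¹ * (Y ^ 2 * τ' ^ 2 + ρ' ^ 2) + 2 * W * (C' ^ 2 + Y' ^ 2) - 1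
  | none, some 2 => s 2 * (W⁻¹ * (Y ^ 2 * τ' * ρ - ρ' * τ))
  | some 2, none => s 2 * (W⁻¹ * (Y ^ 2 * τ' * ρ - ρ' * τ))
  | some 0, some 0 => s 0 ^ 2 * (W⁻¹ * ρ ^ 2) - 1
  | some 0, some 1 => -(s 0 * s 1 * (W⁻¹ * (ρ * τ)))
  | some 1, some 0 => -(s 0 * s 1 * (W⁻¹ * (ρ * τ)))
  | some 1, some 1 => s 1 ^ 2 * (W⁻¹ * τ ^ 2 + 2 * W * C ^ 2) - 1
  | some 2, some 2 => s 2 ^ 2 * (W⁻¹ * (Y ^ 2 * ρ ^ 2 + τ ^ 2) + 2 * W * C ^ 2) - 1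
  | _, _ => 0

/-- `∂_R` and the field of index `2` move both vectors within the plane of the first and third axes,
while those of index `0` and `1` move them along the second axis. So the only mixed terms are
`(none, 2)` and `(0, 1)`. -/
theorem IsFibreCurve.metricDifference_eq_gramDefect {c u v a b : ℝ} {O : Set ℝ} {C τ ρ Y : ℝ → ℝ}
    (h : IsFibreCurve c u v O C τ ρ Y) (hab : a ^ 2 + b ^ 2 = 1)
    (l : Fin 3 → ℝ) {R W : ℝ} (hR : R ∈ O) (hW : √(c + (τ R ^ 2 + ρ R ^ 2 + u ^ 2)) = W)
    {A : Fin 3 → Fin 3 → ℝ} (hA : A ∈ SO3) (I : Fin 2 → Option (Fin 3)) :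
    metricDifference l (bsMetric c) (orbitMap a b u C τ ρ Y) I (R, A) =
      gramDefect W (C R) (τ R) (ρ R) (Y R) (deriv C R) (deriv τ R) (deriv ρ R) (deriv Y R)
        (fun i => (R * √(l i))⁻¹) (I 0) (I 1) := by
  rw [h.metricDifference_orbitMap hab l hR hW hA]
  have hs := h.sphere R hR
  generalize I 0 = i
  generalize I 1 = j
  generalize C R = C₀ at *
  generalize Y R = Y₀ at *
  generalize τ R = τ₀
  generalize ρ R = ρ₀
  generalize deriv C R = C₁
  generalize deriv Y R = Y₁
  generalize deriv τ R = τ₁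
  generalize deriv ρ R = ρ₁
  rcases i with _ | i
  · rcases j with _ | j
    · simp [gramDefect, frameForm, frameBase, frameRadial, dot]
      linear_combination W⁻¹ * τ₁ ^ 2 * -hs
    · have e : (none : Option (Fin 3)) ≠ some j := by simp
      simp only [e, if_false]
      generalize hk : (fun i => (R * √(l i))⁻¹) = s
      have hk' : (R * √(l j))⁻¹ = s j := congrFun hk j
      fin_cases j <;> simp at hk' <;>
        simp [gramDefect, frameForm, frameBase, frameRadial, dot, infRotation, hk']
      linear_combination -s 2 * W⁻¹ * τ₁ * ρ₀ * hs
  · rcases j with _ | j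
    · have e : some i ≠ (none : Option (Fin 3)) := by simp
      simp only [e, if_false]
      generalize hk : (fun i => (R * √(l i))⁻¹) = s
      have hk' : (R * √(l i))⁻¹ = s i := congrFun hk i
      fin_cases i <;> simp at hk' <;>
        simp [gramDefect, frameForm, frameBase, frameRadial, dot, infRotation, hk']
      linear_combination -s 2 * W⁻¹ * τ₁ * ρ₀ * hs
    · generalize hk : (fun i => (R * √(l i))⁻¹) = s
      have hk' : (R * √(l i))⁻¹ = s i := congrFun hk i
      have hk2 : (R * √(l j))⁻¹ = s j := congrFun hk j
      fin_cases i <;> fin_cases j <;> simp at hk' hk2 <;>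
        simp [gramDefect, frameForm, frameBase, frameRadial, dot, infRotation, hk', hk2]
      · ring
      · ring
      · ring
      · ring
      · linear_combination -s 2 ^ 2 * W⁻¹ * ρ₀ ^ 2 * hs

/-! ### The asymptotically conical ends -/

/-- The `ℝ³`-component of the base point at radius `R`, on the end of the fibre. -/
def endC (v R : ℝ) : ℝ := √(1 - (v / R) ^ 2)

/-- The component of the form along the base point at radius `R`, on the end of the fibre. -/
def endτ (u v R : ℝ) : ℝ := -(u * (v / R)) / endC v R

/-- The component of the form orthogonal to the base point at radius `R`, on the end of the fibre. -/
def endρ (c u v R : ℝ) : ℝ := √(R ^ 4 / 16 - c - u ^ 2 - endτ u v R ^ 2)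

/-- The curve `(endC, endτ, endρ)` is defined for `R > R₀`. -/
structure IsEndRadius (c u v R₀ : ℝ) : Prop where
  nonneg : 0 ≤ R₀
  C_pos : ∀ R, R₀ < R → 0 < 1 - (v / R) ^ 2
  ρ_pos : ∀ R, R₀ < R → 0 < R ^ 4 / 16 - c - u ^ 2 - endτ u v R ^ 2

theorem exists_isEndRadius {c : ℝ} (hc : 0 ≤ c) (u v : ℝ) :
    ∃ R₀, 0 < R₀ ∧ IsEndRadius c u v R₀ := by
  -- The term `2 |v|` gives `(v / R)² ≤ 1 / 4`, hence `τ² ≤ u²`; the other terms give `R⁴ / 16 ≥ R /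
  -- 16 > c + 2 u²`.
  refine ⟨1 + 2 * |v| + 16 * (c + 2 * u ^ 2), by positivity, by positivity, ?_, ?_⟩
  all_goals
    intro R hR
    have h0 : 0 ≤ 16 * (c + 2 * u ^ 2) := by positivity
    have hv := abs_nonneg v
    have hR1 : 1 ≤ R := by linarith
    have hvR : (v / R) ^ 2 ≤ 1 / 4 := by
      rw [div_pow, div_le_iff₀ (by positivity), ← sq_abs v]
      nlinarith
  · linarith
  · have hC : 0 < 1 - (v / R) ^ 2 := by linarith
    have hτ : endτ u v R ^ 2 ≤ u ^ 2 := by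
      rw [endτ, endC, div_pow, Real.sq_sqrt hC.le, div_le_iff₀ hC, neg_sq, mul_pow]
      exact mul_le_mul_of_nonneg_left (by linarith) (sq_nonneg u)
    have h4 : R ≤ R ^ 4 := le_self_pow₀ hR1 (by norm_num)
    linarith

namespace IsEndRadius

variable {c u v R₀ : ℝ}

theorem endS_eq (h : IsEndRadius c u v R₀) {R : ℝ} (hR : R₀ < R) :
    c + (endτ u v R ^ 2 + endρ c u v R ^ 2 + u ^ 2) = R ^ 4 / 16 := by
  rw [endρ, Real.sq_sqrt (h.ρ_pos R hR).le]
  ring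

/-- `endρ` is chosen so that `c + r² = R⁴ / 16`, whose power `-1 / 4` is `2 / R`; this turns the
equation for `Y` into `Y = v / R`. -/
theorem isFibreCurve (h : IsEndRadius c u v R₀) :
    IsFibreCurve c u v (Ioi R₀) (endC v) (endτ u v) (endρ c u v) (fun R => v / R) := by
  have hpos : ∀ R ∈ Ioi R₀, 0 < R := fun R hR => h.nonneg.trans_lt hR
  have hY : ∀ R ∈ Ioi R₀, ContDiffAt ℝ ∞ (fun R => v / R) R := fun R hR =>
    contDiffAt_const.div contDiffAt_id (hpos R hR).ne'
  have hC : ∀ R ∈ Ioi R₀, ContDiffAt ℝ ∞ (endC v) R := fun R hR =>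
    (contDiffAt_const.sub ((hY R hR).pow 2)).sqrt (h.C_pos R hR).ne'
  have hC0 : ∀ R ∈ Ioi R₀, 0 < endC v R := fun R hR => Real.sqrt_pos.2 (h.C_pos R hR)
  have hτ : ∀ R ∈ Ioi R₀, ContDiffAt ℝ ∞ (endτ u v) R := fun R hR =>
    (contDiffAt_const.mul (hY R hR)).neg.div (hC R hR) (hC0 R hR).ne'
  refine ⟨isOpen_Ioi, hC, hτ, ?_, hY, hC0, fun R hR => Real.sqrt_pos.2 (h.ρ_pos R hR), ?_, ?_, ?_, ?_⟩
  · intro R hR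
    refine ContDiffAt.sqrt ?_ (h.ρ_pos R hR).ne'
    exact ((((contDiffAt_id.pow 4).div_const 16).sub contDiffAt_const).sub
      contDiffAt_const).sub ((hτ R hR).pow 2)
  · intro R hR
    rw [endC, Real.sq_sqrt (h.C_pos R hR).le]
    ring
  · intro R hR
    have := (hC0 R hR).ne'
    rw [endτ]
    field_simp
  · intro R hR
    rw [h.endS_eq hR]
    have := hpos R hR
    positivity
  · intro R hR
    have hR0 := hpos R hR
    rw [h.endS_eq hR, show R ^ 4 / 16 = (R / 2) ^ (4 : ℕ) by ring, ← Real.rpow_natCast_mul (by positivity)]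
    norm_num
    rw [Real.rpow_neg_one]
    field_simp

theorem isDiffeoOn (h : IsEndRadius c u v R₀) {a b : ℝ} (hab : a ^ 2 + b ^ 2 = 1) :
    IsDiffeoOn (Ioi R₀ ×ˢ SO3)
      {q ∈ smoothFibre c (u, v * a, v * b) | R₀ < 2 * (c + rSq q) ^ (1 / 4 : ℝ)}
      (orbitMap a b u (endC v) (endτ u v) (endρ c u v) (fun R => v / R)) := by
  have hrp {R : ℝ} (hR : 0 < R) : 2 * (R ^ 4 / 16) ^ (1 / 4 : ℝ) = R := by
    rw [show R ^ 4 / 16 = (R / 2) ^ (4 : ℕ) by ring, ← Real.rpow_natCast_mul (by positivity)]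
    norm_num
    field_simp
  refine h.isFibreCurve.isDiffeoOn_orbitMap hab (rad := fun q => 2 * (c + rSq q) ^ (1 / 4 : ℝ))
    ?_ ?_ ?_ ?_
  · intro R hR A hA
    have e : 2 * (c + rSq (orbitMap a b u (endC v) (endτ u v) (endρ c u v)
        (fun R => v / R) (R, A))) ^ (1 / 4 : ℝ) = R := by
      rw [h.isFibreCurve.add_rSq_orbitMap hab hR hA, h.endS_eq hR, hrp (h.nonneg.trans_lt hR)]
    exact ⟨⟨h.isFibreCurve.orbitMap_mem_smoothFibre hab hR hA, by rw [e]; exact hR⟩, e⟩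
  · rintro z hz hS ⟨-, hr⟩
    refine ⟨hr, ?_⟩
    have e := h.endS_eq hr
    rw [rSq_fibrePoint hab hz] at e ⊢
    have hp : (2 * fibreS c u z.2 ^ (1 / 4 : ℝ)) ^ 4 / 16 = fibreS c u z.2 := by
      rw [mul_pow, ← Real.rpow_mul_natCast hS.le]
      norm_num
    rw [hp] at e
    have : fibreS c u z.2 = c + (dot z.2 z.2 + u ^ 2) := rfl
    linarith
  · exact fun q hq => hq.1.1
  · intro q hq
    have hp : 0 < c + rSq q := hq.1.1.1.2
    refine contDiffAt_const.mul (ContDiffAt.rpow_const_of_ne ?_ hp.ne')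
    unfold rSq
    fun_prop

end IsEndRadius

/-- The coefficients of the induced metric minus the cone metric, multiplied by `R ^ 2`, as
functions of `z = 1 / R`; here `p = 1 / endC`, `q = endρ / (R ^ 2 / 4)` and `r = 1 / q`. -/
def endDefect (c u v : ℝ) (p q r : ℝ → ℝ) : Option (Fin 3) → Option (Fin 3) → ℝ → ℝ
  | none, none => fun z => 4 * u ^ 2 * v ^ 4 * z ^ 6 * p z ^ 6 +
      (16 * u ^ 2 * v ^ 2 * z ^ 4 * p z ^ 4 + 64 * u ^ 4 * v ^ 4 * z ^ 10 * p z ^ 8 +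
        16 * z ^ 2 * (c + u ^ 2 * p z ^ 2)) * r z ^ 2 + (v ^ 4 * z ^ 2 * p z ^ 2 + v ^ 2) / 2
  | none, some 2 => fun z => z * √2 * (u * v ^ 3 * z ^ 2 * q z * p z ^ 3 +
      (2 + 16 * u ^ 2 * v ^ 2 * z ^ 6 * p z ^ 4) * (u * v * r z * p z))
  | some 2, none => fun z => z * √2 * (u * v ^ 3 * z ^ 2 * q z * p z ^ 3 +
      (2 + 16 * u ^ 2 * v ^ 2 * z ^ 6 * p z ^ 4) * (u * v * r z * p z))
  | some 0, some 0 => fun z => -(16 * z ^ 2 * (c + u ^ 2 * p z ^ 2))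
  | some 0, some 1 => fun z => 2 * √2 * q z * u * v * z * p z
  | some 1, some 0 => fun z => 2 * √2 * q z * u * v * z * p z
  | some 1, some 1 => fun z => 8 * u ^ 2 * v ^ 2 * z ^ 4 * p z ^ 2 - v ^ 2
  | some 2, some 2 => fun z => v ^ 2 * q z ^ 2 / 2 + 8 * u ^ 2 * v ^ 2 * z ^ 4 * p z ^ 2 - v ^ 2
  | _, _ => fun _ => 0

theorem analyticAt_endDefect {c u v z : ℝ} {p q r : ℝ → ℝ} (hp : AnalyticAt ℝ p z)
    (hq : AnalyticAt ℝ q z) (hr : AnalyticAt ℝ r z) (i j : Option (Fin 3)) :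
    AnalyticAt ℝ (endDefect c u v p q r i j) z := by
  rcases i with _ | i <;> rcases j with _ | j
  · unfold endDefect; fun_prop
  · fin_cases j <;> simp only [endDefect, Fin.reduceFinMk, Fin.zero_eta, Fin.mk_one] <;> fun_prop
  · fin_cases i <;> simp only [endDefect, Fin.reduceFinMk, Fin.zero_eta, Fin.mk_one] <;> fun_prop
  · fin_cases i <;> fin_cases j <;>
      simp only [endDefect, Fin.reduceFinMk, Fin.zero_eta, Fin.mk_one] <;> fun_prop

/-- `endC` as a function of `z = 1 / R`. -/
def endCz (v z : ℝ) : ℝ := √(1 - v ^ 2 * z ^ 2)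

/-- `endρ / (R ^ 2 / 4)` as a function of `z = 1 / R`. -/
def endq (c u v z : ℝ) : ℝ := √(1 - 16 * z ^ 4 * (c + u ^ 2 * ((endCz v z)⁻¹) ^ 2))

theorem analyticAt_endCz (v : ℝ) : AnalyticAt ℝ (endCz v) 0 := by
  refine ContDiffAt.analyticAt (ContDiffAt.sqrt ?_ (by norm_num))
  fun_prop

theorem endCz_zero (v : ℝ) : endCz v 0 = 1 := by simp [endCz]

theorem analyticAt_endCz_inv (v : ℝ) : AnalyticAt ℝ (fun z => (endCz v z)⁻¹) 0 :=
  (analyticAt_endCz v).inv (by simp [endCz_zero])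

theorem analyticAt_endq (c u v : ℝ) : AnalyticAt ℝ (endq c u v) 0 := by
  refine ContDiffAt.analyticAt (ContDiffAt.sqrt ?_ (by simp))
  refine AnalyticAt.contDiffAt ?_
  have := analyticAt_endCz_inv v
  fun_prop

theorem analyticAt_endq_inv (c u v : ℝ) : AnalyticAt ℝ (fun z => (endq c u v z)⁻¹) 0 :=
  (analyticAt_endq c u v).inv (by simp [endq])

/-! ### Expansion of the end metric in powers of `1 / R` -/

namespace IsEndRadius

variable {c u v R₀ : ℝ}

theorem endCz_inv_eq (v R : ℝ) : endCz v R⁻¹ = endC v R := by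
  rw [endCz, endC, div_eq_mul_inv, mul_pow]

/-- Uses `u² + τ² = u² / C²`, which follows from `τ = -u Y / C` and `C² + Y² = 1`. -/
theorem endρ_eq (h : IsEndRadius c u v R₀) {R : ℝ} (hR : R₀ < R) :
    endρ c u v R = R ^ 2 / 4 * endq c u v R⁻¹ := by
  have hR0 : 0 < R := h.nonneg.trans_lt hR
  have hC := h.C_pos R hR
  have hC' := Real.sq_sqrt hC.le
  rw [endρ, endq, endCz_inv_eq, ← Real.sqrt_sq (by positivity : 0 ≤ R ^ 2 / 4),
    ← Real.sqrt_mul (sq_nonneg _)]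
  congr 1
  rw [endτ, ← endC] at *
  have hK : endC v R ≠ 0 := (Real.sqrt_pos.2 hC).ne'
  field_simp at hC' ⊢
  linear_combination -256 * u ^ 2 * hC'

theorem endq_pos (h : IsEndRadius c u v R₀) {R : ℝ} (hR : R₀ < R) : 0 < endq c u v R⁻¹ := by
  have h1 := h.isFibreCurve.ρ_pos R hR
  rw [h.endρ_eq hR] at h1
  exact pos_of_mul_pos_right h1 (by positivity)

theorem hasDerivAt_const_div (v : ℝ) {R : ℝ} (hR : R ≠ 0) :
    HasDerivAt (fun R => v / R) (-v / R ^ 2) R := by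
  convert! (hasDerivAt_inv hR).const_mul v using 1
  ring

theorem deriv_endC (h : IsEndRadius c u v R₀) {R : ℝ} (hR : R₀ < R) :
    deriv (endC v) R = v ^ 2 / (R ^ 3 * endC v R) := by
  have hR0 : 0 < R := h.nonneg.trans_lt hR
  have h1 := hasDerivAt_const_div v hR0.ne'
  have h2 := (((h1.pow 2).const_sub 1).sqrt (h.C_pos R hR).ne').deriv
  refine h2.trans ?_
  change _ / (2 * endC v R) = _
  have := h.isFibreCurve.C_pos R hR
  field_simp
  simp
  field_simp

theorem deriv_endτ (h : IsEndRadius c u v R₀) {R : ℝ} (hR : R₀ < R) :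
    deriv (endτ u v) R = u * v / (R ^ 2 * endC v R ^ 3) := by
  have hR0 : 0 < R := h.nonneg.trans_lt hR
  have hC := h.isFibreCurve.C_pos R hR
  have h1 := hasDerivAt_const_div v hR0.ne'
  have h2 : HasDerivAt (endC v) (v ^ 2 / (R ^ 3 * endC v R)) R := by
    rw [← h.deriv_endC hR]
    exact ((h.isFibreCurve.contDiffAt_C R hR).differentiableAt (by simp)).hasDerivAt
  have h3 := ((h1.const_mul u).neg.div h2 hC.ne').deriv
  refine h3.trans ?_
  have hs := h.isFibreCurve.sphere R hR
  simp only [Pi.neg_apply]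
  field_simp at hs ⊢
  linear_combination u * v * hs

theorem deriv_endρ (h : IsEndRadius c u v R₀) {R : ℝ} (hR : R₀ < R) :
    deriv (endρ c u v) R =
      (R / 2 + 4 * u ^ 2 * v ^ 2 / (R ^ 5 * endC v R ^ 4)) / endq c u v R⁻¹ := by
  have hR0 : 0 < R := h.nonneg.trans_lt hR
  have hC := h.isFibreCurve.C_pos R hR
  have hq := h.endq_pos hR
  have h2 : HasDerivAt (endτ u v) (u * v / (R ^ 2 * endC v R ^ 3)) R := by
    rw [← h.deriv_endτ hR]
    exact ((h.isFibreCurve.contDiffAt_τ R hR).differentiableAt (by simp)).hasDerivAt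
  have h3 := ((((((hasDerivAt_pow 4 R).div_const 16).sub_const c).sub_const (u ^ 2)).sub
    (h2.pow 2)).sqrt (h.ρ_pos R hR).ne').deriv
  refine h3.trans ?_
  change _ / (2 * endρ c u v R) = _
  rw [h.endρ_eq hR, endτ]
  simp only [Nat.cast_ofNat, Nat.add_one_sub_one, pow_one]
  field_simp
  ring

theorem metricDifference_eq (h : IsEndRadius c u v R₀) {a b : ℝ} (hab : a ^ 2 + b ^ 2 = 1) {R : ℝ}
    (hR : R₀ < R) {A : Fin 3 → Fin 3 → ℝ} (hA : A ∈ SO3) (I : Fin 2 → Option (Fin 3)) :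
    metricDifference acLink (bsMetric c)
        (orbitMap a b u (endC v) (endτ u v) (endρ c u v) (fun R => v / R)) I (R, A) =
      R ^ (-2 : ℝ) * endDefect c u v (fun z => (endCz v z)⁻¹) (endq c u v)
        (fun z => (endq c u v z)⁻¹) (I 0) (I 1) R⁻¹ := by
  have hR0 : 0 < R := h.nonneg.trans_lt hR
  have hC := h.isFibreCurve.C_pos R hR
  have hs := h.isFibreCurve.sphere R hR
  have hq := h.endq_pos hR
  have hq2 : endq c u v R⁻¹ ^ 2 = 1 - 16 * R⁻¹ ^ 4 * (c + u ^ 2 * ((endC v R)⁻¹) ^ 2) := by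
    rw [← endCz_inv_eq]
    refine Real.sq_sqrt ?_
    by_contra hn
    have : endq c u v R⁻¹ = 0 := Real.sqrt_eq_zero_of_nonpos (le_of_not_ge hn)
    exact hq.ne' this
  have hW : √(c + (endτ u v R ^ 2 + endρ c u v R ^ 2 + u ^ 2)) = R ^ 2 / 4 := by
    rw [h.endS_eq hR, show R ^ 4 / 16 = (R ^ 2 / 4) ^ 2 by ring, Real.sqrt_sq (by positivity)]
  rw [h.isFibreCurve.metricDifference_eq_gramDefect hab acLink hR hW hA, h.deriv_endC hR,
    h.deriv_endτ hR, h.deriv_endρ hR, (hasDerivAt_const_div v hR0.ne').deriv,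
    h.endρ_eq hR, endτ]
  have hpow : R ^ (-2 : ℝ) = (R ^ 2)⁻¹ := by
    rw [Real.rpow_neg hR0.le]
    norm_cast
  have h2 : √2 ^ 2 = (2 : ℝ) := Real.sq_sqrt (by norm_num)
  have h2p : 0 < √(2 : ℝ) := by positivity
  have hs0 : (R * √(acLink 0))⁻¹ = 2 * R⁻¹ := by
    have : √(acLink 0) = 1 / 2 := by
      rw [acLink, show (![1 / 4, 1 / 2, 1 / 2] : Fin 3 → ℝ) 0 = (1 / 2) ^ 2 by norm_num]
      exact Real.sqrt_sq (by norm_num)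
    rw [this]
    field_simp
  have hs1 : (R * √(acLink 1))⁻¹ = √2 * R⁻¹ := by
    rw [acLink, show (![1 / 4, 1 / 2, 1 / 2] : Fin 3 → ℝ) 1 = 1 / 2 by norm_num]
    rw [Real.sqrt_div zero_le_one, Real.sqrt_one]
    field_simp
  have hs2 : (R * √(acLink 2))⁻¹ = √2 * R⁻¹ := hs1
  rw [hpow]
  generalize I 0 = i
  generalize I 1 = j
  have hK2 : endC v R ^ 2 = 1 - v ^ 2 / R ^ 2 := by rw [← hs]; ring
  generalize hk : (fun i => (R * √(acLink i))⁻¹) = s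
  replace hs0 : s 0 = 2 * R⁻¹ := (congrFun hk 0).symm.trans hs0
  replace hs1 : s 1 = √2 * R⁻¹ := (congrFun hk 1).symm.trans hs1
  replace hs2 : s 2 = √2 * R⁻¹ := (congrFun hk 2).symm.trans hs2
  rcases i with _ | i <;> rcases j with _ | j
  · simp only [gramDefect, endDefect, endCz_inv_eq]
    generalize endC v R = K at *
    generalize endq c u v R⁻¹ = Q at *
    field_simp at hq2 hK2 ⊢
    linear_combination -16 * R ^ 8 * K ^ 6 * hq2
  · fin_cases j <;> simp [gramDefect, endDefect, endCz_inv_eq, hs2]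
    generalize endC v R = K at *
    generalize endq c u v R⁻¹ = Q at *
    generalize √(2 : ℝ) = t at *
    field_simp
    ring
  · fin_cases i <;> simp [gramDefect, endDefect, endCz_inv_eq, hs2]
    generalize endC v R = K at *
    generalize endq c u v R⁻¹ = Q at *
    generalize √(2 : ℝ) = t at *
    field_simp
    ring
  · fin_cases i <;> fin_cases j <;> simp [gramDefect, endDefect, endCz_inv_eq, hs0, hs1, hs2]
    all_goals
      generalize endC v R = K at *
      generalize endq c u v R⁻¹ = Q at *
      generalize √(2 : ℝ) = t at *
      field_simp at hq2 hK2 ⊢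
    · linear_combination 4 * hq2
    · linear_combination (16 * u ^ 2 * v ^ 2 + 2 * R ^ 6 * K ^ 4) * h2 + 4 * R ^ 4 * K ^ 2 * hK2
    · linear_combination 2 * (v ^ 2 * (Q ^ 2 * R ^ 4 * K ^ 2 + u ^ 2 * 4 ^ 2) +
        2 * R ^ 6 * K ^ 4) * h2 + 8 * R ^ 4 * K ^ 2 * hK2
end IsEndRadius

/-! ### The compact core and the conclusion for the ends -/

theorem isCompact_sphere_rSq_le {c : ℝ} (hc : 0 ≤ c) (B : ℝ) :
    IsCompact {q : Ambient | (∀ i, |q.1 i| ≤ 1) ∧ c + rSq q ≤ B} := by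
  refine Metric.isCompact_of_isClosed_isBounded ?_ ?_
  · have e : {q : Ambient | (∀ i, |q.1 i| ≤ 1) ∧ c + rSq q ≤ B} =
        (⋂ i, {q : Ambient | |q.1 i| ≤ 1}) ∩ {q : Ambient | c + rSq q ≤ B} := by
      ext q
      simp
    rw [e]
    refine (isClosed_iInter fun i => isClosed_le (by fun_prop) continuous_const).inter
      (isClosed_le ?_ continuous_const)
    unfold rSq
    fun_prop
  · refine (Metric.isBounded_closedBall (x := (0 : Ambient)) (r := 1 + 4 * |B|)).subset ?_
    rintro ⟨p, η⟩ ⟨h1, h2⟩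
    have hB := abs_nonneg B
    rw [mem_closedBall_zero_iff, Prod.norm_def, max_le_iff]
    refine ⟨(pi_norm_le_iff_of_nonneg (by linarith)).2 fun i => ?_,
      (pi_norm_le_iff_of_nonneg (by linarith)).2 fun i =>
        (pi_norm_le_iff_of_nonneg (by linarith)).2 fun j => ?_⟩
    · exact (h1 i).trans (by linarith)
    · have h3 : η i j ^ 2 ≤ ∑ i, ∑ j, η i j ^ 2 :=
        (Finset.single_le_sum (f := fun j => η i j ^ 2) (fun _ _ => sq_nonneg _)
          (Finset.mem_univ j)).trans
          (Finset.single_le_sum (f := fun i => ∑ j, η i j ^ 2)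
            (fun _ _ => Finset.sum_nonneg fun _ _ => sq_nonneg _) (Finset.mem_univ i))
      have h4 : η i j ^ 2 ≤ 4 * |B| := by
        have := le_abs_self B
        simp only [rSq] at h2
        linarith
      rw [Real.norm_eq_abs]
      refine abs_le_of_sq_le_sq ?_ (by linarith)
      nlinarith

theorem lt_two_mul_rpow_iff {R s : ℝ} (hR : 0 ≤ R) (hs : 0 < s) :
    R < 2 * s ^ (1 / 4 : ℝ) ↔ R ^ 4 / 16 < s := by
  have h4 : (s ^ (1 / 4 : ℝ)) ^ 4 = s := by
    rw [← Real.rpow_mul_natCast hs.le]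
    norm_num
  have h0 : 0 < s ^ (1 / 4 : ℝ) := Real.rpow_pos_of_pos hs _
  rw [← pow_lt_pow_iff_left₀ hR (by positivity) (by norm_num : 4 ≠ 0), mul_pow, h4,
    div_lt_iff₀ (by norm_num)]
  norm_num [mul_comm]

theorem isAsymptoticallyConical_smoothFibre {c : ℝ} (hc : 0 ≤ c) (w : ℝ × ℝ × ℝ) :
    IsAsymptoticallyConical acLink (-2) (bsMetric c) (smoothFibre c w) := by
  refine ⟨isSmoothSubmanifold_smoothFibre c w, ?_⟩
  obtain ⟨u, v, a, b, -, hab, rfl⟩ := exists_polar w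
  obtain ⟨R₀, hR₀, h⟩ := exists_isEndRadius hc u v
  refine ⟨R₀, _, orbitMap a b u (endC v) (endτ u v) (endρ c u v) (fun R => v / R), hR₀,
    isCompact_sphere_rSq_le hc (R₀ ^ 4 / 16), ?_, fun j => ?_⟩
  -- Base points on the sphere have coordinates at most `1` in absolute value, so removing the
  -- compact set only imposes `R > R₀`.
  · convert! h.isDiffeoOn hab using 1
    ext q
    refine and_congr_right fun hq => ?_
    have h1 : ∀ i, |q.1 i| ≤ 1 := fun i => by
      have h2 : ∑ i, q.1 i ^ 2 = 1 := hq.1.1.1.1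
      have h3 := Finset.single_le_sum (f := fun i => q.1 i ^ 2) (fun _ _ => sq_nonneg _)
        (Finset.mem_univ i)
      exact abs_le_one_iff_mul_self_le_one.2 (by nlinarith)
    rw [mem_ofPred_eq, lt_two_mul_rpow_iff hR₀.le hq.1.1.2]
    simp [h1]
  · refine HasConeOrder.isBigO isConeParam_inv_atTop
      (HasConeOrder.iterCovDeriv isConeParam_inv_atTop ?_ acLink j)
    refine ⟨fun I => endDefect c u v (fun z => (endCz v z)⁻¹) (endq c u v)
      (fun z => (endq c u v z)⁻¹) (I 0) (I 1), fun I => analyticAt_endDefect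
        (analyticAt_endCz_inv v) (analyticAt_endq c u v) (analyticAt_endq_inv c u v) _ _, ?_⟩
    filter_upwards [eventually_gt_atTop R₀] with R hR A hA I
    exact h.metricDifference_eq hab hR hA I

/-- For `c = u = v = 0` the end curve exists from `R₀ = 0` on and every term of `endDefect` has a
zero factor. There is no vertex to remove, since `M₀` omits the zero section. -/
theorem isRiemannianCone_fibre_zero : IsRiemannianCone acLink (bsMetric 0) (fibre 0 0) := by
  have h0 : fibre 0 0 = smoothFibre 0 (0, 0 * 1, 0 * 0) := by
    rw [mul_one, mul_zero]
    refine (sdiff_eq_left.2 (Set.disjoint_left.2 ?_)).symm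
    rintro q hq hv
    have h1 := hq.1.2
    simp [rSq, hv.2.2.2] at h1
  have h : IsEndRadius 0 0 0 0 := by
    refine ⟨le_rfl, fun R hR => by simp, fun R hR => ?_⟩
    have : endτ 0 0 R = 0 := by simp [endτ]
    rw [this]
    simp only [sub_zero, ne_eq, OfNat.ofNat_ne_zero, not_false_eq_true, zero_pow]
    positivity
  have hab : (1 : ℝ) ^ 2 + (0 : ℝ) ^ 2 = 1 := by norm_num
  rw [h0]
  refine ⟨isSmoothSubmanifold_smoothFibre _ _,
    orbitMap 1 0 0 (endC 0) (endτ 0 0) (endρ 0 0 0) (fun R => 0 / R), ?_, fun x hx I => ?_⟩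
  · convert! h.isDiffeoOn hab using 1
    ext q
    refine (and_iff_left_of_imp fun hq => ?_).symm
    have := Real.rpow_pos_of_pos hq.1.1.2 (1 / 4 : ℝ)
    positivity
  · obtain ⟨R, A⟩ := x
    rw [h.metricDifference_eq hab hx.1 hx.2]
    generalize I 0 = i
    generalize I 1 = j
    rcases i with _ | i <;> rcases j with _ | j
    · simp [endDefect]
    · fin_cases j <;> simp [endDefect]
    · fin_cases i <;> simp [endDefect]
    · fin_cases i <;> fin_cases j <;> simp [endDefect]

/-! ### The conical singularities -/

theorem AnalyticAt.exists_eq_mul_of_zero {h : ℝ → ℝ} (hh : AnalyticAt ℝ h 0) (h0 : h 0 = 0) :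
    ∃ k : ℝ → ℝ, AnalyticAt ℝ k 0 ∧ ∀ s, h s = s * k s := by
  obtain ⟨p, hp⟩ := hh
  refine ⟨dslope h 0, ⟨_, hp.has_fpower_series_dslope_fslope⟩, fun s => ?_⟩
  have := sub_smul_dslope h 0 s
  rw [h0, sub_zero, sub_zero, smul_eq_mul] at this
  exact this.symm

/-- The distance of the base point from the vertex circle, `1 / (2 d)` times the radius. -/
def coneC (d R : ℝ) : ℝ := R / (2 * d)

/-- The radial component of the base point near the vertex. -/
def coneY (d R : ℝ) : ℝ := √(1 - coneC d R ^ 2)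

/-- The length of the form near the vertex, divided by the radius. -/
def coneg (d R : ℝ) : ℝ := d / 2 * √(2 - coneC d R ^ 2) / (1 - coneC d R ^ 2)

/-- The length of the form near the vertex. -/
def coneρ (d R : ℝ) : ℝ := R * coneg d R

/-- The square root of `c + r²` near the vertex. -/
def coneW (d R : ℝ) : ℝ := d ^ 2 / (1 - coneC d R ^ 2)

section
variable {d : ℝ}

theorem coneC_mem (hd : 0 < d) {R : ℝ} (hR : R ∈ Ioo 0 d) :
    0 < coneC d R ∧ coneC d R ^ 2 < 1 / 4 := by
  have h0 : 0 < coneC d R := div_pos hR.1 (by positivity)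
  have h1 : coneC d R < 1 / 2 := by
    rw [coneC, div_lt_iff₀ (by positivity)]
    linarith [hR.2]
  exact ⟨h0, by nlinarith⟩

/-- Origin of `coneg`: `d⁴ / (1 - C²)² - d⁴ = d⁴ C² (2 - C²) / (1 - C²)²`, and `C = R / (2 d)` lets
the root of `C²` come out as `R`, leaving a factor smooth at `0`. -/
theorem coneS_eq (hd : 0 < d) {R : ℝ} (hR : coneC d R ^ 2 < 1 / 4) :
    d ^ 4 + coneρ d R ^ 2 = coneW d R ^ 2 := by
  have h2 : √(2 - coneC d R ^ 2) ^ 2 = 2 - coneC d R ^ 2 := Real.sq_sqrt (by linarith)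
  have h1 : 1 - coneC d R ^ 2 ≠ 0 := by linarith
  have hR' : R = 2 * d * coneC d R := by rw [coneC]; field_simp
  rw [coneρ, coneg, coneW]
  generalize coneC d R = C at *
  subst hR'
  field_simp
  rw [h2]
  ring

theorem contDiff_coneC (d : ℝ) {n : WithTop ℕ∞} : ContDiff ℝ n (coneC d) := by
  unfold coneC
  fun_prop

theorem contDiffAt_coneY {n : WithTop ℕ∞} {R : ℝ} (hR : coneC d R ^ 2 < 1 / 4) :
    ContDiffAt ℝ n (coneY d) R :=
  (contDiffAt_const.sub ((contDiff_coneC d).contDiffAt.pow 2)).sqrt (by linarith)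

theorem contDiffAt_coneg {n : WithTop ℕ∞} {R : ℝ} (hR : coneC d R ^ 2 < 1 / 4) :
    ContDiffAt ℝ n (coneg d) R :=
  (contDiffAt_const.mul ((contDiffAt_const.sub ((contDiff_coneC d).contDiffAt.pow 2)).sqrt
    (by linarith))).div (contDiffAt_const.sub ((contDiff_coneC d).contDiffAt.pow 2)) (by linarith)

theorem contDiffAt_coneW {n : WithTop ℕ∞} {R : ℝ} (hR : coneC d R ^ 2 < 1 / 4) :
    ContDiffAt ℝ n (coneW d) R :=
  contDiffAt_const.div (contDiffAt_const.sub ((contDiff_coneC d).contDiffAt.pow 2)) (by linarith)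

theorem contDiffAt_coneρ {n : WithTop ℕ∞} {R : ℝ} (hR : coneC d R ^ 2 < 1 / 4) :
    ContDiffAt ℝ n (coneρ d) R :=
  contDiffAt_id.mul (contDiffAt_coneg hR)

theorem coneW_rpow (hd : 0 < d) {R : ℝ} (hR : coneC d R ^ 2 < 1 / 4) :
    2 * d / 2 * (coneW d R ^ 2) ^ (-(1 / 4) : ℝ) = coneY d R := by
  have h1 : 0 < 1 - coneC d R ^ 2 := by linarith
  have hY : 0 < coneY d R := Real.sqrt_pos.2 h1
  have h2 : coneW d R ^ 2 = (d / coneY d R) ^ (4 : ℕ) := by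
    rw [coneW, ← Real.sq_sqrt h1.le, ← coneY]
    ring
  rw [h2, ← Real.rpow_natCast_mul (by positivity)]
  norm_num
  rw [Real.rpow_neg_one]
  field_simp

theorem isFibreCurve_cone (hd : 0 < d) :
    IsFibreCurve (d ^ 4) 0 (2 * d) (Ioo 0 d) (coneC d) (fun _ => 0) (coneρ d) (coneY d) := by
  have hS : ∀ R ∈ Ioo 0 d, d ^ 4 + ((0 : ℝ) ^ 2 + coneρ d R ^ 2 + 0 ^ 2) = coneW d R ^ 2 := by
    intro R hR
    rw [← coneS_eq hd (coneC_mem hd hR).2]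
    ring
  refine ⟨isOpen_Ioo, fun R _ => (contDiff_coneC d).contDiffAt, fun R _ => contDiffAt_const,
    fun R hR => contDiffAt_coneρ (coneC_mem hd hR).2,
    fun R hR => contDiffAt_coneY (coneC_mem hd hR).2, fun R hR => (coneC_mem hd hR).1, ?_, ?_, ?_,
    ?_, ?_⟩
  · intro R hR
    have h := (coneC_mem hd hR).2
    have h1 : 0 < 1 - coneC d R ^ 2 := by linarith
    have h2 : 0 < √(2 - coneC d R ^ 2) := Real.sqrt_pos.2 (by linarith)
    have := hR.1
    unfold coneρ coneg
    positivity
  · intro R hR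
    rw [coneY, Real.sq_sqrt (by linarith [(coneC_mem hd hR).2])]
    ring
  · intro R _
    simp
  · intro R hR
    have : 0 < d ^ 4 := by positivity
    positivity
  · intro R hR
    rw [hS R hR, coneW_rpow hd (coneC_mem hd hR).2]

/-- For `u = 0`, `v = 2 d` the sphere equation reads `1 - C² = d² / √(c + r²)`, so `|x|` determines
`|f|`. -/
theorem dot_fibre_eq_of_base (hd : 0 < d) {z : (Fin 3 → ℝ) × (Fin 3 → ℝ)} {R : ℝ}
    (hR : coneC d R ^ 2 < 1 / 4) (hz : fibreEqs (d ^ 4) 0 (2 * d) z = 0)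
    (hz1 : dot z.1 z.1 = coneC d R ^ 2) : dot z.2 z.2 = coneρ d R ^ 2 := by
  have h1 := (fibreEqs_eq_zero_iff.1 hz).1
  set S := fibreS (d ^ 4) 0 z.2 with hS
  have hSe : S = d ^ 4 + dot z.2 z.2 := by rw [hS, fibreS]; ring
  have hS0 : 0 < S := by
    have := dot_self_nonneg z.2
    have : 0 < d ^ 4 := by positivity
    linarith
  have hY : fibreY (d ^ 4) 0 (2 * d) z.2 = d * (S ^ (1 / 4 : ℝ))⁻¹ := by
    rw [fibreY, ← hS, Real.rpow_neg hS0.le]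
    ring
  have h4 : (S ^ (1 / 4 : ℝ)) ^ 4 = S := by
    rw [← Real.rpow_mul_natCast hS0.le]
    norm_num
  have h0 : 0 < S ^ (1 / 4 : ℝ) := Real.rpow_pos_of_pos hS0 _
  rw [hY, hz1] at h1
  generalize S ^ (1 / 4 : ℝ) = t at *
  have hw := coneS_eq hd hR
  have h5 : coneW d R = t ^ 2 := by
    have : 1 - coneC d R ^ 2 = (d * t⁻¹) ^ 2 := by linarith
    rw [coneW, this]
    field_simp
  rw [h5] at hw
  linear_combination -hSe + h4.symm - hw

/-- The radius is `2 d |x|`, so `|x| < 1 / 2` is the range `R < d`. It is smooth and positive off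
the vertex, since `x = 0` forces `f = 0`. -/
theorem isDiffeoOn_cone (hd : 0 < d) {a b : ℝ} (hab : a ^ 2 + b ^ 2 = 1) :
    IsDiffeoOn (Ioo 0 d ×ˢ SO3)
      (smoothFibre (d ^ 4) (0, 2 * d * a, 2 * d * b) ∩
        {q | dot (basePart q) (basePart q) < 1 / 4})
      (orbitMap a b 0 (coneC d) (fun _ => 0) (coneρ d) (coneY d)) := by
  have h := isFibreCurve_cone hd
  have hpos : ∀ q ∈ smoothFibre (d ^ 4) (0, 2 * d * a, 2 * d * b),
      0 < dot (basePart q) (basePart q) := by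
    intro q hq
    rw [smoothFibre_eq_image hab] at hq
    obtain ⟨z, ⟨⟨hS, h0⟩, hz⟩, rfl⟩ := hq
    rw [fibrePoint, basePart_asdPoint]
    refine (dot_self_nonneg _).lt_of_ne fun hx => h0 ?_
    have hR : coneC d 0 ^ 2 < 1 / 4 := by norm_num [coneC]
    have h1 := dot_fibre_eq_of_base hd hR hz (by rw [← hx]; simp [coneC])
    rw [coneρ, zero_mul, zero_pow two_ne_zero] at h1
    exact Prod.ext (dot_self_eq_zero.1 hx.symm) (dot_self_eq_zero.1 h1)
  have hC {s : ℝ} (hs : 0 ≤ s) : coneC d (2 * d * √s) ^ 2 = s := by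
    rw [coneC, mul_div_cancel_left₀ _ (by positivity), Real.sq_sqrt hs]
  refine h.isDiffeoOn_orbitMap hab (rad := fun q => 2 * d * √(dot (basePart q) (basePart q)))
    ?_ ?_ ?_ ?_
  · intro R hR A hA
    have e : dot (basePart (orbitMap a b 0 (coneC d) (fun _ => 0) (coneρ d) (coneY d) (R, A)))
        (basePart (orbitMap a b 0 (coneC d) (fun _ => 0) (coneρ d) (coneY d) (R, A))) =
        coneC d R ^ 2 := by
      rw [IsFibreCurve.basePart_orbitMap, dot_act_act hA]
      simp [dot, pow_two]
    have hm := coneC_mem hd hR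
    refine ⟨⟨h.orbitMap_mem_smoothFibre hab hR hA, ?_⟩, ?_⟩
    · rw [mem_ofPred_eq, e]
      exact hm.2
    · simp only [e]
      rw [Real.sqrt_sq hm.1.le, coneC]
      field_simp
  · rintro z hz hS ⟨hq, hlt⟩
    have hp := hpos _ hq
    have hb : basePart (fibrePoint (d ^ 4) 0 (2 * d) a b z) = z.1 := basePart_asdPoint ..
    rw [hb] at hp
    rw [mem_ofPred_eq, hb] at hlt
    have h1 := hC hp.le
    simp only [hb]
    refine ⟨⟨by positivity, ?_⟩, ?_⟩
    · have : √(dot z.1 z.1) < 1 / 2 := by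
        rw [Real.sqrt_lt' (by norm_num)]
        linarith
      nlinarith
    · rw [dot_fibre_eq_of_base hd (R := 2 * d * √(dot z.1 z.1)) (by rw [h1]; exact hlt) hz h1.symm]
      ring
  · exact fun q hq => hq.1.1
  · intro q hq
    refine contDiffAt_const.mul (ContDiffAt.sqrt ?_ (hpos q hq.1).ne')
    have h1 (i : Fin 3) : ContDiffAt ℝ ∞ (fun q => basePart q i) q :=
      contDiffAt_pi.1 contDiff_basePart.contDiffAt i
    exact (((h1 0).mul (h1 0)).add ((h1 1).mul (h1 1))).add ((h1 2).mul (h1 2))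

theorem abs_act_le {A : Fin 3 → Fin 3 → ℝ} (hA : A ∈ SO3) (x : Fin 3 → ℝ) (k : Fin 3) :
    |act A x k| ≤ √(dot x x) := by
  rw [← dot_act_act hA]
  refine Real.abs_le_sqrt ?_
  fin_cases k <;> simp only [dot, Fin.zero_eta, Fin.mk_one, Fin.reduceFinMk] <;>
    nlinarith [sq_nonneg (act A x 0), sq_nonneg (act A x 1), sq_nonneg (act A x 2)]

theorem tendsto_act {l : Filter ℝ} {x : ℝ → Fin 3 → ℝ} (hx : Tendsto x l (𝓝 0)) :
    Tendsto (fun q : ConeSpace => act q.2 (x q.1)) (l ×ˢ 𝓟 SO3) (𝓝 0) := by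
  rw [tendsto_pi_nhds]
  intro k
  have h1 : Tendsto (fun R => √(dot (x R) (x R))) l (𝓝 0) := by
    have hi (i : Fin 3) : Tendsto (fun R => x R i) l (𝓝 0) := (tendsto_pi_nhds.1 hx) i
    have h2 := ((((hi 0).mul (hi 0)).add ((hi 1).mul (hi 1))).add ((hi 2).mul (hi 2))).sqrt
    simpa [dot] using h2
  refine squeeze_zero_norm' ?_ (h1.comp tendsto_fst)
  rw [eventually_prod_principal_iff]
  exact Eventually.of_forall fun R A hA => abs_act_le hA _ k

theorem tendsto_orbitMap_cone (d a b : ℝ) :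
    Tendsto (orbitMap a b 0 (coneC d) (fun _ => 0) (coneρ d) (coneY d)) (𝓝[>] 0 ×ˢ 𝓟 SO3)
      (𝓝 (asdPoint a b 0 0 0 1)) := by
  have hR : coneC d 0 ^ 2 < 1 / 4 := by norm_num [coneC]
  have hC : Tendsto (coneC d) (𝓝[>] 0) (𝓝 0) := by
    refine tendsto_nhdsWithin_of_tendsto_nhds ?_
    simpa [coneC] using ((contDiff_coneC d (n := 0)).continuous.tendsto 0)
  have hρ : Tendsto (coneρ d) (𝓝[>] 0) (𝓝 0) := by
    refine tendsto_nhdsWithin_of_tendsto_nhds ?_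
    simpa [coneρ] using (contDiffAt_coneρ (n := 0) hR).continuousAt.tendsto
  have hY : Tendsto (coneY d) (𝓝[>] 0) (𝓝 1) := by
    refine tendsto_nhdsWithin_of_tendsto_nhds ?_
    simpa [coneY, coneC] using (contDiffAt_coneY (n := 0) hR).continuousAt.tendsto
  have h1 : Tendsto (fun R => ![coneC d R, 0, 0]) (𝓝[>] 0) (𝓝 0) := by
    rw [tendsto_pi_nhds]
    intro i
    fin_cases i
    exacts [hC, tendsto_const_nhds, tendsto_const_nhds]
  have h2 : Tendsto (fun R => ![(0 : ℝ), 0, coneρ d R]) (𝓝[>] 0) (𝓝 0) := by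
    rw [tendsto_pi_nhds]
    intro i
    fin_cases i
    exacts [tendsto_const_nhds, tendsto_const_nhds, hρ]
  have h3 := ((contDiff_asdPoint (n := 0) (a := a) (b := b) (u := 0)).continuous.tendsto
    ((0 : Fin 3 → ℝ), (0 : Fin 3 → ℝ), (1 : ℝ)))
  exact h3.comp ((tendsto_act h1).prodMk_nhds ((tendsto_act h2).prodMk_nhds
    (hY.comp tendsto_fst)))

end

/-! ### Expansion of the metric at the vertex -/

section
variable {d : ℝ}

/-- The components of the induced metric minus the cone metric, near the vertex. -/
def coneDefect (d : ℝ) : Option (Fin 3) → Option (Fin 3) → ℝ → ℝ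
  | none, none => fun R => (coneW d R)⁻¹ * deriv (coneρ d) R ^ 2 +
      2 * coneW d R * (1 / (2 * d) ^ 2 + deriv (coneY d) R ^ 2) - 1
  | some 0, some 0 => fun R => 2 * (coneW d R)⁻¹ * coneg d R ^ 2 - 1
  | some 1, some 1 => fun R => coneW d R * (1 / d ^ 2) - 1
  | some 2, some 2 => fun R => (coneW d R)⁻¹ * coneY d R ^ 2 * coneg d R ^ 2 +
      coneW d R * (1 / (2 * d ^ 2)) - 1
  | _, _ => fun _ => 0

theorem coneC_zero_sq_lt (d : ℝ) : coneC d 0 ^ 2 < 1 / 4 := by norm_num [coneC]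

theorem coneW_zero (d : ℝ) : coneW d 0 = d ^ 2 := by simp [coneW, coneC]

theorem coneg_zero (d : ℝ) : coneg d 0 = d / 2 * √2 := by simp [coneg, coneC]

theorem coneY_zero (d : ℝ) : coneY d 0 = 1 := by simp [coneY, coneC]

theorem deriv_coneρ_zero (d : ℝ) : deriv (coneρ d) 0 = coneg d 0 := by
  have h := ((contDiffAt_coneg (n := 1) (coneC_zero_sq_lt d)).differentiableAt (by simp)).hasDerivAt
  have : deriv (coneρ d) 0 = _ := ((hasDerivAt_id (0 : ℝ)).mul h).deriv
  exact this.trans (by simp)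

theorem deriv_coneY_zero (d : ℝ) : deriv (coneY d) 0 = 0 := by
  have h1 : HasDerivAt (coneC d) (1 / (2 * d)) 0 := (hasDerivAt_id (0 : ℝ)).div_const (2 * d)
  have h2 := (((h1.pow 2).const_sub 1).sqrt (by norm_num [coneC])).deriv
  refine h2.trans ?_
  simp [coneC]

theorem analyticAt_coneDefect (hd : 0 < d) (i j : Option (Fin 3)) :
    AnalyticAt ℝ (coneDefect d i j) 0 := by
  have h0 := coneC_zero_sq_lt d
  have hW := (contDiffAt_coneW (n := ω) h0).analyticAt
  have hWi : AnalyticAt ℝ (fun R => (coneW d R)⁻¹) 0 :=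
    hW.inv (by rw [coneW_zero]; positivity)
  have hg := (contDiffAt_coneg (n := ω) h0).analyticAt
  have hY := (contDiffAt_coneY (n := ω) h0).analyticAt
  have hρ' := (contDiffAt_coneρ (n := ω) h0).analyticAt.deriv
  have hY' := hY.deriv
  rcases i with _ | i <;> rcases j with _ | j
  · unfold coneDefect; fun_prop
  · unfold coneDefect; fun_prop
  · fin_cases i <;> unfold coneDefect <;> fun_prop
  · fin_cases i <;> fin_cases j <;>
      simp only [coneDefect, Fin.reduceFinMk, Fin.zero_eta, Fin.mk_one] <;> fun_prop

/-- At `R = 0` one has `W = d²`, `ρ' = coneg = d / √2`, `Y = 1`, `Y' = 0`; the cone `csLink` is the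
one whose coefficients match these values. -/
theorem coneDefect_zero (hd : 0 < d) (i j : Option (Fin 3)) : coneDefect d i j 0 = 0 := by
  have h2 : √2 ^ 2 = (2 : ℝ) := Real.sq_sqrt (by norm_num)
  rcases i with _ | i <;> rcases j with _ | j
  · simp only [coneDefect, coneW_zero, deriv_coneρ_zero, deriv_coneY_zero, coneg_zero, mul_pow, h2]
    field_simp
    ring
  · simp [coneDefect]
  · fin_cases i <;> simp [coneDefect]
  · fin_cases i <;> fin_cases j <;> simp [coneDefect, coneW_zero, coneY_zero, coneg_zero, mul_pow]
    all_goals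
      field_simp
      try ring

/-- As `τ = 0`, the mixed terms vanish, and the factors `R` in `coneρ` and `coneC` cancel the `R⁻¹`
of the frame. -/
theorem metricDifference_cone (hd : 0 < d) {a b : ℝ} (hab : a ^ 2 + b ^ 2 = 1) {R : ℝ}
    (hR : R ∈ Ioo 0 d) {A : Fin 3 → Fin 3 → ℝ} (hA : A ∈ SO3) (I : Fin 2 → Option (Fin 3)) :
    metricDifference csLink (bsMetric (d ^ 4))
        (orbitMap a b 0 (coneC d) (fun _ => 0) (coneρ d) (coneY d)) I (R, A) =
      coneDefect d (I 0) (I 1) R := by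
  have hR0 := hR.1
  have h := isFibreCurve_cone hd
  have hm := coneC_mem hd hR
  have hWp : 0 < coneW d R := div_pos (by positivity) (by linarith)
  have hW : √(d ^ 4 + ((0 : ℝ) ^ 2 + coneρ d R ^ 2 + 0 ^ 2)) = coneW d R := by
    rw [show d ^ 4 + ((0 : ℝ) ^ 2 + coneρ d R ^ 2 + 0 ^ 2) = d ^ 4 + coneρ d R ^ 2 by ring,
      coneS_eq hd hm.2, Real.sqrt_sq hWp.le]
  have hC' : deriv (coneC d) R = 1 / (2 * d) := ((hasDerivAt_id R).div_const (2 * d)).deriv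
  have h2 : √2 ^ 2 = (2 : ℝ) := Real.sq_sqrt (by norm_num)
  have hs0 : (R * √(csLink 0))⁻¹ = √2 * R⁻¹ := by
    rw [csLink, show (![1 / 2, 1 / 2, 1] : Fin 3 → ℝ) 0 = 1 / 2 by norm_num]
    rw [Real.sqrt_div zero_le_one, Real.sqrt_one]
    field_simp
  have hs1 : (R * √(csLink 1))⁻¹ = √2 * R⁻¹ := hs0
  have hs2 : (R * √(csLink 2))⁻¹ = R⁻¹ := by
    rw [csLink, show (![1 / 2, 1 / 2, 1] : Fin 3 → ℝ) 2 = 1 by simp, Real.sqrt_one, mul_one]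
  rw [h.metricDifference_eq_gramDefect hab csLink hR hW hA, hC', deriv_const]
  generalize I 0 = i
  generalize I 1 = j
  generalize hk : (fun i => (R * √(csLink i))⁻¹) = s
  replace hs0 : s 0 = √2 * R⁻¹ := (congrFun hk 0).symm.trans hs0
  replace hs1 : s 1 = √2 * R⁻¹ := (congrFun hk 1).symm.trans hs1
  replace hs2 : s 2 = R⁻¹ := (congrFun hk 2).symm.trans hs2
  rcases i with _ | i <;> rcases j with _ | j
  · simp only [gramDefect, coneDefect]
    ring
  · fin_cases j <;> simp [gramDefect, coneDefect]
  · fin_cases i <;> simp [gramDefect, coneDefect]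
  · fin_cases i <;> fin_cases j <;>
      simp [gramDefect, coneDefect, hs0, hs1, hs2, coneρ, coneC, mul_pow]
    all_goals
      field_simp
      try ring

end

theorem isConicallySingularAt_smoothFibre {c : ℝ} (hc : 0 < c) {w : ℝ × ℝ × ℝ}
    (hw : w ∈ singularValues c) : ∃ p : Ambient, fibre c w ∩ vertices = {p} ∧
      IsConicallySingularAt csLink (bsMetric c) (smoothFibre c w) p := by
  have hsm := isSmoothSubmanifold_smoothFibre c w
  obtain ⟨u, v, a, b, hv, hab, rfl⟩ := exists_polar w
  obtain ⟨hu, hw⟩ := hw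
  simp only at hu hw
  subst hu
  obtain ⟨d, hd, rfl⟩ : ∃ d, 0 < d ∧ d ^ 4 = c :=
    ⟨c ^ (1 / 4 : ℝ), Real.rpow_pos_of_pos hc _, by
      rw [← Real.rpow_mul_natCast hc.le]
      norm_num⟩
  have hd4 : (d ^ 4) ^ (1 / 4 : ℝ) = d := by
    rw [← Real.rpow_natCast_mul hd.le]
    norm_num
  have hv2 : v = 2 * d := by
    rw [hd4] at hw
    refine (pow_left_inj₀ hv (by positivity) two_ne_zero).1 ?_
    linear_combination hw - v ^ 2 * hab
  subst hv2
  have hY0 : fibreY (d ^ 4) 0 (2 * d) 0 = 1 := by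
    have := coneW_rpow hd (coneC_zero_sq_lt d)
    rw [coneW_zero, coneY_zero] at this
    rw [← this, fibreY, fibreS]
    norm_num [dot, ← pow_mul]
  have hp0 : fibreEqs (d ^ 4) 0 (2 * d) 0 = 0 := by
    rw [fibreEqs_eq_zero_iff]
    simp [hY0, dot]
  have hp : fibrePoint (d ^ 4) 0 (2 * d) a b 0 = asdPoint a b 0 0 0 1 := by
    simp [fibrePoint, hY0]
  have hpv : asdPoint a b 0 0 0 1 ∈ vertices := by
    rw [← hp, fibrePoint_mem_vertices_iff hab hp0]
  refine ⟨asdPoint a b 0 0 0 1, ?_, hsm, fun hmem => hmem.2 hpv, 1, d,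
    {q | dot (basePart q) (basePart q) < 1 / 4},
    orbitMap a b 0 (coneC d) (fun _ => 0) (coneρ d) (coneY d), one_pos, hd, ?_, ?_,
    isDiffeoOn_cone hd hab, tendsto_orbitMap_cone d a b, fun j => ?_⟩
  · rw [fibre_eq_image hab]
    ext q
    constructor
    · rintro ⟨⟨z, ⟨-, hz⟩, rfl⟩, hq⟩
      rw [(fibrePoint_mem_vertices_iff hab hz).1 hq]
      exact hp
    · rintro rfl
      refine ⟨⟨0, ⟨?_, hp0⟩, hp⟩, hpv⟩
      simp [fibreS, dot]
      positivity
  · have hc : Continuous (fun q => dot (basePart q) (basePart q)) := by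
      have h1 (i : Fin 3) : Continuous (fun q => basePart q i) :=
        (continuous_apply i).comp (contDiff_basePart (n := 0)).continuous
      exact (((h1 0).mul (h1 0)).add ((h1 1).mul (h1 1))).add ((h1 2).mul (h1 2))
    exact isOpen_lt hc continuous_const
  · rw [mem_ofPred_eq, basePart_asdPoint]
    norm_num [dot]
  · refine HasConeOrder.isBigO isConeParam_id
      (HasConeOrder.iterCovDeriv isConeParam_id ?_ csLink j)
    -- Dividing out the zero at `R = 0` exhibits the difference as `R ^ 1` times an analytic
    -- function; hence the rate `1`.
    choose k hk hkz using fun I : Fin 2 → Option (Fin 3) =>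
      (analyticAt_coneDefect hd (I 0) (I 1)).exists_eq_mul_of_zero (coneDefect_zero hd (I 0) (I 1))
    refine ⟨k, hk, ?_⟩
    filter_upwards [Ioo_mem_nhdsGT hd] with R hR A hA I
    rw [metricDifference_cone hd hab hR hA, hkz, Real.rpow_one]

end

theorem proposition4p9 :
    (∀ c : ℝ, 0 ≤ c → ∀ w : ℝ × ℝ × ℝ,
      IsAsymptoticallyConical acLink (-2) (bsMetric c) (smoothFibre c w)) ∧
    (∀ c : ℝ, 0 < c → ∀ w ∈ singularValues c, ∃ p : Ambient, fibre c w ∩ vertices = {p} ∧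
      IsConicallySingularAt csLink (bsMetric c) (smoothFibre c w) p) ∧
    IsRiemannianCone acLink (bsMetric 0) (fibre 0 0) :=
  ⟨fun _ hc w => isAsymptoticallyConical_smoothFibre hc w,
    fun _ hc _ hw => isConicallySingularAt_smoothFibre hc hw, isRiemannianCone_fibre_zero⟩
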